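/- Let $N$ be a connected, simply connected nilpotent (real, finite-dimensional) Lie group with Lie algebra $\mathfrak n$ and center $Z(N)$, let $\mathfrak z$ be the center of $\mathfrak n$, and let $\Gamma\subset N$ be a discrete subgroup such that $N/\Gamma$ is compact. Let $L\colon N/\Gamma\to N/\Gamma$ be an Anosov automorphism, i.e. the map $g\Gamma\mapsto L(g)\Gamma$ induced by a Lie group automorphism $L$ of $N$ with $L(\Gamma)=\Gamma$ such that $D_eL\colon\mathfrak n\to\mathfrak n$ has no eigenvalue of modulus one. Suppose that $L$ has simple spectrum: the eigenvalues of $D_eL$, counted with multiplicity, have pairwise distinct moduli. Suppose that $w\in\mathfrak z$ and $u\in\mathfrak n\setminus\mathfrak z$ are eigenvectors of $D_eL$ with eigenvalues $\lambda_w,\lambda_u$ such that $1<|\lambda_w|<|\lambda_u|$. A conjugacy from $f$ to $g$ is a homeomorphism $h$ of $N/\Gamma$ with $h\circ f=g\circ h$; $f$ and $g$ have the same periodic data with respect to $h$ if, whenever $f^k(p)=p$ with $k\ge1$, the linear maps $D_pf^k$ and $D_{h(p)}g^k$ are conjugate. A map is $C^{1+}$ if it is $C^1$ with $\theta$-Hölder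 derivative for some $\theta>0$; a $C^{1+}$ diffeomorphism is a $C^{1+}$ bijection with $C^{1+}$ inverse. Let $\operatorname{vol}$ be the $N$-invariant probability measure on $N/\Gamma$. Then: 1. $L$ is not locally Lyapunov spectrum rigid: there is no $C^1$ neighborhood $\mathcal U$ of $L$ such that every $\operatorname{vol}$-preserving $C^{1+}$ diffeomorphism $g\in\mathcal U$ with the same Lyapunov spectrum (with multiplicity) with respect to $\operatorname{vol}$ as $L$ admits a $C^{1+}$ conjugacy from $L$ to $g$. 2. $L$ is not locally periodic data rigid: there is no $C^1$ neighborhood $\mathcal U$ of $L$ such that, for every $C^{1+}$ diffeomorphism $g\in\mathcal U$, each conjugacy $h$ from $L$ to $g$ with respect to which $L$ and $g$ have the same periodic data is $C^{1+}$. 3. For a smooth function $\phi\colon N/\Gamma\to\mathbb R$ that is invariant under left translation by $Z(N)$ (that is, a smooth function on the quotient nilmanifold $N/Z(N)\Gamma$) let $L_\phi(x)=\exp(\phi(x)w)\cdot L(x)$. Then every $L_\phi$ is a $C^\infty$ diffeomorphism, there is a conjugacy from $L$ to $L_\phi$, and $L$ and $L_\phi$ have the same periodic data with respect to every such conjugacy.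 Moreover, for every neighborhood $\mathcal V$ of $0$ in $C^\infty(N/\Gamma,\mathbb R)$ and every $C^\infty$ neighborhood $\mathcal W$ of $L$ there is such a $\phi\in\mathcal V$ with $L_\phi\in\mathcal W$ for which no conjugacy $h$ from $L$ to $L_\phi$ is Lipschitz, nor is $h^{-1}$. -/

import Mathlib

open Set Filter Topology MeasureTheory
open scoped Manifold ContDiff NNReal

noncomputable section

namespace Nilmanifold

/-! ### Maps between manifolds without boundary: regularity and `C^r` topologies -/

section Regularity

variable {E : Type*} [NormedAddCommGroup E] [NormedSpace ℝ E]
  {M : Type*} [TopologicalSpace M] [ChartedSpace E M]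
  {E' : Type*} [NormedAddCommGroup E'] [NormedSpace ℝ E']
  {M' : Type*} [TopologicalSpace M'] [ChartedSpace E' M']

/-- The basic open sets of the (compact-open) `C^r` topology. Given a `C^r` map `f`, charts `c` of
`M` and `d` of `M'`, a compact set `K` in the domain of `c` which `f` maps to the domain of `d`, an
integer `k ≤ r` and `ε > 0`, the set consists of all `g` that map `K` to the domain of `d` and whose
derivatives of order at most `k`, read in `c` and `d`, are `ε`-close on `K` to those of `f`. -/
def crBasicOpen (k : ℕ) (f : M → M') (c : OpenPartialHomeomorph M E)
    (d : OpenPartialHomeomorph M' E') (K : Set M) (ε : ℝ) : Set (M → M') :=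
  {g | MapsTo g K d.source ∧ ∀ x ∈ K, ∀ i ≤ k,
    ‖iteratedFDeriv ℝ i (d ∘ g ∘ c.symm) (c x) - iteratedFDeriv ℝ i (d ∘ f ∘ c.symm) (c x)‖ < ε}

/-- The compact-open `C^r` topology, `r ≤ ∞`. It is written as a topology on all maps `M → M'`, and
is meant to be restricted to the `C^r` maps. On a compact manifold it is *the* `C^r` topology. -/
abbrev crTopology (E : Type*) [NormedAddCommGroup E] [NormedSpace ℝ E]
    (M : Type*) [TopologicalSpace M] [ChartedSpace E M]
    (E' : Type*) [NormedAddCommGroup E'] [NormedSpace ℝ E']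
    (M' : Type*) [TopologicalSpace M'] [ChartedSpace E' M'] (r : ℕ∞) :
    TopologicalSpace (M → M') :=
  TopologicalSpace.generateFrom
    {S | ∃ (k : ℕ) (f : M → M') (c : OpenPartialHomeomorph M E)
        (d : OpenPartialHomeomorph M' E') (K : Set M) (ε : ℝ),
      (k : ℕ∞) ≤ r ∧ ContMDiff 𝓘(ℝ, E) 𝓘(ℝ, E') r f ∧ c ∈ atlas E M ∧ d ∈ atlas E' M' ∧
      IsCompact K ∧ K ⊆ c.source ∧ MapsTo f K d.source ∧ 0 < ε ∧ S = crBasicOpen k f c d K ε}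

variable (E) in
/-- `f` is Lipschitz in local coordinates around every point. For maps of a compact connected
manifold this is the same as being Lipschitz for one, equivalently every, Riemannian distance. -/
def IsLipschitz (f : M → M) : Prop :=
  Continuous f ∧ ∀ x : M, ∃ K : ℝ≥0, ∃ s ∈ 𝓝 (extChartAt 𝓘(ℝ, E) x x),
    LipschitzOnWith K (writtenInExtChartAt 𝓘(ℝ, E) 𝓘(ℝ, E) x f) s

variable (E) in
/-- `f` is `C^{1+}`: it is `C^1` and its derivative is `θ`-Hölder in local coordinates, for some
`θ > 0`. -/
def IsC1Plus (f : M → M) : Prop :=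
  ContMDiff 𝓘(ℝ, E) 𝓘(ℝ, E) 1 f ∧ ∃ θ : ℝ≥0, 0 < θ ∧ ∀ x : M, ∃ C : ℝ≥0,
    ∃ s ∈ 𝓝 (extChartAt 𝓘(ℝ, E) x x),
      HolderOnWith C θ (fderiv ℝ (writtenInExtChartAt 𝓘(ℝ, E) 𝓘(ℝ, E) x f)) s

variable (E) in
/-- `f` belongs to `Diff^{1+}(M)`. -/
def IsC1PlusDiffeo (f : M → M) : Prop :=
  IsC1Plus E f ∧ ∃ g : M → M, Function.LeftInverse g f ∧ Function.RightInverse g f ∧ IsC1Plus E g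

variable (E) in
/-- `f` is a `C^∞` diffeomorphism. -/
def IsSmoothDiffeo (f : M → M) : Prop :=
  ContMDiff 𝓘(ℝ, E) 𝓘(ℝ, E) ∞ f ∧ ∃ g : M → M,
    Function.LeftInverse g f ∧ Function.RightInverse g f ∧ ContMDiff 𝓘(ℝ, E) 𝓘(ℝ, E) ∞ g

/-- The homeomorphism `h` conjugates `f` to `g`. -/
def IsConjugacy (h : M ≃ₜ M) (f g : M → M) : Prop :=
  ∀ x, h (f x) = g (h x)

variable (E) in
/-- The differential of `f` at a point `x`, all tangent spaces being copies of `E`. It is only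
used when `f x = x`, where it is an endomorphism of the tangent space at `x`. -/
def diffAt (f : M → M) (x : M) : E →L[ℝ] E :=
  mfderiv 𝓘(ℝ, E) 𝓘(ℝ, E) f x

variable (E) in
/-- `f` and `g` have the same periodic data with respect to `h`: whenever `f^k p = p`, `k ≥ 1`,
the differentials of `f^k` at `p` and of `g^k` at `h p` are conjugate linear maps. -/
def SamePeriodicData (h : M ≃ₜ M) (f g : M → M) : Prop :=
  ∀ (p : M) (k : ℕ), 0 < k → Function.IsPeriodicPt f k p →
    ∃ A : E ≃L[ℝ] E, ∀ v : E, A (diffAt E f^[k] p v) = diffAt E g^[k] (h p) (A v)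

variable (E) in
/-- Local periodic data rigidity. -/
def LocallyPeriodicDataRigid (f : M → M) : Prop :=
  ∃ 𝒰 ∈ @nhds (M → M) (crTopology E M E M 1) f, ∀ g ∈ 𝒰, IsC1PlusDiffeo E g →
    ∀ h : M ≃ₜ M, IsConjugacy h f g → SamePeriodicData E h f g → IsC1Plus E h

end Regularity

/-! ### Quotients of Lie groups by discrete subgroups -/

section Quotient

instance instLieGroupMinSmoothness {n : ℕ} {N : Type*} [TopologicalSpace N]
    [ChartedSpace (EuclideanSpace ℝ (Fin n)) N] [Group N] [LieGroup (𝓡 n) ∞ N] :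
    LieGroup (𝓡 n) (minSmoothness ℝ 3) N := by
  rw [minSmoothness_of_isRCLikeNormedField]
  infer_instance

theorem isLocalHomeomorph_mk {N : Type*} [TopologicalSpace N] [Group N] [IsTopologicalGroup N]
    (Γ : Subgroup N) [hΓ : DiscreteTopology Γ] :
    IsLocalHomeomorph (QuotientGroup.mk : N → N ⧸ Γ) :=
  (Γ.isQuotientCoveringMap ⟨hΓ⟩).isCoveringMap.isLocalHomeomorph

variable {n : ℕ} {N : Type*} [TopologicalSpace N] [ChartedSpace (EuclideanSpace ℝ (Fin n)) N]
  [Group N] [LieGroup (𝓡 n) ∞ N]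

/-- The charts of `N ⧸ Γ` are the local inverses of the projection `N → N ⧸ Γ` followed by charts
of `N`. -/
instance instChartedSpace (Γ : Subgroup N) [DiscreteTopology Γ] :
    ChartedSpace (EuclideanSpace ℝ (Fin n)) (N ⧸ Γ) :=
  have : IsTopologicalGroup N := topologicalGroup_of_lieGroup (𝓡 n) ∞
  (isLocalHomeomorph_mk Γ).chartedSpace QuotientGroup.mk_surjective

instance instIsManifold (Γ : Subgroup N) [DiscreteTopology Γ] : IsManifold (𝓡 n) ∞ (N ⧸ Γ) := by
  have : IsTopologicalGroup N := topologicalGroup_of_lieGroup (𝓡 n) ∞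
  have hloc := isLocalHomeomorph_mk Γ
  have key : ∀ p q : N, ContDiffOn ℝ ∞
      (((hloc.localInverseAt p).trans (chartAt (EuclideanSpace ℝ (Fin n)) p)).symm.trans
        ((hloc.localInverseAt q).trans (chartAt (EuclideanSpace ℝ (Fin n)) q)))
      (((hloc.localInverseAt p).trans (chartAt (EuclideanSpace ℝ (Fin n)) p)).symm.trans
        ((hloc.localInverseAt q).trans (chartAt (EuclideanSpace ℝ (Fin n)) q))).source := by
    intro p q v hv
    simp only [OpenPartialHomeomorph.trans_source, OpenPartialHomeomorph.symm_source,
      OpenPartialHomeomorph.trans_symm_eq_symm_trans_symm,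
      mem_inter_iff, mem_preimage, OpenPartialHomeomorph.coe_trans, Function.comp_apply,
      hloc.localInverseAt_symm] at hv
    obtain ⟨⟨hv1, hv2⟩, hv3, hv4⟩ := hv
    set cp := chartAt (EuclideanSpace ℝ (Fin n)) p with hcp
    set cq := chartAt (EuclideanSpace ℝ (Fin n)) q with hcq
    set a := cp.symm v with ha
    set b := hloc.localInverseAt q (a : N ⧸ Γ) with hb
    have hbt : b ∈ (hloc.localInverseAt q).target := (hloc.localInverseAt q).map_source hv3
    have hab : (b : N ⧸ Γ) = a := hloc.apply_localInverseAt_of_mem hv3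
    have hγ : a⁻¹ * b ∈ Γ := QuotientGroup.eq.mp hab.symm
    have hcpc : ContMDiffAt (𝓡 n) (𝓡 n) ∞ cp.symm v :=
      (contMDiffOn_chart_symm (I := 𝓡 n) (x := p)).contMDiffAt (cp.open_target.mem_nhds hv1)
    have hm : ContMDiffAt (𝓡 n) (𝓡 n) ∞ (fun v' => cp.symm v' * (a⁻¹ * b)) v :=
      hcpc.mul contMDiffAt_const
    have hbe : cp.symm v * (a⁻¹ * b) = b := by rw [← ha]; group
    have hcqc : ContMDiffAt (𝓡 n) (𝓡 n) ∞ cq (cp.symm v * (a⁻¹ * b)) := by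
      rw [hbe]
      exact (contMDiffOn_chart (I := 𝓡 n) (x := q)).contMDiffAt (cq.open_source.mem_nhds hv4)
    have hF : ContDiffAt ℝ ∞ (fun v' => cq (cp.symm v' * (a⁻¹ * b))) v :=
      contMDiffAt_iff_contDiffAt.mp
        (ContMDiffAt.comp (g := cq) (f := fun v' => cp.symm v' * (a⁻¹ * b)) v hcqc hm)
    refine (hF.congr_of_eventuallyEq ?_).contDiffWithinAt
    have hnear : ∀ᶠ v' in 𝓝 v, cp.symm v' * (a⁻¹ * b) ∈ (hloc.localInverseAt q).target := by
      refine hm.continuousAt ((hloc.localInverseAt q).open_target.mem_nhds ?_)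
      rw [hbe]
      exact hbt
    filter_upwards [hnear] with v' hv'
    simp only [OpenPartialHomeomorph.coe_trans, OpenPartialHomeomorph.trans_symm_eq_symm_trans_symm,
      Function.comp_apply, hloc.localInverseAt_symm]
    congr 1
    have h1 : ((cp.symm v' : N) : N ⧸ Γ) = ((cp.symm v' * (a⁻¹ * b) : N) : N ⧸ Γ) :=
      (QuotientGroup.mk_mul_of_mem _ hγ).symm
    rw [h1]
    have h2 := (hloc.localInverseAt q).right_inv hv'
    rwa [hloc.localInverseAt_symm] at h2
  apply isManifold_of_contDiffOn
  rintro _ _ ⟨p, rfl⟩ ⟨q, rfl⟩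
  simpa using key _ _

/-- The right-invariant framing of the tangent bundle of `N ⧸ Γ`: it sends `v` in the Lie algebra
(the tangent space at `1`) to the velocity at `x` of the left translations of `x` in the direction
`v`. -/
def frame (Γ : Subgroup N) [DiscreteTopology Γ] (x : N ⧸ Γ) :
    EuclideanSpace ℝ (Fin n) →L[ℝ] EuclideanSpace ℝ (Fin n) :=
  mfderiv (𝓡 n) (𝓡 n) (fun g : N => g • x) 1

/-- The norm on tangent spaces of `N ⧸ Γ` of a right-invariant Riemannian metric. -/
def tangentNorm (Γ : Subgroup N) [DiscreteTopology Γ] (x : N ⧸ Γ)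
    (v : EuclideanSpace ℝ (Fin n)) : ℝ :=
  ‖(frame Γ x).inverse v‖

/-- The tangent vector `v` at `x` has Lyapunov exponent `χ` under `f`. -/
def HasLyapunovExponent (Γ : Subgroup N) [DiscreteTopology Γ] (f : N ⧸ Γ → N ⧸ Γ) (x : N ⧸ Γ)
    (v : EuclideanSpace ℝ (Fin n)) (χ : ℝ) : Prop :=
  Tendsto (fun k : ℕ => (1 / (k : ℝ)) *
    Real.log (tangentNorm Γ (f^[k] x) (mfderiv (𝓡 n) (𝓡 n) f^[k] x v))) atTop (𝓝 χ)

variable (n) in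
/-- The list with multiplicities `s` is the Lyapunov spectrum of `f` with respect to `μ`: at almost
every point every nonzero tangent vector has an exponent in `s`, and for every `t` the vectors of
exponent at most `t` form, together with `0`, a subspace whose dimension is the number of members
of `s`, counted with multiplicity, that are at most `t`. -/
def HasLyapunovSpectrum (Γ : Subgroup N) [DiscreteTopology Γ] [MeasurableSpace (N ⧸ Γ)]
    (μ : Measure (N ⧸ Γ)) (f : N ⧸ Γ → N ⧸ Γ) (s : Multiset ℝ) : Prop :=
  ∀ᵐ x ∂μ,
    (∀ v : EuclideanSpace ℝ (Fin n), v ≠ 0 → ∃ χ ∈ s, HasLyapunovExponent Γ f x v χ) ∧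
    ∀ t : ℝ, ∃ V : Submodule ℝ (EuclideanSpace ℝ (Fin n)),
      (∀ v, v ∈ V ↔ v = 0 ∨ ∃ χ ≤ t, HasLyapunovExponent Γ f x v χ) ∧
      Module.finrank ℝ V = (s.filter (· ≤ t)).card

variable (n) in
/-- Local Lyapunov spectrum rigidity, with respect to the volume `vol`. -/
def LocallyLyapunovSpectrumRigid (Γ : Subgroup N) [DiscreteTopology Γ] [MeasurableSpace (N ⧸ Γ)]
    (vol : Measure (N ⧸ Γ)) (f : N ⧸ Γ → N ⧸ Γ) : Prop :=
  ∃ 𝒰 ∈ @nhds (N ⧸ Γ → N ⧸ Γ) (crTopology (EuclideanSpace ℝ (Fin n)) (N ⧸ Γ)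
      (EuclideanSpace ℝ (Fin n)) (N ⧸ Γ) 1) f,
    ∀ g ∈ 𝒰, IsC1PlusDiffeo (EuclideanSpace ℝ (Fin n)) g → MeasurePreserving g vol vol →
      (∃ s, HasLyapunovSpectrum n Γ vol f s ∧ HasLyapunovSpectrum n Γ vol g s) →
      ∃ h : (N ⧸ Γ) ≃ₜ (N ⧸ Γ), IsConjugacy h f g ∧ IsC1Plus (EuclideanSpace ℝ (Fin n)) h

/-! ### Automorphisms of nilmanifolds and their shears -/

variable (n) in
/-- The differential at the identity of a group automorphism `A` of `N`, an endomorphism of the Lie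
algebra, i.e. of the tangent space `EuclideanSpace ℝ (Fin n)` of `N` at `1`. -/
def lieDifferential (A : N ≃* N) : Module.End ℝ (EuclideanSpace ℝ (Fin n)) :=
  (diffAt (EuclideanSpace ℝ (Fin n)) A 1).toLinearMap

variable (n) in
/-- The complex eigenvalues, with algebraic multiplicity, of the differential at the identity. -/
def lieEigenvalues (A : N ≃* N) : Multiset ℂ :=
  ((lieDifferential n A).charpoly.map (algebraMap ℝ ℂ)).roots

variable (n) in
/-- An Anosov automorphism of `N ⧸ Γ`, given by its lift to `N`: an automorphism of the Lie group
`N` that preserves `Γ` and has hyperbolic differential at the identity. -/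
structure AnosovAutomorphism (Γ : Subgroup N) where
  lift : N ≃* N
  contMDiff_lift : ContMDiff (𝓡 n) (𝓡 n) ∞ lift
  contMDiff_lift_symm : ContMDiff (𝓡 n) (𝓡 n) ∞ lift.symm
  map_eq : Γ.map lift.toMonoidHom = Γ
  hyperbolic : ∀ z ∈ lieEigenvalues n lift, ‖z‖ ≠ 1

/-- The diffeomorphism `gΓ ↦ L(g)Γ` of `N ⧸ Γ`. -/
def AnosovAutomorphism.toFun {Γ : Subgroup N} (L : AnosovAutomorphism n Γ) : N ⧸ Γ → N ⧸ Γ :=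
  Quotient.map' L.lift fun a b hab => by
    rw [QuotientGroup.leftRel_apply] at hab ⊢
    have h : L.lift (a⁻¹ * b) ∈ Γ.map L.lift.toMonoidHom :=
      Subgroup.mem_map_of_mem L.lift.toMonoidHom hab
    rw [← map_inv, ← map_mul]
    exact L.map_eq.le h

/-- All eigenvalues of the differential at the identity have distinct moduli (in particular they
are real and simple). -/
def AnosovAutomorphism.HasSimpleSpectrum {Γ : Subgroup N} (L : AnosovAutomorphism n Γ) : Prop :=
  ((lieEigenvalues n L.lift).map fun z => ‖z‖).Nodup

/-- `v` is an unstable eigenvector of the differential at the identity, with eigenvalue `r`. -/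
def AnosovAutomorphism.IsUnstableEigenvector {Γ : Subgroup N} (L : AnosovAutomorphism n Γ)
    (v : GroupLieAlgebra (𝓡 n) N) (r : ℝ) : Prop :=
  (lieDifferential n L.lift).HasEigenvector r v ∧ 1 < |r|

/-- `c` is the one-parameter subgroup `t ↦ exp (t w)`, i.e. the homomorphism `ℝ → N` whose velocity
at `0` is `w`, a vector in the tangent space of `N` at `1`. -/
def IsOneParameterSubgroup (c : ℝ → N) (w : EuclideanSpace ℝ (Fin n)) : Prop :=
  c 0 = 1 ∧ (∀ s t, c (s + t) = c s * c t) ∧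
    HasMFDerivAt 𝓘(ℝ, ℝ) (𝓡 n) c 0 (ContinuousLinearMap.toSpanSingleton ℝ w)

variable (n) in
/-- `φ` is a smooth function on `N / Z(N)Γ`, seen as a smooth function on `N ⧸ Γ` which is
invariant under the action of the center `Z(N)` by left translation. -/
def IsSmoothBaseFunction (Γ : Subgroup N) [DiscreteTopology Γ] (φ : N ⧸ Γ → ℝ) : Prop :=
  ContMDiff (𝓡 n) 𝓘(ℝ, ℝ) ∞ φ ∧ ∀ z ∈ Subgroup.center N, ∀ x, φ (z • x) = φ x

/-- The shear `x ↦ L(x) + φ(x) w = exp (φ(x) w) · L(x)`, where `c t = exp (t w)`. -/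
def AnosovAutomorphism.shear {Γ : Subgroup N} (L : AnosovAutomorphism n Γ) (c : ℝ → N)
    (φ : N ⧸ Γ → ℝ) (x : N ⧸ Γ) : N ⧸ Γ :=
  c (φ x) • L.toFun x

end Quotient
end Nilmanifold

end

open Nilmanifold

noncomputable section

open scoped Pointwise commutatorElement

/-! Write r for the eigenvalue of w, μ for that of u, and exp(tw) for the central flow. For φ
invariant under the center, the shear L_φ has differential L_* + dφ ⊗ w in the right-invariant
framing, and dφ(w) = 0. Since |r| differs from the moduli of all other eigenvalues, products of such
maps along an orbit are carried to powers of L_* by transvections 1 + ξ ⊗ w. Solving for ξ at a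
periodic point gives equal periodic data (`CentralFlow.samePeriodicData_shear`). Solving for a
bounded sequence of functionals ξ along any forward orbit gives equal Lyapunov exponents
(`CentralFlow.hasLyapunovSpectrum_shear`). Shears preserve volume, because L does and because moving
points along the flow by times that are constant along the flow does.

The map x ↦ exp(ψ(x)w)x conjugates L to L_φ when ψ∘L = φ + rψ, and the solution is ψ = -∑ r^{-(k+1)}
φ∘L^k. Along the direction of u the derivative of φ∘L^k may grow like μ^k, and |μ| > |r|, so ψ
should fail to be Lipschitz there. To make this certain, φ is built from the size of Ad y - 1. It
descends smoothly to the base because Z(N)Γ is closed. The matrix entries of Ad y - 1 in an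
eigenbasis are multiplied by ratios of eigenvalues under L. Hence along a noncentral curve through
the base point that L expands by the factor μ, φ vanishes up to a first exit time and then equals
one for many steps. This gives ψ(c(μ^{-i}t)) = r^{-i}a with a ≠ 0
(`exists_base_function_potential_jump`), against a displacement of size about |μ|^{-i} on a smooth
curve.

All conjugacies must be excluded, not only this one. Any other conjugacy is the explicit one
composed with a homeomorphism g commuting with L. By expansivity only countably many continuous maps
commute with L (`AnosovAutomorphism.Eigenbasis.countable_centralizer`). If Lipschitz conjugacies, or
Lipschitz inverses, existed for all multiples sφ with s in an interval, two parameters s ≠ s' would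
share the same g and the same alternative.

Comparing the two maps cancels g and isolates a motion by (s - s')ψ along the flow, which would be
Lipschitz. For inverse conjugacies this contradicts the oscillation of ψ along exp(tu)
(`CentralFlow.not_isLipschitz_of_inverse_shears`). For conjugacies themselves the relevant curve c
is the lift of the g-image of a u-curve. If c leaves the center, ψ oscillates along it
(`CentralFlow.not_isLipschitz_of_shears`). If c stays in the center, ψ vanishes along it, so c
inherits a Lipschitz bound. Its velocities would then be central eigenvectors for μ, which do not
exist because the μ-eigenspace is spanned by the noncentral u. Hence c does not move the base point
(`smul_eq_of_lipschitz_central`), contradicting injectivity of g. -/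

namespace Nilmanifold

/-! ### Differentiable maps of manifolds read in charts -/

section Charts

variable {E₁ : Type*} [NormedAddCommGroup E₁] [NormedSpace ℝ E₁]
  {M₁ : Type*} [TopologicalSpace M₁] [ChartedSpace E₁ M₁]
  {E₂ : Type*} [NormedAddCommGroup E₂] [NormedSpace ℝ E₂]
  {M₂ : Type*} [TopologicalSpace M₂] [ChartedSpace E₂ M₂]
  {E₃ : Type*} [NormedAddCommGroup E₃] [NormedSpace ℝ E₃]
  {M₃ : Type*} [TopologicalSpace M₃] [ChartedSpace E₃ M₃]

/-- A `C^1` map of two variables is Lipschitz in the first one, locally uniformly in the second. -/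
theorem exists_lipschitz_fst_in_charts {F : M₁ × M₂ → M₃} {a : M₁} {b : M₂}
    (hF : ContMDiffAt (𝓘(ℝ, E₁).prod 𝓘(ℝ, E₂)) 𝓘(ℝ, E₃) 1 F (a, b)) :
    ∃ C : ℝ, 0 < C ∧ ∀ᶠ p : (M₁ × M₁) × M₂ in 𝓝 ((a, a), b),
      ‖extChartAt 𝓘(ℝ, E₃) (F (a, b)) (F (p.1.1, p.2)) -
        extChartAt 𝓘(ℝ, E₃) (F (a, b)) (F (p.1.2, p.2))‖ ≤
      C * ‖extChartAt 𝓘(ℝ, E₁) a p.1.1 - extChartAt 𝓘(ℝ, E₁) a p.1.2‖ := by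
  have h1 := (contMDiffAt_iff.1 hF).2
  simp only [ModelWithCorners.range_prod, modelWithCornersSelf_coe, range_id, univ_prod_univ,
    contDiffWithinAt_univ] at h1
  obtain ⟨K, t, ht, hK⟩ := h1.exists_lipschitzOnWith
  refine ⟨K + 1, by positivity, ?_⟩
  have hc1 : ContinuousAt (extChartAt 𝓘(ℝ, E₁) a) a := continuousAt_extChartAt a
  have hc2 : ContinuousAt (extChartAt 𝓘(ℝ, E₂) b) b := continuousAt_extChartAt b
  have hsrc1 := extChartAt_source_mem_nhds (I := 𝓘(ℝ, E₁)) a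
  have hsrc2 := extChartAt_source_mem_nhds (I := 𝓘(ℝ, E₂)) b
  have e1 : Tendsto (fun p : (M₁ × M₁) × M₂ => p.1.1) (𝓝 ((a, a), b)) (𝓝 a) :=
    (continuous_fst.comp continuous_fst).tendsto' _ _ rfl
  have e2 : Tendsto (fun p : (M₁ × M₁) × M₂ => p.1.2) (𝓝 ((a, a), b)) (𝓝 a) :=
    (continuous_snd.comp continuous_fst).tendsto' _ _ rfl
  have e3 : Tendsto (fun p : (M₁ × M₁) × M₂ => p.2) (𝓝 ((a, a), b)) (𝓝 b) :=
    continuous_snd.tendsto' _ _ rfl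
  have f1 : Tendsto (fun p : (M₁ × M₁) × M₂ =>
      (extChartAt 𝓘(ℝ, E₁) a p.1.1, extChartAt 𝓘(ℝ, E₂) b p.2)) (𝓝 ((a, a), b))
      (𝓝 (extChartAt 𝓘(ℝ, E₁) a a, extChartAt 𝓘(ℝ, E₂) b b)) :=
    (hc1.tendsto.comp e1).prodMk_nhds (hc2.tendsto.comp e3)
  have f2 : Tendsto (fun p : (M₁ × M₁) × M₂ =>
      (extChartAt 𝓘(ℝ, E₁) a p.1.2, extChartAt 𝓘(ℝ, E₂) b p.2)) (𝓝 ((a, a), b))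
      (𝓝 (extChartAt 𝓘(ℝ, E₁) a a, extChartAt 𝓘(ℝ, E₂) b b)) :=
    (hc1.tendsto.comp e2).prodMk_nhds (hc2.tendsto.comp e3)
  have ht' : t ∈ 𝓝 (extChartAt 𝓘(ℝ, E₁) a a, extChartAt 𝓘(ℝ, E₂) b b) := by
    simpa [extChartAt_prod] using ht
  filter_upwards [f1 ht', f2 ht', e1 hsrc1, e2 hsrc1, e3 hsrc2] with p g1 g2 g3 g4 g5
  have := hK.norm_sub_le g1 g2
  simp only [Function.comp_apply, extChartAt_prod, PartialEquiv.prod_coe_symm] at this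
  rw [(extChartAt 𝓘(ℝ, E₁) a).left_inv g3, (extChartAt 𝓘(ℝ, E₁) a).left_inv g4,
    (extChartAt 𝓘(ℝ, E₂) b).left_inv g5] at this
  refine this.trans ?_
  simp only [Prod.mk_sub_mk, sub_self, Prod.norm_mk, norm_zero]
  rw [max_eq_left (norm_nonneg _)]
  gcongr
  linarith

/-- A differentiable map with vanishing differential on a connected manifold is constant. -/
theorem eq_of_mfderiv_eq_zero [IsManifold 𝓘(ℝ, E₁) 1 M₁] [IsManifold 𝓘(ℝ, E₂) 1 M₂]
    [PreconnectedSpace M₁] {f : M₁ → M₂} (hf : MDifferentiable 𝓘(ℝ, E₁) 𝓘(ℝ, E₂) f)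
    (h0 : ∀ x, mfderiv 𝓘(ℝ, E₁) 𝓘(ℝ, E₂) f x = 0) (x y : M₁) : f x = f y := by
  have hloc : IsLocallyConstant f := by
    rw [IsLocallyConstant.iff_eventually_eq]
    intro x
    set e := extChartAt 𝓘(ℝ, E₁) x with he
    set e' := extChartAt 𝓘(ℝ, E₂) (f x) with he'
    have hopen : IsOpen (e.source ∩ f ⁻¹' e'.source) :=
      (isOpen_extChartAt_source x).inter
        ((isOpen_extChartAt_source (f x)).preimage hf.continuous)
    have hmem : e.target ∩ e.symm ⁻¹' (e.source ∩ f ⁻¹' e'.source) ∈ 𝓝 (e x) := by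
      refine inter_mem (extChartAt_target_mem_nhds x) ?_
      have : ContinuousAt e.symm (e x) := continuousAt_extChartAt_symm x
      refine this.preimage_mem_nhds ?_
      rw [extChartAt_to_inv]
      exact hopen.mem_nhds ⟨mem_extChartAt_source x, mem_extChartAt_source (f x)⟩
    obtain ⟨r, hr, hball⟩ := Metric.mem_nhds_iff.1 hmem
    have hd : ∀ a ∈ Metric.ball (e x) r, HasFDerivAt (e' ∘ f ∘ e.symm) (0 : E₁ →L[ℝ] E₂) a := by
      intro a ha
      obtain ⟨h1, h2, h3⟩ := hball ha
      have d1 : MDifferentiableAt 𝓘(ℝ, E₁) 𝓘(ℝ, E₁) e.symm a :=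
        (mdifferentiableOn_extChartAt_symm (I := 𝓘(ℝ, E₁)) (x := x)).mdifferentiableAt
          ((isOpen_extChartAt_target x).mem_nhds h1)
      have d2 : MDifferentiableAt 𝓘(ℝ, E₂) 𝓘(ℝ, E₂) e' (f (e.symm a)) :=
        mdifferentiableAt_extChartAt (by simpa [he'] using h3)
      have := (d2.hasMFDerivAt.comp (e.symm a) (hf (e.symm a)).hasMFDerivAt).comp a d1.hasMFDerivAt
      rw [h0] at this
      refine HasFDerivAt.congr_fderiv (hasMFDerivAt_iff_hasFDerivAt.1 this) ?_
      ext v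
      simp only [ContinuousLinearMap.comp_zero, ContinuousLinearMap.zero_comp]
      rfl
    have hconst : ∀ a ∈ Metric.ball (e x) r, (e' ∘ f ∘ e.symm) a = (e' ∘ f ∘ e.symm) (e x) := by
      intro a ha
      have := (convex_ball (e x) r).norm_image_sub_le_of_norm_hasFDerivWithin_le (C := 0)
        (fun b hb => (hd b hb).hasFDerivWithinAt) (fun b hb => by simp)
        (Metric.mem_ball_self hr) ha
      rw [zero_mul] at this
      exact sub_eq_zero.1 (norm_le_zero_iff.1 this)
    have hnb : ∀ᶠ z in 𝓝 x, e z ∈ Metric.ball (e x) r :=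
      (continuousAt_extChartAt x).preimage_mem_nhds (Metric.ball_mem_nhds _ hr)
    filter_upwards [hnb, hopen.mem_nhds ⟨mem_extChartAt_source x, mem_extChartAt_source (f x)⟩]
      with z hz hz'
    have := hconst _ hz
    simp only [Function.comp_apply] at this
    rw [e.left_inv hz'.1, extChartAt_to_inv] at this
    exact e'.injOn hz'.2 (mem_extChartAt_source (f x)) this
  exact hloc.apply_eq_of_preconnectedSpace x y

end Charts


/-! ### Calculus at the identity of a Lie group -/

/-- The model space of the manifolds under consideration. -/
abbrev Euc (n : ℕ) : Type := EuclideanSpace ℝ (Fin n)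

section UnitDeriv

variable {n : ℕ} {N : Type*} [TopologicalSpace N] [ChartedSpace (EuclideanSpace ℝ (Fin n)) N]
  [Group N]
  {E₁ : Type*} [NormedAddCommGroup E₁] [NormedSpace ℝ E₁]
  {M₁ : Type*} [TopologicalSpace M₁] [ChartedSpace E₁ M₁]
  {f : M₁ → N} {a : M₁} {D D' : E₁ →L[ℝ] Euc n}

/-- `f` maps `a` to the identity, and has differential `D` there. -/
def HasUnitDeriv (f : M₁ → N) (a : M₁) (D : E₁ →L[ℝ] Euc n) : Prop :=
  f a = 1 ∧ HasMFDerivAt 𝓘(ℝ, E₁) (𝓡 n) f a D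

variable (n) in
/-- Coordinates of `N` centered at the identity. -/
def unitChart (y : N) : Euc n :=
  extChartAt (𝓡 n) (1 : N) y - extChartAt (𝓡 n) (1 : N) 1

variable (n N) in
/-- The domain of the coordinates centered at the identity. -/
def unitSource : Set N := (extChartAt (𝓡 n) (1 : N)).source

theorem unitSource_mem_nhds : unitSource n N ∈ 𝓝 (1 : N) :=
  extChartAt_source_mem_nhds (I := 𝓡 n) (1 : N)

@[simp] theorem unitChart_one : unitChart n (1 : N) = 0 := sub_self _

theorem continuousAt_unitChart : ContinuousAt (unitChart n : N → _) 1 :=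
  (continuousAt_extChartAt (I := 𝓡 n) (1 : N)).sub continuousAt_const

theorem tendsto_unitChart : Tendsto (unitChart n : N → _) (𝓝 1) (𝓝 0) := by
  have := (continuousAt_unitChart (n := n) (N := N)).tendsto
  rwa [unitChart_one] at this

theorem unitChart_injOn : InjOn (unitChart n : N → _) (unitSource n N) :=
  fun _ ha _ hb h => (extChartAt (𝓡 n) (1 : N)).injOn ha hb (sub_left_injective h)

theorem eq_one_of_unitChart {y : N} (hy : y ∈ unitSource n N) (h : unitChart n y = 0) : y = 1 :=
  unitChart_injOn hy (mem_extChartAt_source (I := 𝓡 n) (1 : N)) (by rw [h, unitChart_one])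

theorem tendsto_one_of_unitChart {ι : Type*} {l : Filter ι} {f : ι → N}
    (hs : ∀ᶠ i in l, f i ∈ unitSource n N)
    (h : Tendsto (fun i => unitChart n (f i)) l (𝓝 0)) : Tendsto f l (𝓝 1) := by
  have h1 : Tendsto (fun i => extChartAt (𝓡 n) (1 : N) (f i)) l
      (𝓝 (extChartAt (𝓡 n) (1 : N) 1)) := by
    have := h.add_const (extChartAt (𝓡 n) (1 : N) 1)
    simpa [unitChart] using this
  have h2 := (continuousAt_extChartAt_symm (I := 𝓡 n) (1 : N)).tendsto.comp h1
  rw [extChartAt_to_inv] at h2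
  refine h2.congr' ?_
  filter_upwards [hs] with i hi
  exact (extChartAt (𝓡 n) (1 : N)).left_inv hi

theorem HasUnitDeriv.continuousAt (h : HasUnitDeriv f a D) :
    ContinuousAt f a := h.2.continuousAt

theorem HasUnitDeriv.tendsto (h : HasUnitDeriv f a D) :
    Tendsto f (𝓝 a) (𝓝 1) := h.1 ▸ h.continuousAt

theorem HasUnitDeriv.unique (h : HasUnitDeriv f a D)
    (h' : HasUnitDeriv f a D') : D = D' :=
  hasMFDerivAt_unique h.2 h'.2

theorem HasUnitDeriv.congr {g : M₁ → N} (h : HasUnitDeriv f a D)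
    (hfg : g =ᶠ[𝓝 a] f) : HasUnitDeriv g a D :=
  ⟨hfg.eq_of_nhds.trans h.1, h.2.congr_of_eventuallyEq hfg⟩

theorem HasUnitDeriv.congr_deriv (h : HasUnitDeriv f a D)
    (hD : D = D') : HasUnitDeriv f a D' := hD ▸ h

theorem hasUnitDeriv_const (a : M₁) :
    HasUnitDeriv (fun _ : M₁ => (1 : N)) a (0 : E₁ →L[ℝ] Euc n) :=
  ⟨rfl, hasMFDerivAt_const (1 : N) a⟩

theorem hasUnitDeriv_id : HasUnitDeriv (fun y : N => y) 1 (ContinuousLinearMap.id ℝ (Euc n)) :=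
  ⟨rfl, hasMFDerivAt_id (1 : N)⟩

theorem hasMFDerivAt_unitChart :
    HasMFDerivAt (𝓡 n) 𝓘(ℝ, Euc n) (unitChart n : N → _) 1
      (ContinuousLinearMap.id ℝ (Euc n)) := by
  refine ⟨continuousAt_unitChart, ?_⟩
  have h : HasFDerivAt (fun a : Euc n => a - extChartAt (𝓡 n) (1 : N) 1)
      (ContinuousLinearMap.id ℝ (Euc n)) (extChartAt (𝓡 n) (1 : N) 1) :=
    (hasFDerivAt_id _).sub_const _
  refine HasFDerivAt.hasFDerivWithinAt (h.congr_of_eventuallyEq ?_)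
  filter_upwards [extChartAt_target_mem_nhds (I := 𝓡 n) (1 : N)] with a ha
  simp only [writtenInExtChartAt, Function.comp_apply, unitChart, extChartAt_model_space_eq_id,
    PartialEquiv.refl_coe, id]
  rw [(extChartAt (𝓡 n) (1 : N)).right_inv ha]

theorem HasUnitDeriv.comp {E₂ : Type*} [NormedAddCommGroup E₂] [NormedSpace ℝ E₂]
    {M₂ : Type*} [TopologicalSpace M₂] [ChartedSpace E₂ M₂]
    {g : M₁ → N} {f : M₂ → M₁} {a : M₂} {b : M₁} {D : E₂ →L[ℝ] E₁} {D' : E₁ →L[ℝ] Euc n}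
    (hg : HasUnitDeriv g b D') (hb : f a = b) (hf : HasMFDerivAt 𝓘(ℝ, E₂) 𝓘(ℝ, E₁) f a D) :
    HasUnitDeriv (fun x => g (f x)) a (D'.comp D) := by
  subst hb
  exact ⟨hg.1, hg.2.comp a hf⟩

theorem HasUnitDeriv.comp_unit {g : N → N} {D' : Euc n →L[ℝ] Euc n}
    (hg : HasUnitDeriv g 1 D') (hf : HasUnitDeriv f a D) :
    HasUnitDeriv (fun x => g (f x)) a (D'.comp D) := hg.comp hf.1 hf.2

/-- The differential read in coordinates. -/
theorem HasUnitDeriv.hasMFDerivAt_unitChart (h : HasUnitDeriv f a D) :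
    HasMFDerivAt 𝓘(ℝ, E₁) 𝓘(ℝ, Euc n) (fun x => unitChart n (f x)) a D := by
  have h1 := Nilmanifold.hasMFDerivAt_unitChart (n := n) (N := N)
  rw [← h.1] at h1
  exact h1.comp a h.2

theorem HasUnitDeriv.hasFDerivAt {f : E₁ → N} {a : E₁} (h : HasUnitDeriv f a D) :
    HasFDerivAt (fun x => unitChart n (f x)) D a :=
  hasMFDerivAt_iff_hasFDerivAt.1 h.hasMFDerivAt_unitChart

/-- A self-map of `N` fixing the identity is approximated by its differential. -/
theorem HasUnitDeriv.isLittleO {f : N → N} {D : Euc n →L[ℝ] Euc n} (h : HasUnitDeriv f 1 D) :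
    (fun y => unitChart n (f y) - D (unitChart n y)) =o[𝓝 1] (unitChart n : N → _) := by
  have h1 := h.hasMFDerivAt_unitChart.2
  simp only [writtenInExtChartAt, modelWithCornersSelf_coe, range_id] at h1
  have h2 := (hasFDerivWithinAt_univ.1 h1).isLittleO.comp_tendsto
    (continuousAt_extChartAt (I := 𝓡 n) (1 : N)).tendsto
  refine h2.congr' ?_ ?_
  · filter_upwards [extChartAt_source_mem_nhds (I := 𝓡 n) (1 : N)] with y hy
    simp only [Function.comp_apply, extChartAt_model_space_eq_id, PartialEquiv.refl_coe, id,
      (extChartAt (𝓡 n) (1 : N)).left_inv hy, extChartAt_to_inv, h.1, unitChart_one, sub_zero]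
    rfl
  · exact Eventually.of_forall fun y => rfl

variable [LieGroup (𝓡 n) ∞ N]

theorem isManifold_one : IsManifold (𝓡 n) 1 N :=
  have : IsManifold (𝓡 n) ∞ N := inferInstance
  IsManifold.of_le (n := ∞) (by norm_cast)

theorem hasMFDerivAt_mul_one : HasMFDerivAt ((𝓡 n).prod (𝓡 n)) (𝓡 n)
    (fun p : N × N => p.1 * p.2) ((1 : N), (1 : N))
    (ContinuousLinearMap.fst ℝ (Euc n) (Euc n) + ContinuousLinearMap.snd ℝ (Euc n) (Euc n)) := by
  have h1 : MDifferentiableAt ((𝓡 n).prod (𝓡 n)) (𝓡 n) (fun p : N × N => p.1 * p.2) (1, 1) :=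
    (contMDiff_mul (𝓡 n) ∞).mdifferentiableAt (by simp)
  have h2 := h1.hasMFDerivAt
  have e1 : mfderiv (𝓡 n) (𝓡 n) (fun z : N => z * 1) 1 = ContinuousLinearMap.id ℝ (Euc n) :=
    ((hasUnitDeriv_id (n := n)).congr (by simp)).2.mfderiv
  have e2 : mfderiv (𝓡 n) (𝓡 n) (fun z : N => 1 * z) 1 = ContinuousLinearMap.id ℝ (Euc n) :=
    ((hasUnitDeriv_id (n := n)).congr (by simp)).2.mfderiv
  have h3 : mfderiv ((𝓡 n).prod (𝓡 n)) (𝓡 n) (fun p : N × N => p.1 * p.2) ((1 : N), (1 : N)) =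
     (ContinuousLinearMap.fst ℝ (Euc n) (Euc n) + ContinuousLinearMap.snd ℝ (Euc n) (Euc n)) := by
    ext1 v
    have := mfderiv_prod_eq_add_apply h1 (v := v)
    refine this.trans ?_
    change mfderiv (𝓡 n) (𝓡 n) (fun z : N => z * 1) 1 v.1 +
      mfderiv (𝓡 n) (𝓡 n) (fun z : N => 1 * z) 1 v.2 = _
    erw [e1, e2]
    rfl
  rw [h3] at h2
  exact h2

theorem HasUnitDeriv.mul {g : M₁ → N} (hf : HasUnitDeriv f a D)
    (hg : HasUnitDeriv g a D') : HasUnitDeriv (fun x => f x * g x) a (D + D') := by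
  refine ⟨by simp [hf.1, hg.1], ?_⟩
  have h1 := hasMFDerivAt_mul_one (n := n) (N := N)
  have h2 := hf.2.prodMk hg.2
  have h3 : ((1 : N), (1 : N)) = (f a, g a) := by rw [hf.1, hg.1]
  rw [h3] at h1
  exact h1.comp a h2

theorem HasUnitDeriv.inv (hf : HasUnitDeriv f a D) :
    HasUnitDeriv (fun x => (f x)⁻¹) a (-D) := by
  have h1 : MDifferentiableAt (𝓡 n) (𝓡 n) (fun y : N => y⁻¹) (f a) :=
    (contMDiff_inv (𝓡 n) ∞).mdifferentiableAt (by simp)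
  have h2 := h1.hasMFDerivAt.comp a hf.2
  set D' : E₁ →L[ℝ] Euc n :=
    ContinuousLinearMap.comp (mfderiv (𝓡 n) (𝓡 n) (fun y : N => y⁻¹) (f a)) D with hD'
  have h3 : HasUnitDeriv (fun x => (f x)⁻¹) a D' := ⟨by simp [hf.1], h2⟩
  -- The product of f and its inverse is constant, so the unknown differential D' satisfies D + D' =
  -- 0.
  have h4 := (hf.mul h3).unique ((hasUnitDeriv_const (N := N) a).congr (by simp))
  rw [← eq_neg_of_add_eq_zero_right h4]
  exact h3

end UnitDeriv


/-! ### The adjoint representation -/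

section Adjoint

variable {n : ℕ} {N : Type*} [TopologicalSpace N] [ChartedSpace (EuclideanSpace ℝ (Fin n)) N]
  [Group N]

variable (n) in
/-- The adjoint representation. -/
def adj (y : N) : Euc n →L[ℝ] Euc n :=
  mfderiv (𝓡 n) (𝓡 n) (fun x : N => y * x * y⁻¹) 1

variable [LieGroup (𝓡 n) ∞ N]

theorem contMDiff_conj_uncurry :
    ContMDiff ((𝓡 n).prod (𝓡 n)) (𝓡 n) ∞ (fun p : N × N => p.1 * p.2 * p.1⁻¹) :=
  (contMDiff_fst.mul contMDiff_snd).mul contMDiff_fst.inv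

theorem contMDiff_conj (y : N) : ContMDiff (𝓡 n) (𝓡 n) ∞ (fun x : N => y * x * y⁻¹) :=
  (contMDiff_const.mul contMDiff_id).mul contMDiff_const

theorem hasUnitDeriv_conj (y : N) : HasUnitDeriv (fun x : N => y * x * y⁻¹) 1 (adj n y) :=
  ⟨by simp, ((contMDiff_conj y).mdifferentiableAt (by simp)).hasMFDerivAt⟩

theorem adj_one : adj n (1 : N) = ContinuousLinearMap.id ℝ (Euc n) :=
  (hasUnitDeriv_conj (1 : N)).unique ((hasUnitDeriv_id).congr (by simp))

theorem adj_mul (x y : N) : adj n (x * y) = (adj n x).comp (adj n y) :=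
  (hasUnitDeriv_conj (x * y)).unique
    (((hasUnitDeriv_conj x).comp_unit (hasUnitDeriv_conj y)).congr
      (Eventually.of_forall fun z => by group))

variable (n N) in
/-- The adjoint representation as a homomorphism of monoids. -/
def adjHom : N →* (Euc n →L[ℝ] Euc n) where
  toFun := adj n
  map_one' := adj_one
  map_mul' := adj_mul

theorem adj_of_mem_center {x : N} (hx : x ∈ Subgroup.center N) :
    adj n x = ContinuousLinearMap.id ℝ (Euc n) :=
  (hasUnitDeriv_conj x).unique ((hasUnitDeriv_id).congr (Eventually.of_forall fun z => by
    simp only []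
    rw [← Subgroup.mem_center_iff.1 hx z, mul_inv_cancel_right]))

/-- All conjugations fix the identity, so Ad is the partial differential of a smooth family at a
fixed base point with a fixed value. The changes of tangent coordinates are then trivial. -/
theorem contMDiff_adj : ContMDiff (𝓡 n) 𝓘(ℝ, Euc n →L[ℝ] Euc n) ∞ (adj n : N → _) := by
  intro y₀
  have := isManifold_one (n := n) (N := N)
  have h := ContMDiffAt.mfderiv (I := 𝓡 n) (I' := 𝓡 n) (J := 𝓡 n) (x₀ := y₀) (n := ∞) (m := ∞)
    (fun y x : N => y * x * y⁻¹) (fun _ => 1) (contMDiff_conj_uncurry (n := n) (N := N)).contMDiffAt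
    contMDiffAt_const (by simp)
  refine h.congr_of_eventuallyEq (Eventually.of_forall fun y => ?_)
  have hg : (fun x : N => x * 1 * x⁻¹) = fun _ => 1 := by ext; simp
  have key : ∀ g : N → N, g = (fun _ => 1) → inTangentCoordinates (𝓡 n) (𝓡 n) (fun _ : N => (1 : N))
      g (adj n : N → _) y₀ y = adj n y := by
    rintro g rfl
    rw [inTangentCoordinates_eq]
    · ext1 v
      have e1 := (tangentBundleCore (𝓡 n) N).coordChange_self
        (achart (EuclideanSpace ℝ (Fin n)) (1 : N)) 1 (mem_chart_source _ _)
      simp only [ContinuousLinearMap.comp_apply]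
      rw [e1, e1]
    · exact mem_chart_source _ _
    · exact mem_chart_source _ _
  exact (key _ hg).symm

theorem continuous_adj : Continuous (adj n : N → _) := contMDiff_adj.continuous

/-- Ad y - 1 is the differential at 1 of x ↦ [y, x]. Each iteration of this map goes one step down
the upper central series, so some iterate is constant. -/
theorem adj_sub_one_pow_eq_zero [Group.IsNilpotent N] (y : N) :
    ∃ m : ℕ, (adj n y - 1) ^ m = 0 := by
  obtain ⟨m, hm⟩ := (Group.isNilpotent_iff (G := N)).1 inferInstance
  refine ⟨m, ?_⟩
  have hstep : HasUnitDeriv (fun x : N => y * x * y⁻¹ * x⁻¹) 1 (adj n y - 1) :=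
    ((hasUnitDeriv_conj y).mul hasUnitDeriv_id.inv).congr_deriv (by rw [sub_eq_add_neg]; rfl)
  have hit : ∀ k : ℕ, HasUnitDeriv (fun x : N => y * x * y⁻¹ * x⁻¹)^[k] 1 ((adj n y - 1) ^ k) := by
    intro k
    induction k with
    | zero => exact hasUnitDeriv_id
    | succ k ih =>
      rw [Function.iterate_succ', pow_succ']
      exact hstep.comp_unit ih
  have hmem : ∀ k ≤ m, ∀ x : N, (fun x : N => y * x * y⁻¹ * x⁻¹)^[k] x ∈
      Subgroup.upperCentralSeries N (m - k) := by
    intro k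
    induction k with
    | zero => intro _ x; simp [hm]
    | succ k ih =>
      intro hk x
      rw [Function.iterate_succ_apply']
      have h1 := ih (by omega) x
      rw [show m - k = (m - (k + 1)) + 1 by omega, Subgroup.mem_upperCentralSeries_succ_iff] at h1
      have h2 := inv_mem (h1 y)
      convert h2 using 1
      group
  refine (hit m).unique ((hasUnitDeriv_const (1 : N)).congr (Eventually.of_forall fun x => ?_))
  simpa using hmem m le_rfl x

/-- In a connected group, the kernel of the adjoint representation is the center. -/
theorem mem_center_of_adj_eq_one [PreconnectedSpace N] {x : N} (hx : adj n x = 1) :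
    x ∈ Subgroup.center N := by
  have := isManifold_one (n := n) (N := N)
  have hsm : ContMDiff (𝓡 n) (𝓡 n) ∞ (fun y : N => x * y * x⁻¹ * y⁻¹) :=
    (contMDiff_conj x).mul contMDiff_id.inv
  have h1 : HasUnitDeriv (fun y : N => x * y * x⁻¹ * y⁻¹) 1 (0 : Euc n →L[ℝ] Euc n) :=
    ((hasUnitDeriv_conj x).mul hasUnitDeriv_id.inv).congr_deriv (by rw [hx]; exact add_neg_cancel _)
  have h0 : ∀ y : N, mfderiv (𝓡 n) (𝓡 n) (fun y : N => x * y * x⁻¹ * y⁻¹) y = 0 := by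
    intro y
    -- near `y`, write the point as `y * z`
    have hF : MDifferentiableAt (𝓡 n) (𝓡 n) (fun z : N => (x * y * x⁻¹) * z * y⁻¹) 1 :=
      ((contMDiff_const.mul contMDiff_id).mul contMDiff_const).mdifferentiableAt (n := ∞) (by simp)
    have hG : MDifferentiableAt (𝓡 n) (𝓡 n) (fun z : N => y⁻¹ * z) y :=
      (contMDiff_const.mul contMDiff_id).mdifferentiableAt (n := ∞) (by simp)
    obtain ⟨B, hB⟩ : ∃ B : Euc n →L[ℝ] Euc n,
      HasMFDerivAt (𝓡 n) (𝓡 n) (fun z : N => y⁻¹ * z) y B := ⟨_, hG.hasMFDerivAt⟩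
    have hG' : HasUnitDeriv (fun z : N => y⁻¹ * z) y B := ⟨by simp, hB⟩
    have h2 := h1.comp_unit hG'
    have h3 := hF.hasMFDerivAt
    rw [← h2.1] at h3
    have h4 := h3.comp y h2.2
    -- The commutator map at z is a translate of the commutator map at y⁻¹z, so the vanishing of its
    -- differential at 1 propagates to every y.
    have h5 : ((fun z : N => (x * y * x⁻¹) * z * y⁻¹) ∘
        fun z : N => x * (y⁻¹ * z) * x⁻¹ * (y⁻¹ * z)⁻¹) = fun y : N => x * y * x⁻¹ * y⁻¹ := by
      ext z; simp only [Function.comp_apply]; group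
    rw [h5] at h4
    rw [h4.mfderiv, ContinuousLinearMap.zero_comp]
    exact ContinuousLinearMap.comp_zero _
  rw [Subgroup.mem_center_iff]
  intro y
  have := eq_of_mfderiv_eq_zero (hsm.mdifferentiable (by simp)) h0 y 1
  simp only [mul_one, mul_inv_cancel, inv_one] at this
  have h6 : x * y * x⁻¹ * y⁻¹ * y * x = y * x := by rw [this, one_mul]
  rw [← h6]; group

/-- A vector whose derivative under the adjoint representation vanishes at the identity is
invariant. -/
theorem adj_apply_eq_self_of_deriv_eq_zero [PreconnectedSpace N] {v : Euc n}
    (hv : mfderiv (𝓡 n) 𝓘(ℝ, Euc n) (fun y : N => adj n y v) 1 = 0) (y : N) : adj n y v = v := by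
  have := isManifold_one (n := n) (N := N)
  have hsm : ContMDiff (𝓡 n) 𝓘(ℝ, Euc n) ∞ (fun y : N => adj n y v) :=
    contMDiff_adj.clm_apply contMDiff_const
  have h0 : ∀ y : N, mfderiv (𝓡 n) 𝓘(ℝ, Euc n) (fun y : N => adj n y v) y = 0 := by
    intro y
    have hG : MDifferentiableAt (𝓡 n) (𝓡 n) (fun z : N => y⁻¹ * z) y :=
      (contMDiff_const.mul contMDiff_id).mdifferentiableAt (n := ∞) (by simp)
    have hF : HasMFDerivAt (𝓡 n) 𝓘(ℝ, Euc n) (fun y : N => adj n y v) (y⁻¹ * y)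
        (0 : Euc n →L[ℝ] Euc n) := by
      rw [inv_mul_cancel]
      have := (hsm.mdifferentiableAt (x := (1 : N)) (by simp)).hasMFDerivAt
      rwa [hv] at this
    obtain ⟨B, hB⟩ : ∃ B : Euc n →L[ℝ] Euc n,
      HasMFDerivAt (𝓡 n) (𝓡 n) (fun z : N => y⁻¹ * z) y B := ⟨_, hG.hasMFDerivAt⟩
    have h1 := hF.comp y hB
    have h2 : HasMFDerivAt 𝓘(ℝ, Euc n) 𝓘(ℝ, Euc n) (fun v : Euc n => adj n y v)
      (adj n (y⁻¹ * y) v) (adj n y) := (adj n y).hasFDerivAt.hasMFDerivAt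
    have h3 := h2.comp y h1
    have h5 : ((fun v : Euc n => adj n y v) ∘ ((fun y : N => adj n y v) ∘ fun z : N => y⁻¹ * z)) =
        fun y : N => adj n y v := by
      ext1 z
      simp only [Function.comp_apply]
      rw [← ContinuousLinearMap.comp_apply, ← adj_mul, mul_inv_cancel_left]
    rw [h5] at h3
    refine h3.mfderiv.trans ?_
    ext1 w
    exact (adj n y).map_zero
  have := eq_of_mfderiv_eq_zero (hsm.mdifferentiable (by simp)) h0 y 1
  simpa [adj_one] using this

end Adjoint


/-! ### The Lie bracket as the differential of the adjoint representation -/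

section Bracket

variable {n : ℕ} {N : Type*} [TopologicalSpace N] [ChartedSpace (EuclideanSpace ℝ (Fin n)) N]
  [Group N] [LieGroup (𝓡 n) ∞ N]

variable (n N) in
/-- The multiplication of `N` in the chart at the identity. -/
def chartMul (p : Euc n × Euc n) : Euc n :=
  extChartAt (𝓡 n) (1 : N) ((extChartAt (𝓡 n) (1 : N)).symm p.1 *
    (extChartAt (𝓡 n) (1 : N)).symm p.2)

variable (n N) in
/-- The point of the model space corresponding to the identity. -/
def chartOne : Euc n := extChartAt (𝓡 n) (1 : N) 1

omit [LieGroup (𝓡 n) ∞ N] in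
variable (n N) in
theorem symm_chartOne : (extChartAt (𝓡 n) (1 : N)).symm (chartOne n N) = 1 :=
  extChartAt_to_inv (I := 𝓡 n) (1 : N)

theorem contDiffAt_chartMul : ContDiffAt ℝ ∞ (chartMul n N) (chartOne n N, chartOne n N) := by
  have hs : ContMDiffAt 𝓘(ℝ, Euc n) (𝓡 n) ∞ (extChartAt (𝓡 n) (1 : N)).symm (chartOne n N) :=
    (contMDiffOn_extChartAt_symm (1 : N)).contMDiffAt (extChartAt_target_mem_nhds (1 : N))
  have h1 : ContMDiffAt (𝓘(ℝ, Euc n).prod 𝓘(ℝ, Euc n)) (𝓡 n) ∞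
      (fun p : Euc n × Euc n => (extChartAt (𝓡 n) (1 : N)).symm p.1 *
        (extChartAt (𝓡 n) (1 : N)).symm p.2) (chartOne n N, chartOne n N) :=
    (hs.comp (chartOne n N, chartOne n N) contMDiffAt_fst).mul
      (hs.comp (chartOne n N, chartOne n N) contMDiffAt_snd)
  have h2 : ContMDiffAt (𝓡 n) 𝓘(ℝ, Euc n) ∞ (extChartAt (𝓡 n) (1 : N)) (1 : N) :=
    contMDiffAt_extChartAt
  have h3 := h2.comp_of_eq (x := (chartOne n N, chartOne n N)) h1 (by simp only [symm_chartOne, mul_one])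
  rw [← modelWithCornersSelf_prod, chartedSpaceSelf_prod] at h3
  exact h3.contDiffAt

/-- The left-invariant vector field of `v`, read in the chart at the identity. -/
theorem mpullback_mulInvariantVectorField_chart (v : GroupLieAlgebra (𝓡 n) N) :
    ∀ᶠ a in 𝓝 (chartOne n N),
      VectorField.mpullbackWithin 𝓘(ℝ, Euc n) (𝓡 n) (extChartAt (𝓡 n) (1 : N)).symm
        (mulInvariantVectorField v) (range (𝓡 n)) a =
      fderiv ℝ (chartMul n N) (a, chartOne n N) ((0 : Euc n), (v : Euc n)) := by
  have := isManifold_one (n := n) (N := N)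
  have hd : ∀ᶠ p in 𝓝 (chartOne n N, chartOne n N), DifferentiableAt ℝ (chartMul n N) p := by
    filter_upwards [((contDiffAt_chartMul (n := n) (N := N)).of_le (m := 1) (by norm_cast)).eventually
      (by simp)] with p hp
    exact hp.differentiableAt (by simp)
  have hd' : ∀ᶠ a in 𝓝 (chartOne n N), DifferentiableAt ℝ (chartMul n N) (a, chartOne n N) := by
    have : Tendsto (fun a : Euc n => (a, chartOne n N)) (𝓝 (chartOne n N))
        (𝓝 (chartOne n N, chartOne n N)) := by
      exact (Continuous.prodMk continuous_id continuous_const).tendsto _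
    exact this hd
  filter_upwards [extChartAt_target_mem_nhds (I := 𝓡 n) (1 : N), hd'] with a ha hda
  set χ := extChartAt (𝓡 n) (1 : N) with hχ
  set g := χ.symm a with hg
  have hgs : g ∈ χ.source := χ.map_target ha
  have e1 : VectorField.mpullbackWithin 𝓘(ℝ, Euc n) (𝓡 n) χ.symm
        (mulInvariantVectorField v) (range (𝓡 n)) a =
      (mfderivWithin 𝓘(ℝ, Euc n) (𝓡 n) χ.symm (range (𝓡 n)) a).inverse
        (mulInvariantVectorField v g) := rfl
  have hinv := mfderiv_extChartAt_comp_mfderivWithin_extChartAt_symm (I := 𝓡 n) (x := (1 : N)) ha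
  have hinv' := mfderivWithin_extChartAt_symm_comp_mfderiv_extChartAt (I := 𝓡 n) (x := (1 : N)) ha
  have e2 : (mfderivWithin 𝓘(ℝ, Euc n) (𝓡 n) χ.symm (range (𝓡 n)) a).inverse =
      mfderiv (𝓡 n) 𝓘(ℝ, Euc n) χ g :=
    ContinuousLinearMap.inverse_eq hinv' hinv
  rw [e1, e2]
  have h1 : HasMFDerivAt (𝓡 n) 𝓘(ℝ, Euc n) χ (g * 1) (mfderiv (𝓡 n) 𝓘(ℝ, Euc n) χ (g * 1)) :=
    (mdifferentiableAt_extChartAt (by rw [mul_one]; simpa [hχ] using hgs)).hasMFDerivAt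
  have h2 : HasMFDerivAt (𝓡 n) (𝓡 n) (fun x : N => g * x) 1
      (mfderiv (𝓡 n) (𝓡 n) (fun x : N => g * x) 1) :=
    ((contMDiff_const.mul contMDiff_id).mdifferentiableAt (n := ∞) (by simp)).hasMFDerivAt
  have h3 := h1.comp (1 : N) h2
  -- the same derivative through the chart
  have h4 : HasFDerivAt (chartMul n N) (fderiv ℝ (chartMul n N) (a, chartOne n N))
      (a, chartOne n N) := hda.hasFDerivAt
  have h5 : HasMFDerivAt (𝓡 n) 𝓘(ℝ, Euc n) (fun x : N => chartMul n N (a, χ x)) 1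
      ((fderiv ℝ (chartMul n N) (a, chartOne n N)).comp
        (ContinuousLinearMap.inr ℝ (Euc n) (Euc n))) := by
    have h6 : HasFDerivAt (fun b : Euc n => chartMul n N (a, b))
      ((fderiv ℝ (chartMul n N) (a, chartOne n N)).comp
        (ContinuousLinearMap.inr ℝ (Euc n) (Euc n))) (chartOne n N) :=
      h4.comp (chartOne n N) (hasFDerivAt_prodMk_right a (chartOne n N))
    have h7 : HasMFDerivAt (𝓡 n) 𝓘(ℝ, Euc n) χ (1 : N) (ContinuousLinearMap.id ℝ (Euc n)) := by
      have h8 := hasMFDerivAt_unitChart (n := n) (N := N)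
      have h9 : HasFDerivAt (fun b : Euc n => b + chartOne n N) (ContinuousLinearMap.id ℝ (Euc n))
        (unitChart n (1 : N)) := (hasFDerivAt_id _).add_const _
      refine (h9.hasMFDerivAt.comp (1 : N) h8).congr_of_eventuallyEq
        (Eventually.of_forall fun b => ?_)
      simp [unitChart, hχ, chartOne]
    exact (h6.hasMFDerivAt.comp (1 : N) h7)
  have h6 : (χ ∘ fun x : N => g * x) =ᶠ[𝓝 1] fun x : N => chartMul n N (a, χ x) := by
    filter_upwards [extChartAt_source_mem_nhds (I := 𝓡 n) (1 : N)] with x hx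
    simp only [Function.comp_apply, chartMul]
    rw [(extChartAt (𝓡 n) (1 : N)).left_inv hx]
  have h7 := hasMFDerivAt_unique h3 (h5.congr_of_eventuallyEq h6)
  have h8 := congrArg (fun D : Euc n →L[ℝ] Euc n => D v) h7
  have h9 : mfderiv (𝓡 n) 𝓘(ℝ, Euc n) χ (g * 1) = mfderiv (𝓡 n) 𝓘(ℝ, Euc n) χ g := by
    rw [mul_one]
  refine Eq.trans ?_ h8
  change _ = (mfderiv (𝓡 n) 𝓘(ℝ, Euc n) χ (g * 1)) (mfderiv (𝓡 n) (𝓡 n) (fun x : N => g * x) 1 v)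
  rw [h9]
  rfl

end Bracket


section Bracket

variable {n : ℕ} {N : Type*} [TopologicalSpace N] [ChartedSpace (EuclideanSpace ℝ (Fin n)) N]
  [Group N] [LieGroup (𝓡 n) ∞ N]

theorem hasUnitDeriv_extChartAt_symm :
    HasUnitDeriv (extChartAt (𝓡 n) (1 : N)).symm (chartOne n N)
      (ContinuousLinearMap.id ℝ (Euc n)) := by
  have := isManifold_one (n := n) (N := N)
  have h1 : MDifferentiableAt 𝓘(ℝ, Euc n) (𝓡 n) (extChartAt (𝓡 n) (1 : N)).symm (chartOne n N) :=
    (mdifferentiableOn_extChartAt_symm (I := 𝓡 n) (x := (1 : N))).mdifferentiableAt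
      (extChartAt_target_mem_nhds (1 : N))
  obtain ⟨D, hD⟩ : ∃ D : Euc n →L[ℝ] Euc n, HasMFDerivAt 𝓘(ℝ, Euc n) (𝓡 n)
    (extChartAt (𝓡 n) (1 : N)).symm (chartOne n N) D := ⟨_, h1.hasMFDerivAt⟩
  have h2 : HasUnitDeriv (extChartAt (𝓡 n) (1 : N)).symm (chartOne n N) D :=
    ⟨symm_chartOne n N, hD⟩
  have h3 := h2.hasFDerivAt
  have h4 : HasFDerivAt (fun b : Euc n => b - chartOne n N) (ContinuousLinearMap.id ℝ (Euc n))
    (chartOne n N) := (hasFDerivAt_id _).sub_const _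
  refine h2.congr_deriv (h3.unique (h4.congr_of_eventuallyEq ?_))
  filter_upwards [extChartAt_target_mem_nhds (I := 𝓡 n) (1 : N)] with b hb
  simp only [unitChart, chartOne, (extChartAt (𝓡 n) (1 : N)).right_inv hb]

theorem eventually_differentiableAt_chartMul :
    ∀ᶠ p in 𝓝 (chartOne n N, chartOne n N), DifferentiableAt ℝ (chartMul n N) p := by
  filter_upwards [((contDiffAt_chartMul (n := n) (N := N)).of_le (m := 1) (by norm_cast)).eventually
      (by simp)] with p hp
  exact hp.differentiableAt (by simp)

/-- The identity `g * x = (g * x * g⁻¹) * g`, differentiated at `x = 1`. -/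
theorem fderiv_chartMul_eq (w : Euc n) : ∀ᶠ a in 𝓝 (chartOne n N),
    fderiv ℝ (chartMul n N) (a, chartOne n N) ((0 : Euc n), w) =
      fderiv ℝ (chartMul n N) (chartOne n N, a)
        (adj n ((extChartAt (𝓡 n) (1 : N)).symm a) w, (0 : Euc n)) := by
  have hd1 : ∀ᶠ a in 𝓝 (chartOne n N), DifferentiableAt ℝ (chartMul n N) (a, chartOne n N) :=
    ((Continuous.prodMk continuous_id continuous_const).tendsto' _ _ rfl).eventually
      (eventually_differentiableAt_chartMul (n := n) (N := N))
  have hd2 : ∀ᶠ a in 𝓝 (chartOne n N), DifferentiableAt ℝ (chartMul n N) (chartOne n N, a) :=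
    ((Continuous.prodMk continuous_const continuous_id).tendsto' _ _ rfl).eventually
      (eventually_differentiableAt_chartMul (n := n) (N := N))
  filter_upwards [hd1, hd2, extChartAt_target_mem_nhds (I := 𝓡 n) (1 : N)] with a h1 h2 ha
  set χ := extChartAt (𝓡 n) (1 : N) with hχ
  set g := χ.symm a with hg
  have hk := (hasUnitDeriv_conj (n := n) g).comp_unit (hasUnitDeriv_extChartAt_symm (n := n))
  have hk1 : HasFDerivAt (fun b => χ (g * χ.symm b * g⁻¹)) (adj n g) (chartOne n N) := by
    have := hk.hasFDerivAt.add_const (chartOne n N)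
    rw [ContinuousLinearMap.comp_id] at this
    refine this.congr_of_eventuallyEq (Eventually.of_forall fun b => ?_)
    simp [unitChart, chartOne, hχ]
  have hk0 : χ (g * χ.symm (chartOne n N) * g⁻¹) = chartOne n N := by
    rw [symm_chartOne]; simp [chartOne, hχ]
  have e1 : HasFDerivAt (fun b => chartMul n N (a, b)) _ (chartOne n N) :=
    h1.hasFDerivAt.comp (chartOne n N) (hasFDerivAt_prodMk_right a (chartOne n N))
  have e2 : HasFDerivAt (fun b => (χ (g * χ.symm b * g⁻¹), a))
      ((ContinuousLinearMap.inl ℝ (Euc n) (Euc n)).comp (adj n g)) (chartOne n N) :=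
    (hasFDerivAt_prodMk_left _ a).comp (chartOne n N) hk1
  have e3 : HasFDerivAt (chartMul n N) (fderiv ℝ (chartMul n N) (chartOne n N, a))
      (χ (g * χ.symm (chartOne n N) * g⁻¹), a) := by rw [hk0]; exact h2.hasFDerivAt
  have e4 := e3.comp (chartOne n N) e2
  have e5 : (fun b => chartMul n N (a, b)) =ᶠ[𝓝 (chartOne n N)]
      (chartMul n N ∘ fun b => (χ (g * χ.symm b * g⁻¹), a)) := by
    have hs : ∀ᶠ b in 𝓝 (chartOne n N), g * χ.symm b * g⁻¹ ∈ χ.source :=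
      hk.tendsto (extChartAt_source_mem_nhds (I := 𝓡 n) (1 : N))
    filter_upwards [hs] with b hb
    simp only [chartMul, Function.comp_apply]
    rw [χ.left_inv hb]
    congr 1
    change g * χ.symm b = g * χ.symm b * g⁻¹ * g
    group
  have e6 := e1.unique (e4.congr_of_eventuallyEq e5)
  have := congrArg (fun D : Euc n →L[ℝ] Euc n => D w) e6
  simpa using this

/-- The differential of the adjoint representation is the Lie bracket. -/
theorem mfderiv_adj_apply (v w : GroupLieAlgebra (𝓡 n) N) :
    mfderiv (𝓡 n) 𝓘(ℝ, Euc n) (fun y : N => adj n y w) 1 v = ⁅v, w⁆ := by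
  have := isManifold_one (n := n) (N := N)
  set o := chartOne n N with ho
  set m := chartMul n N with hm
  set χ := extChartAt (𝓡 n) (1 : N) with hχ
  have hsm : ContDiffAt ℝ 2 m (o, o) := contDiffAt_chartMul.of_le (by norm_cast)
  have hG : DifferentiableAt ℝ (fderiv ℝ m) (o, o) :=
    (hsm.fderiv_right (m := 1) (by norm_num)).differentiableAt (by simp)
  set H := fderiv ℝ (fderiv ℝ m) (o, o) with hH
  have hsymm : ∀ p q, H p q = H q p := fun p q => hsm.isSymmSndFDerivAt (by simp) p q
  -- derivatives of the invariant vector fields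
  have hV : ∀ v : Euc n, HasFDerivAt (fun a => fderiv ℝ m (a, o) ((0 : Euc n), v))
      ((ContinuousLinearMap.apply ℝ (Euc n) ((0 : Euc n), v)).comp
        (H.comp (ContinuousLinearMap.inl ℝ (Euc n) (Euc n)))) o := fun v =>
    (ContinuousLinearMap.apply ℝ (Euc n) ((0 : Euc n), v)).hasFDerivAt.comp o
      (HasFDerivAt.comp (f := fun a => (a, o)) o hG.hasFDerivAt (hasFDerivAt_prodMk_left o o))
  have hfst : HasFDerivAt (fun a => m (a, o)) (ContinuousLinearMap.id ℝ (Euc n)) o := by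
    refine (hasFDerivAt_id o).congr_of_eventuallyEq ?_
    filter_upwards [extChartAt_target_mem_nhds (I := 𝓡 n) (1 : N)] with a ha
    simp only [hm, chartMul, ho, symm_chartOne, mul_one, id]
    exact (extChartAt (𝓡 n) (1 : N)).right_inv ha
  have hsnd : HasFDerivAt (fun a => m (o, a)) (ContinuousLinearMap.id ℝ (Euc n)) o := by
    refine (hasFDerivAt_id o).congr_of_eventuallyEq ?_
    filter_upwards [extChartAt_target_mem_nhds (I := 𝓡 n) (1 : N)] with a ha
    simp only [hm, chartMul, ho, symm_chartOne, one_mul, id]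
    exact (extChartAt (𝓡 n) (1 : N)).right_inv ha
  have hmd : HasFDerivAt m (fderiv ℝ m (o, o)) (o, o) :=
    (hsm.differentiableAt (by simp)).hasFDerivAt
  have hf1 : ∀ v, fderiv ℝ m (o, o) (v, (0 : Euc n)) = v := fun v => by
    have := (HasFDerivAt.comp (f := fun a => (a, o)) o hmd (hasFDerivAt_prodMk_left o o)).unique hfst
    simpa using congrArg (fun D : Euc n →L[ℝ] Euc n => D v) this
  have hf2 : ∀ v, fderiv ℝ m (o, o) ((0 : Euc n), v) = v := fun v => by
    have := (hmd.comp o (hasFDerivAt_prodMk_right o o)).unique hsnd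
    simpa using congrArg (fun D : Euc n →L[ℝ] Euc n => D v) this
  -- the bracket
  have hbr : ⁅v, w⁆ = H ((v : Euc n), (0 : Euc n)) ((0 : Euc n), (w : Euc n)) -
      H ((w : Euc n), (0 : Euc n)) ((0 : Euc n), (v : Euc n)) := by
    let X : Euc n → Euc n :=
      VectorField.mpullbackWithin 𝓘(ℝ, Euc n) (𝓡 n) χ.symm (mulInvariantVectorField v) (range (𝓡 n))
    let Y : Euc n → Euc n :=
      VectorField.mpullbackWithin 𝓘(ℝ, Euc n) (𝓡 n) χ.symm (mulInvariantVectorField w) (range (𝓡 n))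
    let T : Euc n →L[ℝ] Euc n := mfderiv (𝓡 n) 𝓘(ℝ, Euc n) χ (1 : N)
    have hbr0 : ⁅v, w⁆ = T.inverse (VectorField.lieBracketWithin ℝ X Y
        (χ.symm ⁻¹' univ ∩ range (𝓡 n)) o) := rfl
    rw [hbr0]
    have hχ1 : T = ContinuousLinearMap.id ℝ (Euc n) := by
      have h8 := hasMFDerivAt_unitChart (n := n) (N := N)
      have h9 : HasFDerivAt (fun b : Euc n => b + chartOne n N) (ContinuousLinearMap.id ℝ (Euc n))
        (unitChart n (1 : N)) := (hasFDerivAt_id _).add_const _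
      refine ((h9.hasMFDerivAt.comp (1 : N) h8).congr_of_eventuallyEq
        (Eventually.of_forall fun b => ?_)).mfderiv
      simp [unitChart, hχ, chartOne]
    have hset : (χ.symm ⁻¹' univ ∩ range (𝓡 n)) = univ := by simp
    rw [hset]
    have hinv : T.inverse = ContinuousLinearMap.id ℝ (Euc n) := by
      rw [hχ1]; exact ContinuousLinearMap.inverse_id
    rw [hinv]
    have E1 := mpullback_mulInvariantVectorField_chart (n := n) (N := N) v
    have E2 := mpullback_mulInvariantVectorField_chart (n := n) (N := N) w
    rw [VectorField.lieBracketWithin_univ]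
    change VectorField.lieBracket ℝ X Y o = _
    rw [VectorField.lieBracket]
    have F1 : X o = v := (E1.self_of_nhds).trans (hf2 v)
    have F2 : Y o = w := (E2.self_of_nhds).trans (hf2 w)
    have G1 : fderiv ℝ X o = _ := ((hV v).congr_of_eventuallyEq E1).fderiv
    have G2 : fderiv ℝ Y o = _ := ((hV w).congr_of_eventuallyEq E2).fderiv
    rw [F1, F2, G1, G2]
    rfl
  rw [hbr]
  -- the derivative of the adjoint representation
  have hα : MDifferentiableAt (𝓡 n) 𝓘(ℝ, Euc n) (fun y : N => adj n y w) 1 :=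
    (contMDiff_adj.clm_apply contMDiff_const).mdifferentiableAt (n := ∞) (by simp)
  obtain ⟨D, hD⟩ : ∃ D : Euc n →L[ℝ] Euc n, HasMFDerivAt (𝓡 n) 𝓘(ℝ, Euc n)
    (fun y : N => adj n y w) 1 D := ⟨_, hα.hasMFDerivAt⟩
  rw [hD.mfderiv]
  have hαc : HasFDerivAt (fun a => adj n (χ.symm a) w) D o := by
    have h1 := hasUnitDeriv_extChartAt_symm (n := n) (N := N)
    have h2 := hD
    rw [← h1.1] at h2
    have h3 := h2.comp _ h1.2
    have h4 := hasMFDerivAt_iff_hasFDerivAt.1 h3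
    exact h4
  have hα0 : adj n (χ.symm o) w = w := by
    rw [hχ, ho, symm_chartOne, adj_one]; rfl
  have hR : HasFDerivAt (fun a => fderiv ℝ m (o, a) (adj n (χ.symm a) w, (0 : Euc n)))
      ((fderiv ℝ m (o, o)).comp ((ContinuousLinearMap.inl ℝ (Euc n) (Euc n)).comp D) +
        (H.comp (ContinuousLinearMap.inr ℝ (Euc n) (Euc n))).flip ((w : Euc n), (0 : Euc n))) o := by
    have h1 : HasFDerivAt (fun a => fderiv ℝ m (o, a))
      (H.comp (ContinuousLinearMap.inr ℝ (Euc n) (Euc n))) o :=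
      hG.hasFDerivAt.comp o (hasFDerivAt_prodMk_right o o)
    have h2 : HasFDerivAt (fun a => (adj n (χ.symm a) w, (0 : Euc n)))
      ((ContinuousLinearMap.inl ℝ (Euc n) (Euc n)).comp D) o :=
      (ContinuousLinearMap.inl ℝ (Euc n) (Euc n)).hasFDerivAt.comp o hαc
    have h3 := h1.clm_apply h2
    rw [hα0] at h3
    exact h3
  -- Differentiating ∂₂m(a, o)w = ∂₁m(o, a)(Ad(a)w) at a = o in the direction v gives H(v,0)(0,w) =
  -- Dv + H(0,v)(w,0). Symmetry of H turns the last term into H(w,0)(0,v).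
  have key := (hV w).unique (hR.congr_of_eventuallyEq (fderiv_chartMul_eq (N := N) (w : Euc n)))
  have key2 := congrArg (fun T : Euc n →L[ℝ] Euc n => T v) key
  have key3 : H ((v : Euc n), (0 : Euc n)) ((0 : Euc n), (w : Euc n)) =
      fderiv ℝ m (o, o) ((D v : Euc n), (0 : Euc n)) +
        H ((0 : Euc n), (v : Euc n)) ((w : Euc n), (0 : Euc n)) := key2
  rw [hf1, hsymm ((0 : Euc n), (v : Euc n))] at key3
  exact eq_sub_of_add_eq key3.symm

/-- The vectors fixed by the adjoint representation of a connected group are the central ones. -/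
theorem adj_apply_eq_self_iff [PreconnectedSpace N] (w : GroupLieAlgebra (𝓡 n) N) :
    (∀ y : N, adj n y w = w) ↔ w ∈ LieAlgebra.center ℝ (GroupLieAlgebra (𝓡 n) N) := by
  rw [LieModule.mem_maxTrivSubmodule]
  constructor
  · intro h v
    rw [← mfderiv_adj_apply]
    have h1 : HasMFDerivAt (𝓡 n) 𝓘(ℝ, Euc n) (fun y : N => adj n y w) 1
        (0 : Euc n →L[ℝ] Euc n) :=
      (hasMFDerivAt_const (I := 𝓡 n) (I' := 𝓘(ℝ, Euc n)) (M' := Euc n) w (1 : N)).congr_of_eventuallyEq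
        (Eventually.of_forall h)
    exact congrArg (fun D : Euc n →L[ℝ] Euc n => D v) h1.mfderiv
  · intro h
    refine adj_apply_eq_self_of_deriv_eq_zero ?_
    ext1 v
    exact (mfderiv_adj_apply v w).trans (h v)

end Bracket


/-! ### One-parameter subgroups -/

section OneParameter

variable {n : ℕ} {N : Type*} [TopologicalSpace N] [ChartedSpace (EuclideanSpace ℝ (Fin n)) N]
  [Group N]

theorem comp_toSpanSingleton_eq {E F : Type*} [NormedAddCommGroup E] [NormedSpace ℝ E]
    [NormedAddCommGroup F] [NormedSpace ℝ F] (D : E →L[ℝ] F) (v : E) :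
    D.comp (ContinuousLinearMap.toSpanSingleton ℝ v) =
      ContinuousLinearMap.toSpanSingleton ℝ (D v) := by
  ext1; simp

theorem IsOneParameterSubgroup.hasUnitDeriv {c : ℝ → N} {v : Euc n}
    (hc : IsOneParameterSubgroup c v) :
    HasUnitDeriv c 0 (ContinuousLinearMap.toSpanSingleton ℝ v) := ⟨hc.1, hc.2.2⟩

theorem IsOneParameterSubgroup.neg {c : ℝ → N} {v : Euc n}
    (hc : IsOneParameterSubgroup c v) (t : ℝ) : c (-t) = (c t)⁻¹ := by
  rw [eq_inv_iff_mul_eq_one, ← hc.2.1, neg_add_cancel, hc.1]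

theorem IsOneParameterSubgroup.comp_mul {c : ℝ → N} {v : Euc n}
    (hc : IsOneParameterSubgroup c v) (a : ℝ) :
    IsOneParameterSubgroup (fun t => c (a * t)) (a • v) := by
  refine ⟨by simp [hc.1], fun s t => by simp only [mul_add, hc.2.1], ?_⟩
  have h1 : HasFDerivAt (fun t : ℝ => a * t) (ContinuousLinearMap.toSpanSingleton ℝ a) 0 := by
    simpa using ((hasDerivAt_id (0 : ℝ)).const_mul a).hasFDerivAt
  refine ((hc.hasUnitDeriv.comp (f := fun t : ℝ => a * t) (mul_zero a) h1.hasMFDerivAt).congr_deriv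
    (comp_toSpanSingleton_eq (ContinuousLinearMap.toSpanSingleton ℝ v) a)).2

theorem IsOneParameterSubgroup.map {c : ℝ → N} {v : Euc n} (hc : IsOneParameterSubgroup c v)
    (f : N →* N) {D : Euc n →L[ℝ] Euc n} (hf : HasUnitDeriv f 1 D) :
    IsOneParameterSubgroup (fun t => f (c t)) (D v) := by
  refine ⟨by simp [hc.1], fun s t => by simp [hc.2.1], ?_⟩
  exact ((hf.comp_unit hc.hasUnitDeriv).congr_deriv (comp_toSpanSingleton_eq _ _)).2

/-- The distance to the identity along a one-parameter subgroup is comparable to the time. -/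
theorem IsOneParameterSubgroup.eventually_norm_unitChart {c : ℝ → N} {v : Euc n}
    (hc : IsOneParameterSubgroup c v) (hv : v ≠ 0) :
    ∀ᶠ t in 𝓝 (0 : ℝ), ‖v‖ / 2 * |t| ≤ ‖unitChart n (c t)‖ := by
  have h1 := hc.hasUnitDeriv.hasFDerivAt.isLittleO
  have h2 := h1.bound (c := ‖v‖ / 2) (by positivity)
  filter_upwards [h2] with t ht
  simp only [hc.1, unitChart_one, sub_zero, ContinuousLinearMap.toSpanSingleton_apply,
    Real.norm_eq_abs] at ht
  have h3 : ‖t • v‖ - ‖unitChart n (c t)‖ ≤ ‖unitChart n (c t) - t • v‖ := by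
    rw [norm_sub_rev]; exact norm_sub_norm_le _ _
  rw [norm_smul, Real.norm_eq_abs] at h3
  linarith

variable [LieGroup (𝓡 n) ∞ N]

theorem HasUnitDeriv.const_mul {E₁ : Type*} [NormedAddCommGroup E₁] [NormedSpace ℝ E₁]
    {M₁ : Type*} [TopologicalSpace M₁] [ChartedSpace E₁ M₁] {f : M₁ → N} {a : M₁}
    {D : E₁ →L[ℝ] Euc n} (hf : HasUnitDeriv f a D) (y : N) :
    HasMFDerivAt 𝓘(ℝ, E₁) (𝓡 n) (fun x => y * f x) a
      (ContinuousLinearMap.comp (mfderiv (𝓡 n) (𝓡 n) (fun x : N => y * x) 1 :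
        Euc n →L[ℝ] Euc n) D) := by
  have h1 : MDifferentiableAt (𝓡 n) (𝓡 n) (fun x : N => y * x) (f a) :=
    ((contMDiff_mul_left (I := 𝓡 n) (n := ∞) (a := y)).mdifferentiableAt (by simp))
  have h2 := h1.hasMFDerivAt.comp a hf.2
  rw [hf.1] at h2
  exact h2

/-- From c(s) = c(t)c(s - t), the velocity at t is the left translate of the velocity at 0.
Uniqueness for one-parameter subgroups thereby becomes uniqueness for integral curves. -/
theorem IsOneParameterSubgroup.isMIntegralCurve {c : ℝ → N} {v : Euc n}
    (hc : IsOneParameterSubgroup c v) :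
    IsMIntegralCurve (I := 𝓡 n) c (mulInvariantVectorField v) := by
  intro t
  have h0 := hc.hasUnitDeriv
  rw [← sub_self t] at h0
  have h1 : HasFDerivAt (fun s : ℝ => s - t) (ContinuousLinearMap.id ℝ ℝ) t :=
    (hasFDerivAt_id t).sub_const t
  have h2 := (h0.comp (f := fun s : ℝ => s - t) rfl h1.hasMFDerivAt).const_mul (c t)
  have h3 : (fun s => c t * c (s - t)) = c := by
    funext s; rw [← hc.2.1, add_sub_cancel]
  rw [h3] at h2
  refine h2.congr_mfderiv ?_
  ext1
  have key : ∀ (T : Euc n →L[ℝ] Euc n) (x : Euc n), ((T.comp ((ContinuousLinearMap.toSpanSingleton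
      ℝ x).comp (ContinuousLinearMap.id ℝ ℝ))) (1 : ℝ)) = (1 : ℝ) • T x := by
    intro T x
    rw [ContinuousLinearMap.comp_id, comp_toSpanSingleton_eq,
      ContinuousLinearMap.toSpanSingleton_apply]
  exact key _ _

theorem contMDiff_mulInvariantVectorField_one (v : GroupLieAlgebra (𝓡 n) N) :
    ContMDiff (𝓡 n) (𝓡 n).tangent 1
      (fun g : N => (mulInvariantVectorField v g : TangentBundle (𝓡 n) N)) :=
  (contMDiff_mulInvariantVectorField (I := 𝓡 n) (G := N) v).of_le (by
    rw [minSmoothness_of_isRCLikeNormedField]; norm_cast)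

theorem isMIntegralCurve_ext [T2Space N] {c c' : ℝ → N} {v : GroupLieAlgebra (𝓡 n) N}
    (hc : IsMIntegralCurve (I := 𝓡 n) c (mulInvariantVectorField v))
    (hc' : IsMIntegralCurve (I := 𝓡 n) c' (mulInvariantVectorField v)) {t₀ : ℝ}
    (h : c t₀ = c' t₀) : c = c' :=
  have := isManifold_one (n := n) (N := N)
  isMIntegralCurve_Ioo_eq_of_contMDiff_boundaryless (contMDiff_mulInvariantVectorField_one v)
    hc hc' h

theorem IsOneParameterSubgroup.unique [T2Space N] {c c' : ℝ → N} {v : Euc n}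
    (hc : IsOneParameterSubgroup c v) (hc' : IsOneParameterSubgroup c' v) : c = c' :=
  isMIntegralCurve_ext hc.isMIntegralCurve hc'.isMIntegralCurve (hc.1.trans hc'.1.symm)

theorem mfderiv_mul_left_mulInvariantVectorField (v : GroupLieAlgebra (𝓡 n) N) (g y : N) :
    mfderiv (𝓡 n) (𝓡 n) (fun x : N => g * x) y (mulInvariantVectorField v y) =
      mulInvariantVectorField v (g * y) := by
  have h1 : ∀ z w : N, MDifferentiableAt (𝓡 n) (𝓡 n) (fun x : N => z * x) w := fun z w =>
    (contMDiff_mul_left (I := 𝓡 n) (n := ∞) (a := z)).mdifferentiableAt (by simp)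
  have h2 : (fun x : N => g * y * x) = (fun x : N => g * x) ∘ (fun x : N => y * x) := by
    funext x; simp [mul_assoc]
  have h4 : HasMFDerivAt (𝓡 n) (𝓡 n) (fun x : N => g * x) (y * 1) _ := (h1 g (y * 1)).hasMFDerivAt
  have h3 := (h4.comp (1 : N) (h1 y 1).hasMFDerivAt).mfderiv
  rw [← h2] at h3
  have h5 := congrArg (fun D : Euc n →L[ℝ] Euc n => D (v : Euc n)) h3
  rw [mul_one] at h5
  exact h5.symm

theorem isMIntegralCurveOn_mul_left {c : ℝ → N} {v : GroupLieAlgebra (𝓡 n) N} {s : Set ℝ}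
    (hc : IsMIntegralCurveOn (I := 𝓡 n) c (mulInvariantVectorField v) s) (g : N) :
    IsMIntegralCurveOn (I := 𝓡 n) (fun t => g * c t) (mulInvariantVectorField v) s := by
  intro t ht
  have h1 : MDifferentiableAt (𝓡 n) (𝓡 n) (fun x : N => g * x) (c t) :=
    (contMDiff_mul_left (I := 𝓡 n) (n := ∞) (a := g)).mdifferentiableAt (by simp)
  refine (h1.hasMFDerivAt.comp_hasMFDerivWithinAt t (hc t ht)).congr_mfderiv ?_
  rw [← mfderiv_mul_left_mulInvariantVectorField]
  have key : ∀ (T : Euc n →L[ℝ] Euc n) (x : Euc n),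
      T.comp ((1 : ℝ →L[ℝ] ℝ).smulRight x) = (1 : ℝ →L[ℝ] ℝ).smulRight (T x) := by
    intro T x; ext1; simp
  exact key _ _

/-- Left translates of one short integral curve through 1 give the same existence time at every
point, so the left-invariant field is complete. -/
theorem exists_isOneParameterSubgroup [T2Space N] (v : Euc n) :
    ∃ c : ℝ → N, IsOneParameterSubgroup c v := by
  have := isManifold_one (n := n) (N := N)
  have hv := contMDiff_mulInvariantVectorField_one (n := n) (N := N) v
  obtain ⟨γ, hγ0, hγ⟩ := exists_isMIntegralCurveAt_of_contMDiffAt_boundaryless (t₀ := 0)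
    (hv (1 : N))
  obtain ⟨ε, hε, hγ⟩ := isMIntegralCurveAt_iff'.1 hγ
  rw [Real.ball_eq_Ioo, zero_sub, zero_add] at hγ
  obtain ⟨c, hc0, hc⟩ := exists_isMIntegralCurve_of_isMIntegralCurveOn hv hε
    (fun x => ⟨fun t => x * γ t, by simp [hγ0], isMIntegralCurveOn_mul_left hγ x⟩) 1
  refine ⟨c, hc0, fun s t => ?_, ?_⟩
  -- For fixed s, the curves c(s)c(t) and c(s + t) are integral curves of the same field that agree
  -- at t = 0.
  · have h1 : IsMIntegralCurve (I := 𝓡 n) (fun t => c s * c t) (mulInvariantVectorField v) :=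
      isMIntegralCurve_iff_isMIntegralCurveOn.2
        (isMIntegralCurveOn_mul_left (hc.isMIntegralCurveOn univ) (c s))
    have h2 := isMIntegralCurve_ext h1 (hc.comp_add s) (t₀ := 0) (by simp [hc0])
    rw [add_comm]
    exact (congrFun h2 t).symm
  · refine (hc 0).congr_mfderiv ?_
    rw [hc0]
    have h1 : (mulInvariantVectorField (I := 𝓡 n) v (1 : N)) = v := by
      have : HasMFDerivAt (𝓡 n) (𝓡 n) (fun x : N => 1 * x) 1 (ContinuousLinearMap.id ℝ (Euc n)) :=
        (hasMFDerivAt_id (1 : N)).congr_of_eventuallyEq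
          (Eventually.of_forall fun x => one_mul x)
      exact congrArg (fun D : Euc n →L[ℝ] Euc n => D v) this.mfderiv
    ext1
    rw [h1]
    rfl

/-- The curves f(c(t)) and c(at) are one-parameter subgroups with the same velocity. -/
theorem IsOneParameterSubgroup.map_eigenvector [T2Space N] {c : ℝ → N}
    {v : Euc n} (hc : IsOneParameterSubgroup c v) (f : N →* N)
    {D : Euc n →L[ℝ] Euc n} (hf : HasUnitDeriv f 1 D) {a : ℝ} (hD : D (v : Euc n) = a • (v : Euc n))
    (t : ℝ) : f (c t) = c (a * t) :=
  congrFun (IsOneParameterSubgroup.unique (v := (a • (v : Euc n) : Euc n)) (hD ▸ hc.map f hf)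
    (hc.comp_mul a)) t

/-- A vector fixed by Ad y is an eigenvector of conjugation by y with eigenvalue 1, so that
conjugation fixes the curve pointwise. -/
theorem IsOneParameterSubgroup.mem_center_of_adj [T2Space N] {c : ℝ → N}
    {v : Euc n} (hc : IsOneParameterSubgroup c v)
    (hv : ∀ y : N, adj n y v = v) (t : ℝ) : c t ∈ Subgroup.center N := by
  rw [Subgroup.mem_center_iff]
  intro g
  have h := hc.map_eigenvector (MulAut.conj g).toMonoidHom (D := adj n g) (a := 1)
    ((hasUnitDeriv_conj g).congr (Eventually.of_forall fun _ => rfl)) (by rw [one_smul]; exact hv g)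
    t
  simp only [one_mul, MulEquiv.coe_toMonoidHom, MulAut.conj_apply] at h
  exact mul_inv_eq_iff_eq_mul.1 h

theorem IsOneParameterSubgroup.adj_of_mem_center {c : ℝ → N} {v : Euc n}
    (hc : IsOneParameterSubgroup c v) (h : ∀ᶠ t in 𝓝 (0 : ℝ), c t ∈ Subgroup.center N) (y : N) :
    adj n y v = v := by
  have h1 := (hasUnitDeriv_conj (n := n) y).comp_unit hc.hasUnitDeriv
  have h2 := h1.unique (hc.hasUnitDeriv.congr (h.mono fun t ht => by
    simp only []
    rw [Subgroup.mem_center_iff.1 ht y, mul_inv_cancel_right]))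
  rw [comp_toSpanSingleton_eq] at h2
  simpa only [ContinuousLinearMap.toSpanSingleton_apply, one_smul] using
    congrArg (fun D : ℝ →L[ℝ] Euc n => D 1) h2

/-- Regularity at 0 is bootstrapped from the differential equation: in the chart the velocity is a
smooth function of the position, so each order of differentiability yields the next. The
homomorphism property transports smoothness to all times. -/
theorem IsOneParameterSubgroup.contMDiff {c : ℝ → N} {v : Euc n}
    (hc : IsOneParameterSubgroup c v) : ContMDiff 𝓘(ℝ, ℝ) (𝓡 n) ∞ c := by
  have := isManifold_one (n := n) (N := N)
  set χ := extChartAt (𝓡 n) (1 : N) with hχ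
  set o := chartOne n N
  have hχc : Tendsto (fun t => χ (c t)) (𝓝 0) (𝓝 o) := by
    have h1 := continuousAt_extChartAt (I := 𝓡 n) (1 : N)
    exact h1.tendsto.comp hc.hasUnitDeriv.tendsto
  have hd : ∀ᶠ t in 𝓝 (0 : ℝ), HasFDerivAt (fun t => χ (c t))
      (ContinuousLinearMap.toSpanSingleton ℝ (fderiv ℝ (chartMul n N) (χ (c t), o) ((0 : Euc n), v)))
      t := by
    have h1 : ∀ᶠ t in 𝓝 (0 : ℝ), DifferentiableAt ℝ (chartMul n N) (χ (c t), o) :=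
      (hχc.prodMk_nhds tendsto_const_nhds).eventually (eventually_differentiableAt_chartMul (N := N))
    have h2 : ∀ᶠ t in 𝓝 (0 : ℝ), c t ∈ χ.source :=
      hc.hasUnitDeriv.tendsto (extChartAt_source_mem_nhds (I := 𝓡 n) (1 : N))
    filter_upwards [h1, h2] with t ht hts
    have e1 : HasFDerivAt (fun s => χ (c s)) (ContinuousLinearMap.toSpanSingleton ℝ v) 0 := by
      have := hc.hasUnitDeriv.hasFDerivAt.add_const o
      refine this.congr_of_eventuallyEq (Eventually.of_forall fun s => ?_)
      simp [unitChart, o, chartOne, hχ]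
    have e2 : HasFDerivAt (fun s : ℝ => s - t) (ContinuousLinearMap.id ℝ ℝ) t :=
      (hasFDerivAt_id t).sub_const t
    have e3 : HasFDerivAt (fun s => χ (c (s - t)))
        ((ContinuousLinearMap.toSpanSingleton ℝ v).comp (ContinuousLinearMap.id ℝ ℝ)) t := by
      refine HasFDerivAt.comp (g := fun s => χ (c s)) (f := fun s : ℝ => s - t) t ?_ e2
      rw [sub_self]; exact e1
    have e4 : HasFDerivAt (fun s => chartMul n N (χ (c t), χ (c (s - t)))) _ t :=
      HasFDerivAt.comp (g := chartMul n N) (f := fun s => (χ (c t), χ (c (s - t)))) t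
        (by rw [sub_self, hc.1]; exact ht.hasFDerivAt)
        ((hasFDerivAt_prodMk_right (χ (c t)) _).comp t e3)
    refine (e4.congr_of_eventuallyEq ?_).congr_fderiv ?_
    · have h3 : ∀ᶠ s in 𝓝 t, c (s - t) ∈ χ.source := by
        have : Tendsto (fun s : ℝ => s - t) (𝓝 t) (𝓝 0) := by
          exact (continuous_id.sub (continuous_const (y := t))).tendsto' _ _ (sub_self t)
        exact this.eventually h2
      filter_upwards [h3] with s hs
      simp only [chartMul]
      rw [χ.left_inv hts, χ.left_inv hs, ← hc.2.1, add_sub_cancel]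
    · ext1
      simp
  have hk : ∀ k : ℕ, ContDiffAt ℝ k (fun t => χ (c t)) 0 := by
    intro k
    induction k with
    | zero =>
      have : ContinuousAt (fun t => χ (c t)) 0 ∧ ∀ᶠ t in 𝓝 (0 : ℝ), ContinuousAt (fun t => χ (c t)) t :=
        ⟨hd.self_of_nhds.continuousAt, hd.mono fun t ht => ht.continuousAt⟩
      have h0 := this.2
      rw [Nat.cast_zero, contDiffAt_zero]
      exact ⟨_, h0, fun t ht => ContinuousAt.continuousWithinAt ht⟩
    | succ k ih =>
      rw [Nat.cast_succ, contDiffAt_succ_iff_hasFDerivAt]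
      refine ⟨_, ⟨_, hd, fun t ht => ht⟩, ?_⟩
      have h1 : ContDiffAt ℝ k (fun p => fderiv ℝ (chartMul n N) p) (o, o) :=
        ((contDiffAt_chartMul (n := n) (N := N)).fderiv_right (m := k)
          (by exact_mod_cast le_top))
      have h2 : ContDiffAt ℝ k (fun t => fderiv ℝ (chartMul n N) (χ (c t), o)) 0 := by
        refine ContDiffAt.comp (g := fun p => fderiv ℝ (chartMul n N) p)
          (f := fun t => (χ (c t), o)) 0 ?_ (ih.prodMk contDiffAt_const)
        rw [hc.1]; exact h1
      exact (ContinuousLinearMap.toSpanSingletonCLE (𝕜 := ℝ) (E := Euc n)).contDiff.contDiffAt.comp 0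
        (h2.clm_apply contDiffAt_const)
  have h0 : ContMDiffAt 𝓘(ℝ, ℝ) (𝓡 n) ∞ c 0 := by
    rw [contMDiffAt_iff]
    refine ⟨hc.hasUnitDeriv.continuousAt, ?_⟩
    have : ContDiffAt ℝ ∞ (fun t => χ (c t)) 0 := contDiffAt_infty.2 hk
    rw [hχ, ← hc.1] at this
    exact this.contDiffWithinAt
  intro t
  have h1 : ContMDiffAt 𝓘(ℝ, ℝ) (𝓡 n) ∞ (fun s => c (s - t)) t := by
    have h2 : ContMDiffAt 𝓘(ℝ, ℝ) 𝓘(ℝ, ℝ) ∞ (fun s : ℝ => s - t) t :=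
      (contDiff_id.sub contDiff_const).contMDiff.contMDiffAt
    refine ContMDiffAt.comp (g := c) t ?_ h2
    rw [sub_self]; exact h0
  refine (contMDiffAt_const (c := c t)).mul h1 |>.congr_of_eventuallyEq
    (Eventually.of_forall fun s => ?_)
  change c s = c t * c (s - t)
  rw [← hc.2.1, add_sub_cancel]

end OneParameter


/-! ### Smooth action and right-invariant framing on the quotient -/

section QuotientCalculus

variable {n : ℕ} {N : Type*} [TopologicalSpace N] [ChartedSpace (EuclideanSpace ℝ (Fin n)) N]
  [Group N] [LieGroup (𝓡 n) ∞ N]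

theorem isTopGroup (n : ℕ) (N : Type*) [TopologicalSpace N]
    [ChartedSpace (EuclideanSpace ℝ (Fin n)) N] [Group N] [LieGroup (𝓡 n) ∞ N] :
    IsTopologicalGroup N := topologicalGroup_of_lieGroup (𝓡 n) ∞

variable {Γ : Subgroup N} [DiscreteTopology Γ]

theorem contMDiff_mk : ContMDiff (𝓡 n) (𝓡 n) ∞ (QuotientGroup.mk : N → N ⧸ Γ) := by
  have := isTopGroup n N
  have hloc := isLocalHomeomorph_mk Γ
  intro p
  rw [contMDiffAt_iff_target]
  refine ⟨hloc.continuous.continuousAt, ?_⟩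
  -- The chart at the class of p is built from a chosen representative q, which may differ from p by
  -- an element of Γ. Right translation by p⁻¹q corrects for this.
  set q : N := (QuotientGroup.mk_surjective (s := Γ)).hasRightInverse.choose (p : N ⧸ Γ) with hq
  have hqp : (q : N ⧸ Γ) = p := (QuotientGroup.mk_surjective (s := Γ)).hasRightInverse.choose_spec _
  have hγ : p⁻¹ * q ∈ Γ := QuotientGroup.eq.1 hqp.symm
  have h1 : ContMDiffAt (𝓡 n) (𝓡 n) ∞ (fun y : N => y * (p⁻¹ * q)) p :=
    (contMDiff_id.mul contMDiff_const).contMDiffAt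
  have h2 : ContMDiffAt (𝓡 n) 𝓘(ℝ, EuclideanSpace ℝ (Fin n)) ∞
      (chartAt (EuclideanSpace ℝ (Fin n)) q) (p * (p⁻¹ * q)) := by
    rw [mul_inv_cancel_left]
    exact contMDiffAt_extChartAt (I := 𝓡 n)
  refine (ContMDiffAt.comp (g := chartAt (EuclideanSpace ℝ (Fin n)) q) p h2 h1).congr_of_eventuallyEq
    ?_
  have h3 : ∀ᶠ y in 𝓝 p, y * (p⁻¹ * q) ∈ (hloc.localInverseAt q).target := by
    refine h1.continuousAt ((hloc.localInverseAt q).open_target.mem_nhds ?_)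
    simp only [mul_inv_cancel_left]
    exact hloc.self_mem_localInverseAt_target
  filter_upwards [h3] with y hy
  have h4 := (hloc.localInverseAt q).right_inv hy
  rw [hloc.localInverseAt_symm, QuotientGroup.mk_mul_of_mem _ hγ] at h4
  change chartAt (EuclideanSpace ℝ (Fin n)) q (hloc.localInverseAt q (y : N ⧸ Γ)) = _
  rw [h4]; rfl

/-- A smooth local section of the orbit map `g ↦ g • x`. -/
theorem exists_orbit_section (x : N ⧸ Γ) : ∃ s : N ⧸ Γ → N,
    ContMDiffAt (𝓡 n) (𝓡 n) ∞ s x ∧ s x = 1 ∧ (∀ᶠ y in 𝓝 x, s y • x = y) ∧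
      ∀ᶠ g in 𝓝 (1 : N), s (g • x) = g := by
  have := isTopGroup n N
  have hloc := isLocalHomeomorph_mk Γ
  set q : N := (QuotientGroup.mk_surjective (s := Γ)).hasRightInverse.choose x with hq
  have hqx : (q : N ⧸ Γ) = x := (QuotientGroup.mk_surjective (s := Γ)).hasRightInverse.choose_spec _
  set σ := hloc.localInverseAt q with hσ
  have hxs : x ∈ σ.source := by rw [← hqx]; exact hloc.apply_self_mem_localInverseAt_source
  have hσx : σ x = q := by
    have := σ.right_inv (hloc.self_mem_localInverseAt_target (x := q))
    rwa [hloc.localInverseAt_symm, hqx] at this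
  have hsm : ContMDiffAt (𝓡 n) (𝓡 n) ∞ σ x := by
    rw [contMDiffAt_iff_target]
    refine ⟨σ.continuousAt hxs, ?_⟩
    rw [hσx]
    exact contMDiffAt_extChartAt (I := 𝓡 n) (x := x)
  refine ⟨fun y => σ y * q⁻¹, hsm.mul contMDiffAt_const, by simp [hσx], ?_, ?_⟩
  · filter_upwards [σ.open_source.mem_nhds hxs] with y hy
    have h := hloc.apply_localInverseAt_of_mem hy
    rw [← hqx]
    change ((σ y * q⁻¹ * q : N) : N ⧸ Γ) = y
    rw [inv_mul_cancel_right, h]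
  · have h1 : ∀ᶠ g in 𝓝 (1 : N), g * q ∈ σ.target := by
      have : Continuous fun g : N => g * q := continuous_id.mul continuous_const
      refine this.continuousAt (σ.open_target.mem_nhds ?_)
      rw [one_mul]; exact hloc.self_mem_localInverseAt_target
    filter_upwards [h1] with g hg
    have h4 := σ.right_inv hg
    rw [hloc.localInverseAt_symm] at h4
    rw [← hqx]
    change σ ((g * q : N) : N ⧸ Γ) * q⁻¹ = g
    rw [h4, mul_inv_cancel_right]

theorem contMDiff_orbit (x : N ⧸ Γ) :
    ContMDiff (𝓡 n) (𝓡 n) ∞ (fun g : N => g • x) := by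
  obtain ⟨p, rfl⟩ := QuotientGroup.mk_surjective x
  exact contMDiff_mk.comp (contMDiff_id.mul contMDiff_const)

/-- With a local section s of the orbit map at x, the action near (g, x) is (g, y) ↦ (g s(y)) • x,
which reduces it to multiplication in N. -/
theorem contMDiff_smul_quotient :
    ContMDiff ((𝓡 n).prod (𝓡 n)) (𝓡 n) ∞ (fun p : N × N ⧸ Γ => p.1 • p.2) := by
  intro ⟨g, x⟩
  obtain ⟨s, hs, hsx, hs1, -⟩ := exists_orbit_section (n := n) x
  have h1 : ContMDiffAt ((𝓡 n).prod (𝓡 n)) (𝓡 n) ∞ (fun p : N × N ⧸ Γ => (p.1 * s p.2) • x) (g, x) :=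
    (contMDiff_orbit x).contMDiffAt.comp (g, x)
      (contMDiffAt_fst.mul (ContMDiffAt.comp (g := s) (g, x) hs contMDiffAt_snd))
  refine h1.congr_of_eventuallyEq ?_
  filter_upwards [continuousAt_snd.eventually hs1] with p hp
  rw [mul_smul, hp]

/-- Smoothness of a map on `N ⧸ Γ` may be tested along an orbit map. -/
theorem contMDiffAt_of_orbit {E' : Type*} [NormedAddCommGroup E'] [NormedSpace ℝ E']
    {M' : Type*} [TopologicalSpace M'] [ChartedSpace E' M'] {f : N ⧸ Γ → M'} {x : N ⧸ Γ}
    {k : WithTop ℕ∞} (hk : k ≤ ∞)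
    (h : ContMDiffAt (𝓡 n) 𝓘(ℝ, E') k (fun g : N => f (g • x)) 1) :
    ContMDiffAt (𝓡 n) 𝓘(ℝ, E') k f x := by
  obtain ⟨s, hs, hsx, hs1, -⟩ := exists_orbit_section (n := n) x
  rw [← hsx] at h
  refine (ContMDiffAt.comp (g := fun g : N => f (g • x)) x h (hs.of_le hk)).congr_of_eventuallyEq ?_
  filter_upwards [hs1] with y hy
  simp only [Function.comp_apply, hy]

theorem contMDiff_of_comp_mk {E' : Type*} [NormedAddCommGroup E'] [NormedSpace ℝ E']
    {M' : Type*} [TopologicalSpace M'] [ChartedSpace E' M'] {f : N ⧸ Γ → M'}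
    (h : ContMDiff (𝓡 n) 𝓘(ℝ, E') ∞ (fun g : N => f g)) : ContMDiff (𝓡 n) 𝓘(ℝ, E') ∞ f := by
  intro x
  obtain ⟨p, rfl⟩ := QuotientGroup.mk_surjective x
  refine contMDiffAt_of_orbit le_rfl ?_
  have h1 : ContMDiff (𝓡 n) (𝓡 n) ∞ (fun g : N => g * p) := contMDiff_id.mul contMDiff_const
  exact (h.comp h1).contMDiffAt

theorem hasMFDerivAt_frame (x : N ⧸ Γ) :
    HasMFDerivAt (𝓡 n) (𝓡 n) (fun g : N => g • x) 1 (frame Γ x) :=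
  ((contMDiff_orbit x).mdifferentiableAt (by simp)).hasMFDerivAt

/-- A local section and the orbit map are inverse to each other near x and 1, so their differentials
are too. This makes `(frame Γ x).inverse` a genuine inverse. -/
theorem exists_hasUnitDeriv_section (x : N ⧸ Γ) : ∃ s : N ⧸ Γ → N,
    HasUnitDeriv s x (frame (n := n) Γ x).inverse ∧ (∀ᶠ y in 𝓝 x, s y • x = y) ∧
      (frame Γ x).comp (frame Γ x).inverse = ContinuousLinearMap.id ℝ (Euc n) ∧
      (frame Γ x).inverse.comp (frame Γ x) = ContinuousLinearMap.id ℝ (Euc n) := by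
  have := isManifold_one (n := n) (N := N)
  obtain ⟨s, hs, hsx, hs1, hs2⟩ := exists_orbit_section (n := n) x
  obtain ⟨D, hD⟩ : ∃ D : Euc n →L[ℝ] Euc n, HasMFDerivAt (𝓡 n) (𝓡 n) s x D :=
    ⟨_, (hs.mdifferentiableAt (by simp)).hasMFDerivAt⟩
  have hu : HasUnitDeriv s x D := ⟨hsx, hD⟩
  have h1 : D.comp (frame Γ x) = ContinuousLinearMap.id ℝ (Euc n) :=
    (hu.comp (f := fun g : N => g • x) (one_smul N x) (hasMFDerivAt_frame x)).unique
      (hasUnitDeriv_id.congr hs2)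
  have h2 : (frame Γ x).comp D = ContinuousLinearMap.id ℝ (Euc n) := by
    have h3 := hasMFDerivAt_frame (n := n) x
    rw [← hsx] at h3
    exact hasMFDerivAt_unique ((h3.comp x hD).congr_of_eventuallyEq
      (hs1.mono fun y hy => by simp only [Function.comp_apply, hy]; rfl)) (hasMFDerivAt_id x)
  have h4 : (frame Γ x).inverse = D := ContinuousLinearMap.inverse_eq h2 h1
  rw [h4]
  exact ⟨s, hu, hs1, h2, h1⟩

theorem frame_comp_inverse (x : N ⧸ Γ) :
    (frame Γ x).comp (frame Γ x).inverse = ContinuousLinearMap.id ℝ (Euc n) :=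
  (exists_hasUnitDeriv_section x).choose_spec.2.2.1

theorem frame_inverse_comp (x : N ⧸ Γ) :
    (frame Γ x).inverse.comp (frame Γ x) = ContinuousLinearMap.id ℝ (Euc n) :=
  (exists_hasUnitDeriv_section x).choose_spec.2.2.2

/-- The differential of `f` at `x` is `D` in the right-invariant framing: near `x` the map `f` is
`g • x ↦ m g • f x` where `m` has differential `D` at the identity. -/
def HasFrameDeriv (f : N ⧸ Γ → N ⧸ Γ) (x : N ⧸ Γ) (D : Euc n →L[ℝ] Euc n) : Prop :=
  ∃ m : N → N, HasUnitDeriv m 1 D ∧ ∀ᶠ g in 𝓝 (1 : N), f (g • x) = m g • f x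

theorem HasFrameDeriv.hasMFDerivAt {f : N ⧸ Γ → N ⧸ Γ} {x : N ⧸ Γ} {D : Euc n →L[ℝ] Euc n}
    (h : HasFrameDeriv f x D) :
    HasMFDerivAt (𝓡 n) (𝓡 n) f x ((frame Γ (f x)).comp (D.comp (frame Γ x).inverse)) := by
  obtain ⟨m, hm, hf⟩ := h
  obtain ⟨s, hs, hs1, -⟩ := exists_hasUnitDeriv_section (n := n) x
  have h1 := hm.comp_unit hs
  have h2 := hasMFDerivAt_frame (n := n) (f x)
  rw [← h1.1] at h2
  refine (h2.comp x h1.2).congr_of_eventuallyEq ?_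
  filter_upwards [hs1, hs.tendsto.eventually hf] with y hy hy'
  rw [hy] at hy'
  exact hy'

omit [LieGroup (𝓡 n) ∞ N] [DiscreteTopology Γ] in
theorem hasFrameDeriv_id (x : N ⧸ Γ) :
    HasFrameDeriv (fun y => y) x (ContinuousLinearMap.id ℝ (Euc n)) :=
  ⟨_, hasUnitDeriv_id, Eventually.of_forall fun _ => rfl⟩

omit [LieGroup (𝓡 n) ∞ N] [DiscreteTopology Γ] in
theorem HasFrameDeriv.comp {f g : N ⧸ Γ → N ⧸ Γ} {x : N ⧸ Γ} {D D' : Euc n →L[ℝ] Euc n}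
    (hg : HasFrameDeriv g (f x) D') (hf : HasFrameDeriv f x D) :
    HasFrameDeriv (fun y => g (f y)) x (D'.comp D) := by
  obtain ⟨m, hm, hf⟩ := hf
  obtain ⟨m', hm', hg⟩ := hg
  refine ⟨_, hm'.comp_unit hm, ?_⟩
  filter_upwards [hf, hm.tendsto.eventually hg] with y hy hy'
  rw [hy, hy']

/-- The product of the maps `D (i)`, `i < k`, with later factors on the left. -/
def cocycleProd (D : ℕ → Euc n →L[ℝ] Euc n) : ℕ → Euc n →L[ℝ] Euc n
  | 0 => ContinuousLinearMap.id ℝ _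
  | k + 1 => (D k).comp (cocycleProd D k)

omit [LieGroup (𝓡 n) ∞ N] [DiscreteTopology Γ] in
theorem HasFrameDeriv.iterate {f : N ⧸ Γ → N ⧸ Γ} {x : N ⧸ Γ} {D : ℕ → Euc n →L[ℝ] Euc n}
    (hf : ∀ k, HasFrameDeriv f (f^[k] x) (D k)) (k : ℕ) :
    HasFrameDeriv f^[k] x (cocycleProd D k) := by
  induction k with
  | zero => exact hasFrameDeriv_id x
  | succ k ih =>
    have := (hf k).comp ih
    rwa [show (fun y => f (f^[k] y)) = f^[k + 1] from by
      funext y; rw [Function.iterate_succ_apply']] at this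

/-- The tangent norm is the Euclidean norm in the framing, so growth along orbits is a question
about matrix products. -/
theorem HasFrameDeriv.tangentNorm_mfderiv {f : N ⧸ Γ → N ⧸ Γ} {x : N ⧸ Γ}
    {D : Euc n →L[ℝ] Euc n} (h : HasFrameDeriv f x D) (v : Euc n) :
    tangentNorm Γ (f x) (mfderiv (𝓡 n) (𝓡 n) f x v) = ‖D ((frame Γ x).inverse v)‖ := by
  have h1 : mfderiv (𝓡 n) (𝓡 n) f x = _ := h.hasMFDerivAt.mfderiv
  rw [h1]
  have h2 := congrArg (fun T : Euc n →L[ℝ] Euc n => T (D ((frame Γ x).inverse v)))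
    (frame_inverse_comp (n := n) (f x))
  exact congrArg norm h2

/-- At a fixed point the differential is conjugate to the differential in the framing. -/
theorem HasFrameDeriv.diffAt_eq {f : N ⧸ Γ → N ⧸ Γ} {x : N ⧸ Γ} {D : Euc n →L[ℝ] Euc n}
    (h : HasFrameDeriv f x D) (hx : f x = x) :
    diffAt (Euc n) f x = (frame Γ x).comp (D.comp (frame Γ x).inverse) := by
  have h1 := h.hasMFDerivAt.mfderiv
  rw [hx] at h1
  exact h1

end QuotientCalculus


/-! ### Simple spectrum and real eigenbases -/

section Eigenbasis

/-- An endomorphism whose complex eigenvalues have distinct moduli has a real eigenbasis. -/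
theorem exists_eigenbasis {n : ℕ} (T : Module.End ℝ (Euc n))
    (h : ((T.charpoly.map (algebraMap ℝ ℂ)).roots.map fun z => ‖z‖).Nodup) :
    ∃ (b : Module.Basis (Fin n) ℝ (Euc n)) (ev : Fin n → ℝ), (∀ i, T (b i) = ev i • b i) ∧
      Function.Injective (fun i => |ev i|) ∧
      ∀ i, (ev i : ℂ) ∈ (T.charpoly.map (algebraMap ℝ ℂ)).roots := by
  set p := T.charpoly with hp
  set q := p.map (algebraMap ℝ ℂ) with hq
  have hpm : p.Monic := T.charpoly_monic
  have hqm : q.Monic := hpm.map _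
  have hcard : Multiset.card q.roots = n := by
    rw [IsAlgClosed.card_roots_eq_natDegree, hq, hpm.natDegree_map, hp,
      LinearMap.charpoly_natDegree, finrank_euclideanSpace_fin]
  have hinj : ∀ z ∈ q.roots, ∀ z' ∈ q.roots, ‖z‖ = ‖z'‖ → z = z' := fun z hz z' hz' hzz =>
    Multiset.inj_on_of_nodup_map h z hz z' hz' hzz
  -- The conjugate of a root is again a root and has the same modulus. Distinct moduli force it to
  -- be the same root.
  have hreal : ∀ z ∈ q.roots, ((z.re : ℝ) : ℂ) = z := by
    intro z hz
    have hz0 : Polynomial.aeval z p = 0 := by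
      have := (Polynomial.mem_roots'.1 hz).2
      rwa [Polynomial.IsRoot, hq, Polynomial.eval_map_algebraMap] at this
    have hc : (starRingEnd ℂ) z ∈ q.roots := by
      rw [Polynomial.mem_roots', Polynomial.IsRoot, hq, Polynomial.eval_map_algebraMap,
        Polynomial.aeval_conj, hz0, map_zero]
      exact ⟨hqm.ne_zero, rfl⟩
    exact Complex.conj_eq_iff_re.1 (hinj _ hc _ hz (Complex.norm_conj z))
  set S : Finset ℝ := (q.roots.map Complex.re).toFinset with hS
  have hSmem : ∀ r, r ∈ S ↔ (r : ℂ) ∈ q.roots := by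
    intro r
    simp only [hS, Multiset.mem_toFinset, Multiset.mem_map]
    constructor
    · rintro ⟨z, hz, rfl⟩; rwa [hreal z hz]
    · intro hr; exact ⟨r, hr, Complex.ofReal_re r⟩
  have hScard : S.card = n := by
    rw [hS, Multiset.toFinset_card_of_nodup, Multiset.card_map, hcard]
    refine (Multiset.Nodup.of_map _ h).map_on ?_
    intro z hz z' hz' hzz
    rw [← hreal z hz, ← hreal z' hz', hzz]
  have hev : ∀ r ∈ S, T.HasEigenvalue r := by
    intro r hr
    rw [Module.End.hasEigenvalue_iff_isRoot_charpoly]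
    have := (Polynomial.mem_roots'.1 ((hSmem r).1 hr)).2
    rw [hq] at this
    exact (Polynomial.isRoot_map_iff (algebraMap ℝ ℂ).injective).1 this
  let e : Fin n ≃ S := (S.equivFinOfCardEq hScard).symm
  choose v hv using fun i : Fin n => (hev (e i) (e i).2).exists_hasEigenvector
  have hinj' : Function.Injective fun i : Fin n => ((e i : S) : ℝ) :=
    Subtype.val_injective.comp e.injective
  have hli : LinearIndependent ℝ v := Module.End.eigenvectors_linearIndependent' T
    (fun i : Fin n => ((e i : S) : ℝ)) hinj' v hv
  have hfr : Fintype.card (Fin n) = Module.finrank ℝ (Euc n) := by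
    rw [Fintype.card_fin, finrank_euclideanSpace_fin]
  let b := basisOfLinearIndependentOfCardEqFinrank' v hli hfr
  refine ⟨b, fun i => e i, fun i => ?_, fun i j hij => ?_, fun i => (hSmem _).1 (e i).2⟩
  · simp only [b, coe_basisOfLinearIndependentOfCardEqFinrank']
    exact (hv i).apply_eq_smul
  · refine hinj' (Complex.ofReal_injective (hinj _ ((hSmem _).1 (e i).2) _ ((hSmem _).1 (e j).2) ?_))
    simpa using hij

end Eigenbasis

section Automorphism

variable {n : ℕ} {N : Type*} [TopologicalSpace N] [ChartedSpace (EuclideanSpace ℝ (Fin n)) N]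
  [Group N] {Γ : Subgroup N}

namespace AnosovAutomorphism

/-- The differential of the automorphism at the identity. -/
def deriv (L : AnosovAutomorphism n Γ) : Euc n →L[ℝ] Euc n := diffAt (Euc n) L.lift 1

theorem hasUnitDeriv (L : AnosovAutomorphism n Γ) : HasUnitDeriv L.lift 1 L.deriv :=
  ⟨map_one _, ((L.contMDiff_lift).mdifferentiableAt (by simp)).hasMFDerivAt⟩

@[simp] theorem toFun_mk (L : AnosovAutomorphism n Γ) (g : N) :
    L.toFun (g : N ⧸ Γ) = (L.lift g : N ⧸ Γ) := rfl

theorem toFun_smul (L : AnosovAutomorphism n Γ) (g : N) (x : N ⧸ Γ) :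
    L.toFun (g • x) = L.lift g • L.toFun x := by
  obtain ⟨p, rfl⟩ := QuotientGroup.mk_surjective x
  change ((L.lift (g * p) : N) : N ⧸ Γ) = ((L.lift g * L.lift p : N) : N ⧸ Γ)
  rw [map_mul]

theorem hasFrameDeriv (L : AnosovAutomorphism n Γ) (x : N ⧸ Γ) :
    HasFrameDeriv L.toFun x L.deriv :=
  ⟨L.lift, L.hasUnitDeriv, Eventually.of_forall fun g => L.toFun_smul g x⟩

/-- The bijection `gΓ ↦ L(g)Γ` of `N ⧸ Γ`. -/
def equiv (L : AnosovAutomorphism n Γ) : N ⧸ Γ ≃ N ⧸ Γ where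
  toFun := L.toFun
  invFun := Quotient.map' L.lift.symm fun a b hab => by
    rw [QuotientGroup.leftRel_apply] at hab ⊢
    have h : a⁻¹ * b ∈ Γ.map L.lift.toMonoidHom := L.map_eq.ge hab
    obtain ⟨γ, hγ, hγ'⟩ := h
    rw [← map_inv, ← map_mul, ← hγ']
    simpa using hγ
  left_inv x := by
    obtain ⟨p, rfl⟩ := QuotientGroup.mk_surjective x
    change ((L.lift.symm (L.lift p) : N) : N ⧸ Γ) = p
    rw [MulEquiv.symm_apply_apply]
  right_inv x := by
    obtain ⟨p, rfl⟩ := QuotientGroup.mk_surjective x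
    change ((L.lift (L.lift.symm p) : N) : N ⧸ Γ) = p
    rw [MulEquiv.apply_symm_apply]

@[simp] theorem equiv_apply (L : AnosovAutomorphism n Γ) (x : N ⧸ Γ) : L.equiv x = L.toFun x := rfl

theorem equiv_symm_smul (L : AnosovAutomorphism n Γ) (g : N) (x : N ⧸ Γ) :
    L.equiv.symm (g • x) = L.lift.symm g • L.equiv.symm x := by
  rw [Equiv.symm_apply_eq, equiv_apply, toFun_smul, MulEquiv.apply_symm_apply, ← equiv_apply,
    Equiv.apply_symm_apply]

variable [LieGroup (𝓡 n) ∞ N]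

/-- The automorphism is equivariant for the adjoint representation. -/
theorem deriv_comp_adj (L : AnosovAutomorphism n Γ) (y : N) :
    L.deriv.comp (adj n y) = (adj n (L.lift y)).comp L.deriv :=
  (L.hasUnitDeriv.comp_unit (hasUnitDeriv_conj y)).unique
    (((hasUnitDeriv_conj (L.lift y)).comp_unit L.hasUnitDeriv).congr
      (Eventually.of_forall fun x => by simp))

variable [DiscreteTopology Γ]

theorem contMDiff_toFun (L : AnosovAutomorphism n Γ) : ContMDiff (𝓡 n) (𝓡 n) ∞ L.toFun :=
  contMDiff_of_comp_mk (contMDiff_mk.comp L.contMDiff_lift)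

theorem contMDiff_equiv_symm (L : AnosovAutomorphism n Γ) :
    ContMDiff (𝓡 n) (𝓡 n) ∞ L.equiv.symm :=
  contMDiff_of_comp_mk (contMDiff_mk.comp L.contMDiff_lift_symm)

/-- The eigenvalues and eigenvectors of an automorphism with simple spectrum. -/
structure Eigenbasis (L : AnosovAutomorphism n Γ) where
  basis : Module.Basis (Fin n) ℝ (Euc n)
  ev : Fin n → ℝ
  apply_basis : ∀ i, L.deriv (basis i) = ev i • basis i
  abs_injective : Function.Injective fun i => |ev i|
  abs_ne_one : ∀ i, |ev i| ≠ 1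
  ne_zero : ∀ i, ev i ≠ 0

omit [DiscreteTopology Γ] [LieGroup (𝓡 n) ∞ N] in
theorem exists_eigenbasis (L : AnosovAutomorphism n Γ) (hL : L.HasSimpleSpectrum) :
    Nonempty L.Eigenbasis := by
  obtain ⟨b, ev, hb, hinj, hmem⟩ := Nilmanifold.exists_eigenbasis (lieDifferential n L.lift) hL
  refine ⟨⟨b, ev, hb, hinj, fun i h => L.hyperbolic _ (hmem i) (by simpa using h), fun i h => ?_⟩⟩
  -- The differential is invertible because the inverse automorphism is differentiable, so zero is
  -- not an eigenvalue.
  have hs : HasUnitDeriv L.lift.symm 1 (diffAt (Euc n) L.lift.symm 1) :=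
    ⟨map_one _, ((L.contMDiff_lift_symm).mdifferentiableAt (by simp)).hasMFDerivAt⟩
  have h1 := (hs.comp_unit L.hasUnitDeriv).unique
    (hasUnitDeriv_id.congr (Eventually.of_forall fun x => by simp))
  have h2 : L.deriv (b i) = ev i • b i := hb i
  rw [h, zero_smul] at h2
  have h3 := congrArg (fun D : Euc n →L[ℝ] Euc n => D (b i)) h1
  simp only [ContinuousLinearMap.comp_apply, h2, map_zero, ContinuousLinearMap.id_apply] at h3
  exact b.ne_zero i h3.symm

omit [DiscreteTopology Γ] [LieGroup (𝓡 n) ∞ N] in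
theorem Eigenbasis.coord_apply {L : AnosovAutomorphism n Γ} (B : L.Eigenbasis) (v : Euc n)
    (i : Fin n) : B.basis.repr (L.deriv v) i = B.ev i * B.basis.repr v i := by
  conv_lhs => rw [← B.basis.sum_repr v]
  simp only [map_sum, map_smul, B.apply_basis, Finsupp.coe_finsetSum, Finset.sum_apply,
    Finsupp.coe_smul, Pi.smul_apply, Module.Basis.repr_self, smul_eq_mul]
  rw [Finset.sum_eq_single i]
  · rw [Finsupp.single_eq_same]; ring
  · intro j _ hj; rw [Finsupp.single_eq_of_ne hj.symm]; ring
  · simp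

omit [DiscreteTopology Γ] [LieGroup (𝓡 n) ∞ N] in
/-- Eigenvectors are multiples of basis vectors. -/
theorem Eigenbasis.eigenvector {L : AnosovAutomorphism n Γ} (B : L.Eigenbasis) {v : Euc n} {r : ℝ}
    (hv : L.deriv v = r • v) (hv0 : v ≠ 0) :
    ∃ i, B.ev i = r ∧ v = B.basis.repr v i • B.basis i ∧ B.basis.repr v i ≠ 0 := by
  have h1 : ∀ i, (B.ev i - r) * B.basis.repr v i = 0 := by
    intro i
    have := B.coord_apply v i
    rw [hv] at this
    simp only [map_smul, Finsupp.coe_smul, Pi.smul_apply, smul_eq_mul] at this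
    linarith
  obtain ⟨i, hi⟩ : ∃ i, B.basis.repr v i ≠ 0 := by
    by_contra! hc
    exact hv0 (B.basis.repr.map_eq_zero_iff.1 (Finsupp.ext hc))
  have hri : B.ev i = r := by
    rcases mul_eq_zero.1 (h1 i) with h | h
    · linarith
    · exact absurd h hi
  refine ⟨i, hri, ?_, hi⟩
  conv_lhs => rw [← B.basis.sum_repr v]
  refine Finset.sum_eq_single i (fun j _ hj => ?_) (by simp)
  rcases mul_eq_zero.1 (h1 j) with h | h
  · exact absurd (B.abs_injective (by simp only []; rw [hri, sub_eq_zero.1 h])) hj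
  · rw [h, zero_smul]

end AnosovAutomorphism

end Automorphism


/-! ### Lattices in nilpotent groups and closedness of Z(N)Γ -/

section CocompactDiscrete

variable {N : Type*} [TopologicalSpace N] [Group N] [IsTopologicalGroup N]
  (Γ : Subgroup N)

/-- A cocompact subgroup has a compact fundamental set. -/
theorem exists_compact_interior_cover [LocallyCompactSpace N] [CompactSpace (N ⧸ Γ)] :
    ∃ K : Set N, IsCompact K ∧ ∀ y : N, ∃ γ ∈ Γ, y * γ ∈ interior K := by
  choose U hUc hU using fun y : N => exists_compact_mem_nhds y
  have hopen : ∀ y : N, IsOpen ((QuotientGroup.mk : N → N ⧸ Γ) '' interior (U y)) := fun y =>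
    QuotientGroup.isOpenMap_coe _ isOpen_interior
  obtain ⟨t, ht⟩ := isCompact_univ.elim_finite_subcover
    (fun y : N => (QuotientGroup.mk : N → N ⧸ Γ) '' interior (U y)) hopen (by
      intro x _
      obtain ⟨y, rfl⟩ := QuotientGroup.mk_surjective x
      exact mem_iUnion.2 ⟨y, y, mem_interior_iff_mem_nhds.2 (hU y), rfl⟩)
  refine ⟨⋃ y ∈ t, U y, t.isCompact_biUnion fun y _ => hUc y, fun y => ?_⟩
  obtain ⟨a, ha, b, hb, hab⟩ := mem_iUnion₂.1 (ht (mem_univ (y : N ⧸ Γ)))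
  refine ⟨y⁻¹ * b, QuotientGroup.eq.1 hab.symm, ?_⟩
  rw [mul_inv_cancel_left]
  exact interior_mono (subset_biUnion_of_mem (u := U) ha) hb

/-- A discrete cocompact subgroup of a connected group is finitely generated. -/
theorem exists_finite_generators [LocallyCompactSpace N] [T2Space N] [PreconnectedSpace N]
    [DiscreteTopology Γ] [CompactSpace (N ⧸ Γ)] :
    ∃ F : Set N, F.Finite ∧ Subgroup.closure F = Γ := by
  obtain ⟨K, hK, hKΓ⟩ := exists_compact_interior_cover Γ
  have hΓ : IsClosed (Γ : Set N) := inferInstance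
  set F : Set N := (K⁻¹ * K) ∩ Γ with hF
  have hFfin : F.Finite := by
    refine IsCompact.finite ((hK.inv.mul hK).inter_right hΓ) ?_
    exact IsDiscrete.mono ⟨‹DiscreteTopology Γ›⟩ inter_subset_right
  refine ⟨F, hFfin, le_antisymm ((Subgroup.closure_le _).2 inter_subset_right) ?_⟩
  set Γ' := Subgroup.closure F
  have hle : Γ' ≤ Γ := (Subgroup.closure_le _).2 inter_subset_right
  -- Translates of the interior of K by elements of Γ that meet differ by an element of F. So A and
  -- B are disjoint open sets covering N, and connectedness leaves only A.
  set A : Set N := interior K * (Γ' : Set N)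
  set B : Set N := interior K * ((Γ : Set N) \ Γ')
  have hA : IsOpen A := isOpen_interior.mul_right
  have hB : IsOpen B := isOpen_interior.mul_right
  have hdisj : Disjoint A B := by
    rw [Set.disjoint_left]
    rintro _ ⟨a, ha, γ, hγ, rfl⟩ ⟨b, hb, δ, ⟨hδ, hδ'⟩, hab⟩
    simp only at hab
    apply hδ'
    have h1 : b⁻¹ * a = δ * γ⁻¹ := by
      rw [inv_mul_eq_iff_eq_mul, ← mul_assoc, hab, mul_inv_cancel_right]
    have h2 : b⁻¹ * a ∈ F := by
      refine ⟨Set.mul_mem_mul (Set.inv_mem_inv.2 (interior_subset hb)) (interior_subset ha), ?_⟩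
      rw [h1]
      exact Γ.mul_mem hδ (Γ.inv_mem (hle hγ))
    have h3 : δ = (b⁻¹ * a) * γ := by rw [h1, inv_mul_cancel_right]
    rw [h3]
    exact Γ'.mul_mem (Subgroup.subset_closure h2) hγ
  have hcov : (univ : Set N) ⊆ A ∪ B := by
    intro y _
    obtain ⟨γ, hγ, hy⟩ := hKΓ y
    by_cases hg : γ ∈ Γ'
    · exact Or.inl ⟨y * γ, hy, γ⁻¹, Γ'.inv_mem hg, mul_inv_cancel_right _ _⟩
    · exact Or.inr ⟨y * γ, hy, γ⁻¹, ⟨Γ.inv_mem hγ, fun h => hg (by simpa using Γ'.inv_mem h)⟩,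
        mul_inv_cancel_right _ _⟩
  obtain ⟨γ₀, hγ₀, hy₀⟩ := hKΓ 1
  rw [one_mul] at hy₀
  have hAne : γ₀ ∈ A := ⟨γ₀, hy₀, 1, Γ'.one_mem, mul_one _⟩
  rcases isPreconnected_univ.subset_or_subset hA hB hdisj hcov with h | h
  · intro γ hγ
    by_contra hg
    have : γ₀ * γ ∈ B := ⟨γ₀, hy₀, γ, ⟨hγ, hg⟩, rfl⟩
    exact hdisj.le_bot ⟨h (mem_univ _), this⟩
  · exact absurd (h (mem_univ γ₀)) (Set.disjoint_left.1 hdisj hAne)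

end CocompactDiscrete

section Unipotent

/-- The powers of a unipotent element depend polynomially on the exponent. -/
theorem pow_eq_sum_choose {R : Type*} [Ring R] {a : R} {m : ℕ} (ha : (a - 1) ^ m = 0) (k : ℕ) :
    a ^ k = ∑ i ∈ Finset.range m, (k.choose i : R) * (a - 1) ^ i := by
  have h1 : a ^ k = ∑ i ∈ Finset.range (k + 1), (k.choose i : R) * (a - 1) ^ i := by
    conv_lhs => rw [← sub_add_cancel a 1, (Commute.one_right (a - 1)).add_pow]
    refine Finset.sum_congr rfl fun i _ => ?_
    rw [one_pow, mul_one, Nat.cast_comm]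
  have h2 : ∀ M, m ≤ M → ∑ i ∈ Finset.range M, (k.choose i : R) * (a - 1) ^ i =
      ∑ i ∈ Finset.range m, (k.choose i : R) * (a - 1) ^ i := fun M hM =>
    (Finset.sum_subset (Finset.range_mono hM) fun i _ hi => by
      rw [Finset.mem_range, not_lt] at hi
      rw [pow_eq_zero_of_le hi ha, mul_zero]).symm
  have h3 : ∀ M, k + 1 ≤ M → ∑ i ∈ Finset.range M, (k.choose i : R) * (a - 1) ^ i =
      ∑ i ∈ Finset.range (k + 1), (k.choose i : R) * (a - 1) ^ i := fun M hM =>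
    (Finset.sum_subset (Finset.range_mono hM) fun i _ hi => by
      rw [Finset.mem_range, not_lt] at hi
      rw [Nat.choose_eq_zero_of_lt hi, Nat.cast_zero, zero_mul]).symm
  rw [h1, ← h3 (max m (k + 1)) (le_max_right _ _), h2 _ (le_max_left _ _)]

theorem exists_polynomial_choose (i : ℕ) :
    ∃ p : Polynomial ℝ, ∀ k : ℕ, (k.choose i : ℝ) = p.eval (k : ℝ) := by
  refine ⟨Polynomial.C ((i.factorial : ℝ)⁻¹) * descPochhammer ℝ i, fun k => ?_⟩
  rw [Polynomial.eval_mul, Polynomial.eval_C, descPochhammer_eval_eq_descFactorial,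
    Nat.descFactorial_eq_factorial_mul_choose]
  push_cast
  have : (i.factorial : ℝ) ≠ 0 := by positivity
  field_simp

/-- If the products of the powers of two unipotent elements stay bounded, they are trivial. -/
theorem mul_eq_one_of_bounded {R : Type*} [Ring R] [Algebra ℝ R] {a b : R} {m m' : ℕ}
    (ha : (a - 1) ^ m = 0) (hb : (b - 1) ^ m' = 0) (ℓ : R →ₗ[ℝ] ℝ) {C : ℝ}
    (hC : ∀ k : ℕ, |ℓ (a ^ k * b ^ k)| ≤ C) : ℓ (a * b) = ℓ 1 := by
  choose q hq using exists_polynomial_choose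
  set p : Polynomial ℝ := ∑ i ∈ Finset.range m, ∑ j ∈ Finset.range m',
    q i * q j * Polynomial.C (ℓ ((a - 1) ^ i * (b - 1) ^ j)) with hp
  have hcast : ∀ (k : ℕ), (k : R) = algebraMap ℝ R k := fun k => (map_natCast _ k).symm
  have hpk : ∀ k : ℕ, ℓ (a ^ k * b ^ k) = p.eval (k : ℝ) := by
    intro k
    rw [pow_eq_sum_choose ha k, pow_eq_sum_choose hb k, Finset.sum_mul_sum, hp]
    simp only [map_sum, Polynomial.eval_finsetSum, Polynomial.eval_mul, Polynomial.eval_C, ← hq]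
    refine Finset.sum_congr rfl fun i _ => Finset.sum_congr rfl fun j _ => ?_
    have : (k.choose i : R) * (a - 1) ^ i * ((k.choose j : R) * (b - 1) ^ j) =
        ((k.choose i : ℝ) * (k.choose j : ℝ)) • ((a - 1) ^ i * (b - 1) ^ j) := by
      rw [hcast, hcast, ← Algebra.smul_def, ← Algebra.smul_def, smul_mul_smul_comm]
    rw [this, map_smul, smul_eq_mul]
  -- For unipotent a and b the matrix entry is polynomial in k. A polynomial bounded on ℕ is
  -- constant, so its values at k = 1 and k = 0 agree.
  have hdeg : ¬ 0 < p.degree := by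
    intro hd
    have h1 := (Polynomial.abs_tendsto_atTop p hd).comp (tendsto_natCast_atTop_atTop (R := ℝ))
    obtain ⟨k, hk⟩ := (h1.eventually (eventually_gt_atTop C)).exists
    simp only [Function.comp_apply, ← hpk] at hk
    exact absurd (hC k) (not_le.2 hk)
  rw [not_lt, Polynomial.degree_le_zero_iff] at hdeg
  have h0 := hpk 0
  have h1 := hpk 1
  rw [hdeg, Polynomial.eval_C] at h0 h1
  rw [pow_one, pow_one] at h1
  rw [pow_zero, pow_zero, mul_one] at h0
  rw [h1, h0]

end Unipotent

section Centralizer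

variable {N : Type*} [TopologicalSpace N] [Group N]

/-- A Lie group has no small subgroups. -/
theorem exists_nhds_no_small_subgroup (n : ℕ) (N : Type*) [TopologicalSpace N] [Group N]
    [ChartedSpace (EuclideanSpace ℝ (Fin n)) N] [LieGroup (𝓡 n) ∞ N] : ∃ W ∈ 𝓝 (1 : N), ∀ g : N, (∀ k : ℕ, g ^ k ∈ W) → g = 1 := by
  have h1 : HasUnitDeriv (fun y : N => y * y) 1 ((2 : ℝ) • ContinuousLinearMap.id ℝ (Euc n)) :=
    (hasUnitDeriv_id.mul hasUnitDeriv_id).congr_deriv (two_smul _ _).symm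
  have h2 := h1.isLittleO.bound (c := 1 / 2) (by norm_num)
  have h3 : ∀ᶠ y in 𝓝 (1 : N), ‖unitChart n y‖ < 1 :=
    (tendsto_unitChart (n := n) (N := N)).norm.eventually_lt_const (by simp)
  refine ⟨_, (h2.and (h3.and (unitSource_mem_nhds (n := n) (N := N)))), fun g hg => ?_⟩
  -- Squaring doubles the coordinates up to an error of half their size. They grow by at least 3/2
  -- at each squaring, which cannot go on within a bounded chart.
  have h4 : ∀ k : ℕ, (3 / 2 : ℝ) ^ k * ‖unitChart n g‖ ≤ ‖unitChart n (g ^ 2 ^ k)‖ := by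
    intro k
    induction k with
    | zero => simp
    | succ k ih =>
      have h5 := (hg (2 ^ k)).1
      simp only [smul_apply, ContinuousLinearMap.id_apply] at h5
      rw [← pow_two, ← pow_mul, ← pow_succ] at h5
      have h6 : ‖(2 : ℝ) • unitChart n (g ^ 2 ^ k)‖ - ‖unitChart n (g ^ 2 ^ (k + 1))‖ ≤
          1 / 2 * ‖unitChart n (g ^ 2 ^ k)‖ :=
        (norm_sub_norm_le _ _).trans (by rw [norm_sub_rev]; exact h5)
      rw [norm_smul, Real.norm_of_nonneg (by norm_num)] at h6
      rw [pow_succ]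
      nlinarith
  have h7 : unitChart n g = 0 := by
    by_contra hne
    have hpos : 0 < ‖unitChart n g‖ := norm_pos_iff.2 hne
    obtain ⟨k, hk⟩ := pow_unbounded_of_one_lt (1 / ‖unitChart n g‖) (by norm_num : (1 : ℝ) < 3 / 2)
    rw [div_lt_iff₀ hpos] at hk
    linarith [h4 k, (hg (2 ^ k)).2.1]
  have := (hg 1).2.2
  rw [pow_one] at this
  exact eq_one_of_unitChart this h7

variable (Γ : Subgroup N) [DiscreteTopology Γ] [T2Space N] [PreconnectedSpace N]
  [Group.IsNilpotent N] [CompactSpace (N ⧸ Γ)]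

omit [DiscreteTopology Γ] [T2Space N] in
/-- Commutators with elements of the centralizer of a cocompact subgroup are central. -/
theorem commutator_mem_center_of_mem_centralizer (n : ℕ) [ChartedSpace (EuclideanSpace ℝ (Fin n)) N]
    [LieGroup (𝓡 n) ∞ N] {x : N}
    (hx : x ∈ Subgroup.centralizer (Γ : Set N)) (y : N) : ⁅x, y⁆ ∈ Subgroup.center N := by
  have := isTopGroup n N
  have : LocallyCompactSpace N := Manifold.locallyCompact_of_finiteDimensional (𝓡 n)
  obtain ⟨K, hK, hKΓ⟩ := exists_compact_interior_cover Γ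
  -- Since x commutes with Γ, [x, yγ] = [x, y]. All values of the commutator are therefore taken on
  -- the compact set K, and their adjoint images are bounded.
  have hinv : ∀ y : N, ∃ k ∈ K, ⁅x, y⁆ = ⁅x, k⁆ := by
    intro y
    obtain ⟨γ, hγ, hy⟩ := hKΓ y
    refine ⟨y * γ, interior_subset hy, ?_⟩
    have h1 : γ * x⁻¹ = x⁻¹ * γ := by
      have := Subgroup.mem_centralizer_iff.1 hx γ hγ
      rw [mul_inv_eq_iff_eq_mul, mul_assoc, this, inv_mul_cancel_left]
    rw [commutatorElement_def, commutatorElement_def, mul_inv_rev, ← mul_assoc (x * (y * γ) * x⁻¹),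
      ← mul_assoc x y γ, mul_assoc (x * y) γ, h1, ← mul_assoc, mul_inv_cancel_right]
  have hcont : Continuous fun k : N => adj n ⁅x, k⁆ := by
    have : Continuous fun k : N => x * k * x⁻¹ * k⁻¹ := by fun_prop
    exact continuous_adj.comp this
  obtain ⟨C, hC⟩ := (hK.image hcont).isBounded.exists_norm_le
  have hb : ∀ y : N, ‖adj n ⁅x, y⁆‖ ≤ C := by
    intro y
    obtain ⟨k, hk, hyk⟩ := hinv y
    rw [hyk]
    exact hC _ ⟨k, hk, rfl⟩
  apply mem_center_of_adj_eq_one (n := n)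
  obtain ⟨m, hm⟩ := adj_sub_one_pow_eq_zero (n := n) (x * y * x⁻¹)
  obtain ⟨m', hm'⟩ := adj_sub_one_pow_eq_zero (n := n) y⁻¹
  -- [x, y^k] is a product of k-th powers of xyx⁻¹ and y⁻¹, whose adjoint images are unipotent.
  -- Boundedness in k then forces Ad [x, y] = 1.
  have hk : ∀ k : ℕ, adj n ⁅x, y ^ k⁆ = adj n (x * y * x⁻¹) ^ k * adj n y⁻¹ ^ k := by
    intro k
    rw [commutatorElement_def]
    have h1 : x * y ^ k * x⁻¹ * (y ^ k)⁻¹ = (x * y * x⁻¹) ^ k * (y⁻¹) ^ k := by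
      rw [conj_pow, inv_pow]
    rw [h1]
    exact ((adjHom n N).map_mul _ _).trans (by rw [map_pow, map_pow]; rfl)
  ext1 v
  ext i
  let ℓ : (Euc n →L[ℝ] Euc n) →ₗ[ℝ] ℝ :=
    { toFun := fun T => T v i
      map_add' := fun S T => by simp
      map_smul' := fun r T => by simp }
  have h2 := mul_eq_one_of_bounded hm hm' ℓ (C := C * ‖v‖) (fun k => by
    rw [← hk]
    calc |(adj n ⁅x, y ^ k⁆ v) i| ≤ ‖adj n ⁅x, y ^ k⁆ v‖ :=
          (Real.norm_eq_abs _).symm.trans_le (PiLp.norm_apply_le _ i)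
      _ ≤ ‖adj n ⁅x, y ^ k⁆‖ * ‖v‖ := ContinuousLinearMap.le_opNorm _ _
      _ ≤ C * ‖v‖ := by gcongr; exact hb _)
  have h3 := hk 1
  rw [pow_one, pow_one, pow_one] at h3
  rw [h3]
  exact h2

omit [DiscreteTopology Γ] [T2Space N] in
/-- Near the identity the centralizer of a cocompact subgroup is contained in the center. -/
theorem eventually_mem_center_of_mem_centralizer (n : ℕ) [ChartedSpace (EuclideanSpace ℝ (Fin n)) N]
    [LieGroup (𝓡 n) ∞ N] :
    ∀ᶠ x in 𝓝 (1 : N), x ∈ Subgroup.centralizer (Γ : Set N) → x ∈ Subgroup.center N := by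
  have := isTopGroup n N
  have : LocallyCompactSpace N := Manifold.locallyCompact_of_finiteDimensional (𝓡 n)
  obtain ⟨K, hK, hKΓ⟩ := exists_compact_interior_cover Γ
  obtain ⟨W, hW, hWs⟩ := exists_nhds_no_small_subgroup n N
  have hcont : Continuous fun p : N × N => ⁅p.1, p.2⁆ := by
    simp only [commutatorElement_def]; fun_prop
  have h1 : ∀ᶠ x in 𝓝 (1 : N), ∀ k ∈ K, ⁅x, k⁆ ∈ W := by
    refine hK.eventually_forall_of_forall_eventually fun k _ => ?_
    exact hcont.continuousAt.eventually (by simpa using hW)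
  filter_upwards [h1] with x hxK hx
  have hZ := commutator_mem_center_of_mem_centralizer Γ n hx
  -- As commutators with x are central, y ↦ [x, y] is a homomorphism. It kills Γ, so its image is
  -- already attained on K. That image is a subgroup inside W, hence trivial.
  have hmul : ∀ y y' : N, ⁅x, y * y'⁆ = ⁅x, y⁆ * ⁅x, y'⁆ := by
    intro y y'
    have h2 := Subgroup.mem_center_iff.1 (hZ y') y
    calc ⁅x, y * y'⁆ = x * y * x⁻¹ * ⁅x, y'⁆ * y⁻¹ := by
          simp only [commutatorElement_def]; group
      _ = x * y * x⁻¹ * (⁅x, y'⁆ * y⁻¹) := by group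
      _ = x * y * x⁻¹ * (y⁻¹ * ⁅x, y'⁆) := by
          rw [Subgroup.mem_center_iff.1 (hZ y') y⁻¹]
      _ = ⁅x, y⁆ * ⁅x, y'⁆ := by simp only [commutatorElement_def]; group
  have hpow : ∀ (y : N) (k : ℕ), ⁅x, y⁆ ^ k = ⁅x, y ^ k⁆ := by
    intro y k
    induction k with
    | zero => simp
    | succ k ih => rw [pow_succ, pow_succ, hmul, ih]
  have hΓ1 : ∀ γ ∈ Γ, ⁅x, γ⁆ = 1 := fun γ hγ =>
    commutatorElement_eq_one_iff_mul_comm.2 (Subgroup.mem_centralizer_iff.1 hx γ hγ).symm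
  have hW' : ∀ y : N, ⁅x, y⁆ ∈ W := by
    intro y
    obtain ⟨γ, hγ, hy⟩ := hKΓ y
    have := hxK _ (interior_subset hy)
    rwa [hmul, hΓ1 γ hγ, mul_one] at this
  rw [Subgroup.mem_center_iff]
  intro y
  have := hWs ⁅x, y⁆ fun k => by rw [hpow]; exact hW' _
  exact (commutatorElement_eq_one_iff_mul_comm.1 this).symm

/-- Near the identity the elements of `Z(N) Γ` are central. -/
theorem eventually_mem_center_of_eq_mul (n : ℕ) [ChartedSpace (EuclideanSpace ℝ (Fin n)) N]
    [LieGroup (𝓡 n) ∞ N] : ∀ᶠ g in 𝓝 (1 : N), ∀ z ∈ Subgroup.center N, ∀ γ ∈ Γ,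
    g = z * γ → g ∈ Subgroup.center N := by
  have := isTopGroup n N
  have : LocallyCompactSpace N := Manifold.locallyCompact_of_finiteDimensional (𝓡 n)
  obtain ⟨F, hF, hFΓ⟩ := exists_finite_generators Γ
  obtain ⟨V, hV, hVΓ⟩ : ∃ V ∈ 𝓝 (1 : N), ∀ γ ∈ Γ, γ ∈ V → γ = 1 := by
    have h1 : ({1} : Set Γ) ∈ 𝓝 (1 : Γ) := by simp
    rw [nhds_subtype_eq_comap, mem_comap] at h1
    obtain ⟨V, hV, hV'⟩ := h1
    exact ⟨V, hV, fun γ hγ hγV => congrArg Subtype.val (hV' (show (⟨γ, hγ⟩ : Γ) ∈ _ from hγV))⟩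
  -- Finite generation provides one neighborhood of 1 that works for all generators.
  have h2 : ∀ᶠ g in 𝓝 (1 : N), ∀ δ ∈ F, ⁅g, δ⁆ ∈ V := by
    rw [eventually_all_finite hF]
    intro δ _
    have hc : Continuous fun g : N => ⁅g, δ⁆ := by simp only [commutatorElement_def]; fun_prop
    exact hc.continuousAt.eventually (by simpa using hV)
  filter_upwards [h2, eventually_mem_center_of_mem_centralizer Γ n] with g hg hc z hz γ hγ hgz
  have h3 : ∀ δ : N, ⁅g, δ⁆ = ⁅γ, δ⁆ := by
    intro δ
    have hz' := fun y => Subgroup.mem_center_iff.1 hz y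
    rw [hgz, commutatorElement_def, commutatorElement_def]
    calc z * γ * δ * (z * γ)⁻¹ * δ⁻¹ = z * (γ * δ * γ⁻¹) * z⁻¹ * δ⁻¹ := by group
      _ = _ := by rw [← hz', mul_inv_cancel_right]
  -- For a generator δ, [γ, δ] = [g, δ] lies in Γ and is close to 1, so it is trivial by
  -- discreteness. Thus γ centralizes Γ, and so does g = zγ.
  have h4 : γ ∈ Subgroup.centralizer (Γ : Set N) := by
    rw [← hFΓ, Subgroup.centralizer_closure, Subgroup.mem_centralizer_iff]
    intro δ hδ
    have hδΓ : δ ∈ Γ := hFΓ ▸ Subgroup.subset_closure hδ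
    have h5 : ⁅γ, δ⁆ = 1 := by
      refine hVΓ _ ?_ (h3 δ ▸ hg δ hδ)
      rw [commutatorElement_def]
      exact Γ.mul_mem (Γ.mul_mem (Γ.mul_mem hγ hδΓ) (Γ.inv_mem hγ)) (Γ.inv_mem hδΓ)
    exact (commutatorElement_eq_one_iff_mul_comm.1 h5).symm
  apply hc
  rw [hgz]
  exact Subgroup.mul_mem _ (Subgroup.center_le_centralizer _ hz) h4

/-- Near 1 the subgroup Z(N)Γ coincides with the closed subgroup Z(N). A subgroup that is closed
near the identity is closed. -/
theorem isClosed_center_sup (n : ℕ) [ChartedSpace (EuclideanSpace ℝ (Fin n)) N]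
    [LieGroup (𝓡 n) ∞ N] : IsClosed ((Subgroup.center N ⊔ Γ : Subgroup N) : Set N) := by
  have := isTopGroup n N
  set H := Subgroup.center N ⊔ Γ
  have hZ : IsClosed (Subgroup.center N : Set N) := by
    rw [show (Subgroup.center N : Set N) = ⋂ g : N, {z | g * z = z * g} by
      ext z; simp [Subgroup.mem_center_iff]]
    exact isClosed_iInter fun g => isClosed_eq (by fun_prop) (by fun_prop)
  have hmem : ∀ᶠ g in 𝓝 (1 : N), g ∈ H → g ∈ Subgroup.center N := by
    filter_upwards [eventually_mem_center_of_eq_mul Γ n] with g hg hgH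
    have hgH' : g ∈ (H : Set N) := hgH
    rw [show H = Subgroup.center N ⊔ Γ from rfl, Subgroup.normal_mul] at hgH'
    obtain ⟨z, hz, γ, hγ, hzγ⟩ := hgH'
    exact hg z hz γ hγ hzγ.symm
  obtain ⟨W, hWs, hWo, hW1⟩ := eventually_nhds_iff.1 hmem
  refine isClosed_of_closure_subset fun y hy => ?_
  have h1 : Tendsto (fun h : N => h⁻¹ * y) (𝓝 y) (𝓝 1) :=
    (by fun_prop : Continuous fun h : N => h⁻¹ * y).tendsto' _ _ (inv_mul_cancel y)
  obtain ⟨h, hhW, hhH⟩ := mem_closure_iff_nhds.1 hy _ (h1 (hWo.mem_nhds hW1))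
  have h2 : h⁻¹ * y ∈ closure (Subgroup.center N : Set N) := by
    rw [mem_closure_iff_nhds]
    intro t ht
    have h3 : Tendsto (fun a : N => h⁻¹ * a) (𝓝 y) (𝓝 (h⁻¹ * y)) :=
      (by fun_prop : Continuous fun a : N => h⁻¹ * a).tendsto _
    obtain ⟨a, ha, haH⟩ := mem_closure_iff_nhds.1 hy _
      (h3 (inter_mem ht (hWo.mem_nhds (show h⁻¹ * y ∈ W from hhW))))
    exact ⟨h⁻¹ * a, ha.1, hWs _ ha.2 (H.mul_mem (H.inv_mem hhH) haH)⟩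
  rw [hZ.closure_eq] at h2
  have h4 : h⁻¹ * y ∈ H := (le_sup_left : Subgroup.center N ≤ H) h2
  simpa using H.mul_mem hhH h4

end Centralizer


/-! ### Base functions built from Ad y - 1 -/

section AdjEntry

variable {n : ℕ} {N : Type*} [TopologicalSpace N] [ChartedSpace (EuclideanSpace ℝ (Fin n)) N]
  [Group N] (b : Module.Basis (Fin n) ℝ (Euc n))

/-- The matrix entries of `Ad y - 1` in the basis `b`. -/
def adjEntry (i j : Fin n) (y : N) : ℝ := b.repr (adj n y (b j) - b j) i

/-- The square of the Hilbert-Schmidt norm of `Ad y - 1` in the basis `b`. -/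
def adjDefect (y : N) : ℝ := ∑ i, ∑ j, adjEntry b i j y ^ 2

theorem adjDefect_nonneg (y : N) : 0 ≤ adjDefect b y :=
  Finset.sum_nonneg fun _ _ => Finset.sum_nonneg fun _ _ => sq_nonneg _

theorem sq_adjEntry_le (i j : Fin n) (y : N) : adjEntry b i j y ^ 2 ≤ adjDefect b y :=
  (Finset.single_le_sum (f := fun j => adjEntry b i j y ^ 2) (fun _ _ => sq_nonneg _)
    (Finset.mem_univ j)).trans
  (Finset.single_le_sum (f := fun i => ∑ j, adjEntry b i j y ^ 2)
    (fun _ _ => Finset.sum_nonneg fun _ _ => sq_nonneg _) (Finset.mem_univ i))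

variable [LieGroup (𝓡 n) ∞ N]

theorem contMDiff_adjDefect : ContMDiff (𝓡 n) 𝓘(ℝ, ℝ) ∞ (adjDefect b : N → ℝ) := by
  have h1 : ∀ i j, ContMDiff (𝓡 n) 𝓘(ℝ, ℝ) ∞ (adjEntry b i j : N → ℝ) := by
    intro i j
    have h2 : ContMDiff (𝓡 n) 𝓘(ℝ, Euc n) ∞ (fun y : N => adj n y (b j)) :=
      contMDiff_adj.clm_apply contMDiff_const
    have h3 : ContDiff ℝ ∞ (fun v : Euc n => b.repr (v - b j) i) :=
      (LinearMap.toContinuousLinearMap (b.coord i)).contDiff.comp (contDiff_id.sub contDiff_const)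
    exact h3.contMDiff.comp h2
  have h4 : ∀ i j, ContMDiff (𝓡 n) 𝓘(ℝ, ℝ) ∞ (fun y : N => adjEntry b i j y ^ 2) := fun i j =>
    (contDiff_id.pow 2).contMDiff.comp (h1 i j)
  exact contMDiff_finsetSum fun i _ => contMDiff_finsetSum fun j _ => h4 i j

theorem adjDefect_one : adjDefect b (1 : N) = 0 := by
  simp [adjDefect, adjEntry, adj_one]

theorem mem_center_of_adjDefect [PreconnectedSpace N] {y : N} (hy : adjDefect b y = 0) :
    y ∈ Subgroup.center N := by
  refine mem_center_of_adj_eq_one (n := n) ?_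
  have h1 : ∀ j, adj n y (b j) = b j := by
    intro j
    rw [← sub_eq_zero]
    refine b.repr.map_eq_zero_iff.1 (Finsupp.ext fun i => ?_)
    have := sq_adjEntry_le b i j y
    rw [hy] at this
    exact pow_eq_zero_iff (two_ne_zero) |>.1 (le_antisymm this (sq_nonneg _))
  have h2 : (adj n y : Euc n →ₗ[ℝ] Euc n) = LinearMap.id := b.ext h1
  ext1 v
  exact congrArg (fun D : Euc n →ₗ[ℝ] Euc n => D v) h2

theorem adjDefect_mul_center {z : N} (hz : z ∈ Subgroup.center N) (y : N) :
    adjDefect b (y * z) = adjDefect b y := by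
  simp only [adjDefect, adjEntry, adj_mul, adj_of_mem_center hz, ContinuousLinearMap.comp_id]

theorem adjDefect_center_mul {z : N} (hz : z ∈ Subgroup.center N) (y : N) :
    adjDefect b (z * y) = adjDefect b y := by
  rw [← Subgroup.mem_center_iff.1 hz, adjDefect_mul_center b hz]

/-- The relation L_* Ad(y) = Ad(L y) L_*, read in the eigenbasis, makes each entry an eigenfunction
of composition with the automorphism. -/
theorem adjEntry_lift {Γ : Subgroup N} {L : AnosovAutomorphism n Γ} (B : L.Eigenbasis)
    (i j : Fin n) (y : N) :
    adjEntry B.basis i j (L.lift y) = B.ev i / B.ev j * adjEntry B.basis i j y := by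
  have h1 := congrArg (fun D : Euc n →L[ℝ] Euc n => B.basis.repr (D (B.basis j)) i)
    (L.deriv_comp_adj y)
  simp only [ContinuousLinearMap.comp_apply, B.coord_apply, B.apply_basis, map_smul,
    Finsupp.smul_apply, smul_eq_mul] at h1
  simp only [adjEntry, map_sub, Finsupp.sub_apply, Module.Basis.repr_self]
  rcases eq_or_ne i j with rfl | hij
  · rw [mul_eq_mul_left_iff, or_iff_left (B.ne_zero i)] at h1
    rw [div_self (B.ne_zero i), one_mul, h1]
  · rw [Finsupp.single_eq_of_ne hij, sub_zero, sub_zero, div_mul_eq_mul_div,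
      eq_div_iff (B.ne_zero j), h1]
    ring

theorem adjEntry_iterate {Γ : Subgroup N} {L : AnosovAutomorphism n Γ} (B : L.Eigenbasis)
    (i j : Fin n) (y : N) (k : ℕ) :
    adjEntry B.basis i j (L.lift^[k] y) = (B.ev i / B.ev j) ^ k * adjEntry B.basis i j y := by
  induction k with
  | zero => simp
  | succ k ih => rw [Function.iterate_succ_apply', adjEntry_lift, ih, pow_succ]; ring

end AdjEntry

section BaseFunction

variable {n : ℕ} {N : Type*} [TopologicalSpace N] [ChartedSpace (EuclideanSpace ℝ (Fin n)) N]
  [Group N] [LieGroup (𝓡 n) ∞ N] [T2Space N] [PreconnectedSpace N]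

omit [T2Space N] in
/-- Near the center the size of `Ad y - 1` controls the distance to the center. -/
theorem exists_center_neighborhood (b : Module.Basis (Fin n) ℝ (Euc n)) {W : Set N}
    (hW : W ∈ 𝓝 (1 : N)) :
    ∃ (O K : Set N) (δ : ℝ), IsOpen O ∧ IsCompact K ∧ 0 < δ ∧ 1 ∈ O ∧
      (Subgroup.center N : Set N) * O ⊆ O ∧ O ⊆ (Subgroup.center N : Set N) * W ∧
      (Subgroup.center N : Set N) * K ⊆ O ∧
      ∀ y ∈ O, adjDefect b y < δ → y ∈ (Subgroup.center N : Set N) * K := by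
  have := isTopGroup n N
  have : LocallyCompactSpace N := Manifold.locallyCompact_of_finiteDimensional (𝓡 n)
  set Z : Set N := ((Subgroup.center N : Subgroup N) : Set N) with hZ
  have hZZ : ∀ S : Set N, Z * (Z * S) ⊆ Z * S := by
    rintro S _ ⟨z, hz, _, ⟨z', hz', s, hs, rfl⟩, rfl⟩
    exact ⟨z * z', (Subgroup.center N).mul_mem hz hz', s, hs, mul_assoc _ _ _⟩
  obtain ⟨K₂, hK₂, hK₂W, hK₂c⟩ := local_compact_nhds hW
  obtain ⟨K, hK, hKK₂, hKc⟩ := local_compact_nhds (interior_mem_nhds.2 hK₂)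
  have hOo : IsOpen (Z * interior K₂) := isOpen_interior.mul_left
  have hKo : IsOpen (Z * interior K) := isOpen_interior.mul_left
  have h1 : ∀ {S : Set N}, S ∈ 𝓝 (1 : N) → (1 : N) ∈ Z * interior S := fun hS =>
    ⟨1, (Subgroup.center N).one_mem, 1, mem_interior_iff_mem_nhds.2 hS, mul_one 1⟩
  -- Outside Z · int K the compact set K₂ contains no central element, so the defect has a positive
  -- minimum there.
  obtain ⟨δ, hδ, hδK⟩ : ∃ δ : ℝ, 0 < δ ∧ ∀ y ∈ K₂ \ (Z * interior K), δ ≤ adjDefect b y := by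
    rcases (K₂ \ (Z * interior K)).eq_empty_or_nonempty with he | hne
    · exact ⟨1, one_pos, by simp [he]⟩
    · obtain ⟨y, hy, hmin⟩ := (hK₂c.diff hKo).exists_isMinOn hne
        (contMDiff_adjDefect b).continuous.continuousOn
      refine ⟨adjDefect b y, (adjDefect_nonneg b y).lt_of_ne' fun h0 => ?_, fun a ha => hmin ha⟩
      exact hy.2 ⟨y, mem_center_of_adjDefect b h0, 1, mem_interior_iff_mem_nhds.2 hK, mul_one y⟩
  refine ⟨Z * interior K₂, K, δ, hOo, hKc, hδ, h1 hK₂, hZZ _,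
    mul_subset_mul_left (interior_subset.trans hK₂W), mul_subset_mul_left hKK₂, ?_⟩
  rintro _ ⟨z, hz, y, hy, rfl⟩ hlt
  simp only at hlt ⊢
  rw [adjDefect_center_mul b hz] at hlt
  have h2 : y ∈ Z * interior K := by
    by_contra hc
    exact absurd (hδK y ⟨interior_subset hy, hc⟩) (not_le.2 hlt)
  exact hZZ _ ⟨z, hz, y, mul_subset_mul_left interior_subset h2, rfl⟩

variable [Group.IsNilpotent N] {Γ : Subgroup N} [DiscreteTopology Γ] [CompactSpace (N ⧸ Γ)]

variable (Γ) in
/-- Functions of `Ad y - 1` near the center descend to smooth functions on the base. -/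
theorem exists_base_function (b : Module.Basis (Fin n) ℝ (Euc n)) :
    ∃ (O : Set N) (δ : ℝ), IsOpen O ∧ 0 < δ ∧ 1 ∈ O ∧ (Subgroup.center N : Set N) * O ⊆ O ∧
      ∀ θ : ℝ → ℝ, ContDiff ℝ ∞ θ → (∀ s, 0 ≤ θ s ∧ θ s ≤ 1) → (∀ s, δ ≤ s → θ s = 1) →
        ∃ f : N ⧸ Γ → ℝ, IsSmoothBaseFunction n Γ f ∧ (∀ x, 0 ≤ f x ∧ f x ≤ 1) ∧
          ∀ y ∈ O, f y = θ (adjDefect b y) := by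
  have := isTopGroup n N
  set Z : Set N := ((Subgroup.center N : Subgroup N) : Set N) with hZ
  obtain ⟨W, hW, hWZ⟩ : ∃ W ∈ 𝓝 (1 : N), ∀ w ∈ W, ∀ w' ∈ W, ∀ z ∈ Subgroup.center N, ∀ γ ∈ Γ,
      w⁻¹ * w' = z * γ → w⁻¹ * w' ∈ Subgroup.center N := by
    have hc : Tendsto (fun p : N × N => p.1⁻¹ * p.2) (𝓝 1 ×ˢ 𝓝 1) (𝓝 1) := by
      rw [← nhds_prod_eq]
      exact (by fun_prop : Continuous fun p : N × N => p.1⁻¹ * p.2).tendsto' _ _ (by simp)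
    obtain ⟨W, hW, hW'⟩ := mem_prod_same_iff.1 (hc (eventually_mem_center_of_eq_mul Γ n))
    exact ⟨W, hW, fun w hw w' hw' => hW' (show (w, w') ∈ W ×ˢ W from ⟨hw, hw'⟩)⟩
  obtain ⟨O, K, δ, hO, hK, hδ, h1O, hZO, hOW, hKO, hOδ⟩ := exists_center_neighborhood b hW
  refine ⟨O, δ, hO, hδ, h1O, hZO, fun θ hθ hθ01 hθ1 => ?_⟩
  -- If zw and z'w' have the same class, then w⁻¹w' lies in Z(N)Γ and is small, hence central, and
  -- central factors do not change the defect.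
  have hwd : ∀ y ∈ O, ∀ y' ∈ O, (y : N ⧸ Γ) = y' → adjDefect b y = adjDefect b y' := by
    intro y hy y' hy' hyy
    obtain ⟨z, hz, w, hw, rfl⟩ := hOW hy
    obtain ⟨z', hz', w', hw', rfl⟩ := hOW hy'
    simp only at hyy ⊢
    have hγ := QuotientGroup.eq.1 hyy
    have e1 : w⁻¹ * w' = (z'⁻¹ * z) * ((z * w)⁻¹ * (z' * w')) := by
      have e2 : z'⁻¹ * z ∈ Subgroup.center N :=
        Subgroup.mul_mem _ (Subgroup.inv_mem _ hz') hz
      rw [mul_inv_rev, mul_assoc w⁻¹ z⁻¹, ← mul_assoc z⁻¹ z' w', ← mul_assoc, 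
        ← Subgroup.mem_center_iff.1 e2 w⁻¹]
      group
    have h3 := hWZ w hw w' hw' _ (Subgroup.mul_mem _ (Subgroup.inv_mem _ hz') hz) _ hγ e1
    rw [adjDefect_center_mul b hz, adjDefect_center_mul b hz',
      ← adjDefect_mul_center b h3 w, mul_inv_cancel_left]
  classical
  -- The value off the image of O is 1, matching θ = 1 where the defect is at least δ. The two
  -- definitions therefore glue.
  set f : N ⧸ Γ → ℝ := fun x =>
    if h : ∃ y ∈ O, (y : N ⧸ Γ) = x then θ (adjDefect b h.choose) else 1 with hf
  have hfO : ∀ y ∈ O, f y = θ (adjDefect b y) := by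
    intro y hy
    have h : ∃ y' ∈ O, (y' : N ⧸ Γ) = y := ⟨y, hy, rfl⟩
    simp only [hf, dif_pos h]
    rw [hwd _ h.choose_spec.1 y hy h.choose_spec.2]
  have hf1 : ∀ x, (¬ ∃ y ∈ O, (y : N ⧸ Γ) = x) → f x = 1 := fun x hx => by simp only [hf, dif_neg hx]
  refine ⟨f, ⟨contMDiff_of_comp_mk fun y₀ => ?_, fun z hz x => ?_⟩, fun x => ?_, hfO⟩
  · by_cases h : ∃ γ ∈ Γ, y₀ * γ ∈ O
    · obtain ⟨γ, hγ, hy⟩ := h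
      have hc : ContMDiff (𝓡 n) (𝓡 n) ∞ fun y : N => y * γ := contMDiff_id.mul contMDiff_const
      have h2 : ContMDiff (𝓡 n) 𝓘(ℝ, ℝ) ∞ fun y : N => θ (adjDefect b (y * γ)) :=
        hθ.contMDiff.comp ((contMDiff_adjDefect b).comp hc)
      refine h2.contMDiffAt.congr_of_eventuallyEq ?_
      filter_upwards [hc.continuous.continuousAt.eventually (hO.mem_nhds hy)] with y hyO
      rw [← hfO _ hyO, QuotientGroup.mk_mul_of_mem _ hγ]
    · refine (contMDiffAt_const (c := (1 : ℝ))).congr_of_eventuallyEq ?_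
      -- The Γ-saturation of ZK is K · Z(N)Γ, a compact set times a closed one. Off this closed set,
      -- points of O have defect at least δ, so f is locally 1.
      have hcl : IsClosed (K * ((Subgroup.center N ⊔ Γ : Subgroup N) : Set N)) :=
        (isClosed_center_sup Γ n).mul_left_of_isCompact hK
      have hKmem : ∀ y : N, y ∈ K * ((Subgroup.center N ⊔ Γ : Subgroup N) : Set N) ↔
          ∃ γ ∈ Γ, y * γ ∈ Z * K := by
        intro y
        rw [Subgroup.normal_mul]
        constructor
        · rintro ⟨k, hk, _, ⟨z, hz, γ, hγ, rfl⟩, rfl⟩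
          refine ⟨γ⁻¹, Γ.inv_mem hγ, z, hz, k, hk, ?_⟩
          have := Subgroup.mem_center_iff.1 hz k
          simp only
          rw [← this, mul_assoc, mul_assoc, mul_inv_cancel, mul_one]
        · rintro ⟨γ, hγ, z, hz, k, hk, hzk⟩
          refine ⟨k, hk, z * γ⁻¹, ⟨z, hz, γ⁻¹, Γ.inv_mem hγ, rfl⟩, ?_⟩
          have := Subgroup.mem_center_iff.1 hz k
          simp only at hzk ⊢
          rw [← mul_assoc, this, hzk, mul_inv_cancel_right]
      have hy₀ : y₀ ∉ K * ((Subgroup.center N ⊔ Γ : Subgroup N) : Set N) := by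
        rw [hKmem]
        rintro ⟨γ, hγ, hy⟩
        exact h ⟨γ, hγ, hKO hy⟩
      filter_upwards [hcl.isOpen_compl.mem_nhds hy₀] with y hy
      rw [mem_compl_iff, hKmem] at hy
      by_cases hex : ∃ y' ∈ O, (y' : N ⧸ Γ) = y
      · obtain ⟨y', hy', hyy⟩ := hex
        rw [← hyy, hfO y' hy']
        refine hθ1 _ (not_lt.1 fun hlt => hy ⟨y⁻¹ * y', QuotientGroup.eq.1 hyy.symm, ?_⟩)
        rw [mul_inv_cancel_left]
        exact hOδ y' hy' hlt
      · exact hf1 _ hex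
  · have hz' : ∀ z ∈ Subgroup.center N, ∀ y ∈ O, z * y ∈ O := fun z hz y hy =>
      hZO ⟨z, hz, y, hy, rfl⟩
    by_cases hex : ∃ y ∈ O, (y : N ⧸ Γ) = x
    · obtain ⟨y, hy, rfl⟩ := hex
      change f ((z * y : N) : N ⧸ Γ) = _
      rw [hfO _ (hz' z hz y hy), hfO y hy, adjDefect_center_mul b hz]
    · rw [hf1 x hex, hf1]
      rintro ⟨y, hy, hyx⟩
      refine hex ⟨z⁻¹ * y, hz' _ (Subgroup.inv_mem _ hz) y hy, ?_⟩
      change z⁻¹ • (y : N ⧸ Γ) = x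
      rw [hyx, inv_smul_smul]
  · simp only [hf]
    split_ifs
    · exact hθ01 _
    · norm_num

end BaseFunction


/-! ### Oscillation of the potential along expanded curves -/

section PowerSeries

theorem summable_pow_mul_of_bounded {x : ℝ} (hx : |x| < 1) {c : ℕ → ℝ} {C : ℝ}
    (hc : ∀ k, |c k| ≤ C) : Summable fun k => x ^ k * c k := by
  refine Summable.of_norm_bounded ((summable_geometric_of_lt_one (abs_nonneg x) hx).mul_right C)
    fun k => ?_
  rw [norm_mul, norm_pow, Real.norm_eq_abs, Real.norm_eq_abs]
  gcongr
  exact hc k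

/-- A power series with coefficients in `[0, 1]` that starts with enough ones does not vanish. -/
theorem exists_tsum_pow_mul_ne_zero {x : ℝ} (hx : |x| < 1) : ∃ J : ℕ, ∀ c : ℕ → ℝ,
    (∀ k, 0 ≤ c k ∧ c k ≤ 1) → (∀ k < J, c k = 1) → ∑' k, x ^ k * c k ≠ 0 := by
  have h0 : 0 < 1 - |x| := by linarith
  have h0' : 0 < 1 + |x| := by linarith [abs_nonneg x]
  -- The full geometric sum has modulus at least 1/(1 + |x|), and altering coefficients from index J
  -- on changes it by at most |x|^J/(1 - |x|). This J makes the change too small to reach zero.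
  obtain ⟨J, hJ⟩ := exists_pow_lt_of_lt_one (div_pos h0 h0') hx
  refine ⟨J, fun c hc hcJ h => ?_⟩
  have hs1 : Summable fun k => x ^ k * c k := summable_pow_mul_of_bounded hx (C := 1) fun k => by
    rw [abs_of_nonneg (hc k).1]; exact (hc k).2
  have hs0 : Summable fun k : ℕ => x ^ k := summable_geometric_of_abs_lt_one hx
  have h1 : ∑' k, (x ^ k - x ^ k * c k) = (1 - x)⁻¹ := by
    rw [hs0.tsum_sub hs1, h, sub_zero, tsum_geometric_of_abs_lt_one hx]
  have h2 : ∑' k, (x ^ k - x ^ k * c k) = ∑' k, (x ^ (k + J) - x ^ (k + J) * c (k + J)) := by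
    rw [← (hs0.sub hs1).sum_add_tsum_nat_add J, Finset.sum_eq_zero, zero_add]
    intro k hk
    rw [hcJ k (Finset.mem_range.1 hk), mul_one, sub_self]
  have h3 : ‖∑' k, (x ^ (k + J) - x ^ (k + J) * c (k + J))‖ ≤ |x| ^ J * (1 - |x|)⁻¹ := by
    refine tsum_of_norm_bounded ((hasSum_geometric_of_lt_one (abs_nonneg x) hx).mul_left (|x| ^ J))
      fun k => ?_
    have : x ^ (k + J) - x ^ (k + J) * c (k + J) = x ^ (k + J) * (1 - c (k + J)) := by ring
    rw [this, norm_mul, norm_pow, Real.norm_eq_abs, Real.norm_eq_abs, pow_add, mul_comm (|x| ^ k)]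
    have h4 : |1 - c (k + J)| ≤ 1 := by
      rw [abs_of_nonneg (by linarith [(hc (k + J)).2])]; linarith [(hc (k + J)).1]
    exact mul_le_of_le_one_right (by positivity) h4
  rw [← h2, h1, norm_inv, Real.norm_eq_abs] at h3
  have h5 : (1 + |x|)⁻¹ ≤ |1 - x|⁻¹ := by
    have hx1 : 0 < |1 - x| := abs_pos.2 (by linarith [le_abs_self x])
    refine inv_anti₀ hx1 ?_
    calc |1 - x| ≤ |1| + |x| := abs_sub _ _
      _ = 1 + |x| := by rw [abs_one]
  rw [lt_div_iff₀ h0'] at hJ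
  have h6 := h5.trans h3
  rw [← div_eq_mul_inv, le_div_iff₀ h0, inv_mul_le_iff₀ h0'] at h6
  linarith

end PowerSeries

section Jump

variable {n : ℕ} {N : Type*} [TopologicalSpace N] [ChartedSpace (EuclideanSpace ℝ (Fin n)) N]
  [Group N] {Γ : Subgroup N}

/-- The solution `ψ` of `ψ ∘ L = f + r ψ`, for `1 < |r|`. -/
def AnosovAutomorphism.potential (L : AnosovAutomorphism n Γ) (r : ℝ) (f : N ⧸ Γ → ℝ)
    (x : N ⧸ Γ) : ℝ := -∑' k : ℕ, r⁻¹ ^ (k + 1) * f (L.toFun^[k] x)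

theorem AnosovAutomorphism.iterate_toFun_mk (L : AnosovAutomorphism n Γ) (k : ℕ) (g : N) :
    L.toFun^[k] (g : N ⧸ Γ) = (L.lift^[k] g : N) := by
  induction k with
  | zero => rfl
  | succ k ih => rw [Function.iterate_succ_apply', Function.iterate_succ_apply', ih, L.toFun_mk]

theorem AnosovAutomorphism.lift_mem_center (L : AnosovAutomorphism n Γ) {z : N}
    (hz : z ∈ Subgroup.center N) : L.lift z ∈ Subgroup.center N := by
  rw [Subgroup.mem_center_iff] at hz ⊢
  intro g
  obtain ⟨y, rfl⟩ := L.lift.surjective g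
  rw [← map_mul, hz, map_mul]

theorem iterate_lift_curve {L : AnosovAutomorphism n Γ} {c : ℝ → N} {μ : ℝ}
    (hc : ∀ t, L.lift (c t) = c (μ * t)) (k : ℕ) (t : ℝ) : L.lift^[k] (c t) = c (μ ^ k * t) := by
  induction k with
  | zero => simp
  | succ k ih => rw [Function.iterate_succ_apply', ih, hc, pow_succ']; ring_nf

theorem iterate_lift_curve_inv {L : AnosovAutomorphism n Γ} {c : ℝ → N} {μ : ℝ} (hμ : μ ≠ 0)
    (hc : ∀ t, L.lift (c t) = c (μ * t)) (k : ℕ) (t : ℝ) :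
    L.lift^[k] (c (μ⁻¹ ^ k * t)) = c t := by
  rw [iterate_lift_curve hc, ← mul_assoc, ← mul_pow, mul_inv_cancel₀ hμ, one_pow, one_mul]

variable [LieGroup (𝓡 n) ∞ N]

/-- Along a curve that is expanded by the automorphism, only the expanded entries of `Ad - 1` are
nonzero. -/
theorem adjEntry_eq_zero_of_not_expanded {L : AnosovAutomorphism n Γ} (B : L.Eigenbasis)
    {c : ℝ → N} {μ : ℝ} (hμ : 1 < |μ|) (hcc : Continuous c) (hc0 : c 0 = 1)
    (hc : ∀ t, L.lift (c t) = c (μ * t)) {i j : Fin n} (hij : |B.ev i / B.ev j| ≤ 1) (t : ℝ) :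
    adjEntry B.basis i j (c t) = 0 := by
  have hμ0 : μ ≠ 0 := by rintro rfl; simp at hμ; linarith
  -- Going back k steps along the curve does not decrease the absolute value of a nonexpanded entry,
  -- while the point tends to 1, where the entry vanishes.
  have h1 : ∀ k : ℕ, |adjEntry B.basis i j (c t)| ≤ |adjEntry B.basis i j (c (μ⁻¹ ^ k * t))| := by
    intro k
    conv_lhs => rw [← iterate_lift_curve_inv hμ0 hc k t, adjEntry_iterate, abs_mul, abs_pow]
    exact mul_le_of_le_one_left (abs_nonneg _) (pow_le_one₀ (abs_nonneg _) hij)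
  have h2 : Tendsto (fun k : ℕ => μ⁻¹ ^ k * t) atTop (𝓝 0) := by
    have : |μ⁻¹| < 1 := by rw [abs_inv]; exact inv_lt_one_of_one_lt₀ hμ
    simpa using (tendsto_pow_atTop_nhds_zero_of_abs_lt_one this).mul_const t
  have h3 : Continuous (adjEntry B.basis i j : N → ℝ) := by
    have h4 : Continuous fun v : Euc n => B.basis.repr v i :=
      (LinearMap.toContinuousLinearMap (B.basis.coord i)).continuous
    exact h4.comp ((continuous_adj.clm_apply continuous_const).sub continuous_const)
  have h5 := ((h3.comp hcc).tendsto 0).comp h2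
  have h6 : adjEntry B.basis i j (1 : N) = 0 := by simp [adjEntry, adj_one]
  simp only [Function.comp_def, hc0, h6] at h5
  exact abs_nonpos_iff.1 (ge_of_tendsto' (by simpa using h5.abs) h1)

variable [T2Space N] [PreconnectedSpace N] [Group.IsNilpotent N] [DiscreteTopology Γ]
  [CompactSpace (N ⧸ Γ)]

/-- There is a base function whose potential oscillates at a definite rate along every noncentral
curve through the base point that is expanded by the automorphism. -/
theorem exists_base_function_potential_jump {L : AnosovAutomorphism n Γ} (B : L.Eigenbasis)
    {r : ℝ} (hr : 1 < |r|) : ∃ f : N ⧸ Γ → ℝ, IsSmoothBaseFunction n Γ f ∧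
      (∀ x, 0 ≤ f x ∧ f x ≤ 1) ∧ L.potential r f ((1 : N) : N ⧸ Γ) = 0 ∧
      ∀ (c : ℝ → N) (μ : ℝ), 1 < |μ| → Continuous c → c 0 = 1 → (∀ t, L.lift (c t) = c (μ * t)) →
        (∃ t, c t ∉ Subgroup.center N) →
        ∃ t a : ℝ, a ≠ 0 ∧ ∀ i : ℕ, L.potential r f (c (μ⁻¹ ^ i * t) : N) = r⁻¹ ^ i * a := by
  have := isTopGroup n N
  have hx : |r⁻¹| < 1 := by rw [abs_inv]; exact inv_lt_one_of_one_lt₀ hr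
  have hr0 : r ≠ 0 := by rintro rfl; simp at hr; linarith
  obtain ⟨J, hJ⟩ := exists_tsum_pow_mul_ne_zero hx
  set d : N → ℝ := adjDefect B.basis with hd
  have hdc : Continuous d := (contMDiff_adjDefect B.basis).continuous
  obtain ⟨O, δ, hO, hδ, h1O, hZO, hF⟩ := exists_base_function Γ B.basis
  have hLc : Continuous L.lift := L.contMDiff_lift.continuous
  -- Points of O' keep their first J iterates, as well as themselves, inside O, where f is given by
  -- its explicit formula.
  obtain ⟨O', K, δ', hO', hK, hδ', h1O', hZO', hO'W, hKO', hO'δ⟩ :=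
    exists_center_neighborhood B.basis (W := {y | ∀ j ∈ Finset.range (J + 1), L.lift^[j] y ∈ O}) (by
      change ∀ᶠ y in 𝓝 (1 : N), ∀ j ∈ Finset.range (J + 1), L.lift^[j] y ∈ O
      refine Filter.eventually_all_finset (Finset.range (J + 1)) |>.2 fun j _ => ?_
      refine (hLc.iterate j).continuousAt.eventually (hO.mem_nhds ?_) |>.mono fun y hy => hy
      rwa [iterate_map_one])
  -- ν lies strictly between 1 and every ratio of eigenvalue moduli exceeding 1. It depends only on
  -- L, so the f built from it serves all curves at once, including the unknown curves produced by
  -- the centralizer.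
  obtain ⟨ν, hν, hν1⟩ : ∃ ν : ℝ, (∀ i j, 1 < |B.ev i / B.ev j| → ν < |B.ev i / B.ev j|) ∧ 1 < ν := by
    have h1 : ∀ᶠ ν in 𝓝[>] (1 : ℝ), ∀ i j, 1 < |B.ev i / B.ev j| → ν < |B.ev i / B.ev j| := by
      rw [eventually_all]; intro i
      rw [eventually_all]; intro j
      by_cases h : 1 < |B.ev i / B.ev j|
      · filter_upwards [mem_nhdsWithin_of_mem_nhds (Iio_mem_nhds h)] with ν hν _ using hν
      · exact Eventually.of_forall fun ν h' => absurd h' h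
    exact (h1.and self_mem_nhdsWithin).exists
  have hν2 : 1 < ν ^ 2 := by nlinarith
  -- ε < δ' keeps points of O' with defect at most ε inside ZK, and ν²ε ≤ δ makes the cutoff below
  -- equal to 1 wherever the defect is at least δ.
  set ε : ℝ := min (δ' / 2) (δ / ν ^ 2) with hε
  have hε0 : 0 < ε := lt_min (by positivity) (by positivity)
  have hεδ' : ε < δ' := (min_le_left _ _).trans_lt (by linarith)
  have hεδ : ν ^ 2 * ε ≤ δ := by
    have := min_le_right (δ' / 2) (δ / ν ^ 2)
    rw [← hε, le_div_iff₀ (by positivity)] at this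
    linarith
  have hgap : 0 < ν ^ 2 * ε - ε := by nlinarith
  -- The cutoff rises from 0 to 1 as the defect goes from ε to ν²ε, which is the least growth over
  -- one step. No orbit point on an expanded curve then falls in between when starting from defect
  -- exactly ε.
  obtain ⟨f, hf, hf01, hfO⟩ := hF (fun s => Real.smoothTransition ((s - ε) / (ν ^ 2 * ε - ε)))
    (Real.smoothTransition.contDiff.comp ((contDiff_id.sub contDiff_const).div_const _))
    (fun s => ⟨Real.smoothTransition.nonneg _, Real.smoothTransition.le_one _⟩)
    (fun s hs => Real.smoothTransition.one_of_one_le (by rw [le_div_iff₀ hgap]; linarith))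
  have hf0 : ∀ y ∈ O, d y ≤ ε → f y = 0 := fun y hy hle => by
    rw [hfO y hy]
    exact Real.smoothTransition.zero_of_nonpos (div_nonpos_of_nonpos_of_nonneg (by linarith) hgap.le)
  have hf1 : ∀ y ∈ O, ν ^ 2 * ε ≤ d y → f y = 1 := fun y hy hle => by
    rw [hfO y hy]
    exact Real.smoothTransition.one_of_one_le (by rw [le_div_iff₀ hgap]; linarith)
  have hO'O : ∀ y ∈ O', ∀ j ≤ J, L.lift^[j] y ∈ O := by
    intro y hy j hj
    obtain ⟨z, hz, w, hw, rfl⟩ := hO'W hy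
    have hzj : ∀ j, L.lift^[j] z ∈ Subgroup.center N := fun j => by
      induction j with
      | zero => exact hz
      | succ j ih => rw [Function.iterate_succ_apply']; exact L.lift_mem_center ih
    simp only
    rw [iterate_map_mul]
    exact hZO ⟨_, hzj j, _, hw j (Finset.mem_range.2 (by omega)), rfl⟩
  refine ⟨f, hf, hf01, ?_, ?_⟩
  · have h1 : ∀ k, f (L.toFun^[k] ((1 : N) : N ⧸ Γ)) = 0 := fun k => by
      rw [L.iterate_toFun_mk, iterate_map_one]
      exact hf0 1 h1O (by rw [hd, adjDefect_one]; exact hε0.le)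
    simp [AnosovAutomorphism.potential, h1]
  intro c μ hμ hcc hc0 hc ⟨t₀, ht₀⟩
  have hμ0 : μ ≠ 0 := by rintro rfl; simp at hμ; linarith
  have hdcc : Continuous fun s => d (c s) := hdc.comp hcc
  -- the defect grows along the curve
  have hgrow : ∀ t, ∀ j : ℕ, 1 ≤ j → ν ^ 2 * d (c t) ≤ d (c (μ ^ j * t)) := by
    intro t j hj
    rw [← iterate_lift_curve hc, hd]
    simp only [adjDefect, Finset.mul_sum]
    refine Finset.sum_le_sum fun i _ => Finset.sum_le_sum fun k _ => ?_
    rw [adjEntry_iterate]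
    by_cases hik : 1 < |B.ev i / B.ev k|
    · have h1 : ν ^ 2 ≤ ((B.ev i / B.ev k) ^ j) ^ 2 := by
        rw [← sq_abs ((B.ev i / B.ev k) ^ j), abs_pow]
        refine pow_le_pow_left₀ (by linarith) ?_ 2
        exact (hν i k hik).le.trans (le_self_pow₀ hik.le (by omega))
      rw [mul_pow]
      exact mul_le_mul_of_nonneg_right h1 (sq_nonneg _)
    · rw [adjEntry_eq_zero_of_not_expanded B hμ hcc hc0 hc (not_lt.1 hik)]
      simp
  -- Some point of the curve is noncentral, so its defect is positive, and forward iteration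
  -- multiplies the defect by at least ν² each time.
  have hlarge : ∃ t, ε ≤ d (c t) := by
    have hpos : 0 < d (c t₀) := (adjDefect_nonneg _ _).lt_of_ne' fun h =>
      ht₀ (mem_center_of_adjDefect B.basis h)
    have h1 : ∀ k : ℕ, (ν ^ 2) ^ k * d (c t₀) ≤ d (c (μ ^ k * t₀)) := by
      intro k
      induction k with
      | zero => simp
      | succ k ih =>
        have h2 := hgrow (μ ^ k * t₀) 1 le_rfl
        rw [pow_one, ← mul_assoc, ← pow_succ'] at h2
        refine le_trans ?_ h2
        rw [pow_succ', mul_assoc]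
        gcongr
    obtain ⟨k, hk⟩ := pow_unbounded_of_one_lt (ε / d (c t₀)) hν2
    rw [div_lt_iff₀ hpos] at hk
    exact ⟨_, hk.le.trans (h1 k)⟩
  -- the first time at which the defect is not small
  obtain ⟨ρ, hρ0, hρle, t, htρ, htε⟩ : ∃ ρ : ℝ, 0 < ρ ∧ (∀ s, |s| ≤ ρ → d (c s) ≤ ε) ∧
      ∃ t, |t| = ρ ∧ ε ≤ d (c t) := by
    set S : Set ℝ := {s | 0 ≤ s ∧ ε ≤ max (d (c s)) (d (c (-s)))} with hS
    have hScl : IsClosed S := by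
      have h1 : Continuous fun s => max (d (c s)) (d (c (-s))) := hdcc.max (hdcc.comp continuous_neg)
      have h2 : S = {s | 0 ≤ s} ∩ {s | ε ≤ max (d (c s)) (d (c (-s)))} := by ext; rfl
      rw [h2]
      exact (isClosed_le continuous_const continuous_id).inter (isClosed_le continuous_const h1)
    have hSne : S.Nonempty := by
      obtain ⟨t, ht⟩ := hlarge
      refine ⟨|t|, abs_nonneg t, ?_⟩
      rcases abs_choice t with h | h
      · rw [h]; exact ht.trans (le_max_left _ _)
      · rw [h, neg_neg]; exact ht.trans (le_max_right _ _)
    have hSbdd : BddBelow S := ⟨0, fun s hs => hs.1⟩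
    have hmem := hScl.csInf_mem hSne hSbdd
    set ρ := sInf S
    have hρ0 : 0 < ρ := hmem.1.lt_of_ne' fun h => by
      have := hmem.2
      rw [h, neg_zero, max_self, hc0, hd, adjDefect_one] at this
      linarith
    have hlt : ∀ s ∈ Ioo (-ρ) ρ, d (c s) ≤ ε := by
      intro s hs
      by_contra hcon
      have : |s| ∈ S := by
        refine ⟨abs_nonneg s, ?_⟩
        rcases abs_choice s with h | h
        · rw [h]; exact (not_le.1 hcon).le.trans (le_max_left _ _)
        · rw [h, neg_neg]; exact (not_le.1 hcon).le.trans (le_max_right _ _)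
      exact absurd (csInf_le hSbdd this) (not_le.2 (abs_lt.2 hs))
    have hle : ∀ s, |s| ≤ ρ → d (c s) ≤ ε := by
      intro s hs
      have h1 : s ∈ closure (Ioo (-ρ) ρ) := by
        rw [closure_Ioo (by linarith)]; exact abs_le.1 hs
      exact closure_minimal hlt (isClosed_le hdcc continuous_const) h1
    refine ⟨ρ, hρ0, hle, ?_⟩
    rcases le_max_iff.1 hmem.2 with h | h
    · exact ⟨ρ, abs_of_pos hρ0, h⟩
    · exact ⟨-ρ, by rw [abs_neg, abs_of_pos hρ0], h⟩
  -- up to this time the curve stays near the center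
  have hstay : ∀ s, |s| ≤ ρ → c s ∈ O' := by
    have hZK : IsClosed (((Subgroup.center N : Subgroup N) : Set N) * K) := by
      refine IsClosed.mul_right_of_isCompact ?_ hK
      rw [show ((Subgroup.center N : Subgroup N) : Set N) = ⋂ g : N, {z | g * z = z * g} by
        ext z; simp [Subgroup.mem_center_iff]]
      exact isClosed_iInter fun g => isClosed_eq (by fun_prop) (by fun_prop)
    have h1 : Icc (-ρ) ρ ⊆ c ⁻¹' O' ∪ (c ⁻¹' (((Subgroup.center N : Subgroup N) : Set N) * K))ᶜ :=
      fun s _ => (em (c s ∈ O')).imp_right fun h h' => h (hKO' h')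
    have h2 : Icc (-ρ) ρ ∩ (c ⁻¹' O' ∩
        (c ⁻¹' (((Subgroup.center N : Subgroup N) : Set N) * K))ᶜ) = ∅ := by
      rw [Set.eq_empty_iff_forall_notMem]
      rintro s ⟨hs, hs1, hs2⟩
      exact hs2 (hO'δ _ hs1 ((hρle s (abs_le.2 hs)).trans_lt hεδ'))
    have h0 : (0 : ℝ) ∈ Icc (-ρ) ρ := ⟨by linarith, hρ0.le⟩
    rcases isPreconnected_iff_subset_of_disjoint.1 (isPreconnected_Icc (a := -ρ) (b := ρ)) _ _
      (hO'.preimage hcc) (hZK.isOpen_compl.preimage hcc) h1 h2 with h | h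
    · exact fun s hs => h (abs_le.1 hs)
    · refine absurd (hO'δ 1 h1O' ?_) (by simpa [hc0] using h h0)
      rw [adjDefect_one]; exact hδ'
  -- the values of the base function along the orbit
  have hneg : ∀ s, |s| ≤ ρ → f (c s : N) = 0 := fun s hs =>
    hf0 _ (hO'O _ (hstay s hs) 0 (Nat.zero_le _)) (hρle s hs)
  set a : ℕ → ℝ := fun k => f (c (μ ^ (k + 1) * t) : N) with ha
  have hpos : ∀ k < J, a k = 1 := by
    intro k hk
    have h1 : c (μ ^ (k + 1) * t) ∈ O := by
      rw [← iterate_lift_curve hc]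
      exact hO'O _ (hstay t htρ.le) _ hk
    refine hf1 _ h1 (le_trans ?_ (hgrow t (k + 1) (by omega)))
    gcongr
  -- At the point c(μ^{-i}t) the terms k ≤ i of the series vanish, since their times do not exceed ρ
  -- in modulus. Shifting by i + 1 leaves r^{-i} times a fixed series with summands r^{-(k+2)}a_k,
  -- whose first J coefficients a_k are 1.
  refine ⟨t, -(r⁻¹ ^ 2 * ∑' k, r⁻¹ ^ k * a k), ?_, fun i => ?_⟩
  · refine neg_ne_zero.2 (mul_ne_zero (pow_ne_zero _ (inv_ne_zero hr0)) ?_)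
    exact hJ a (fun k => hf01 _) hpos
  · have hterm : ∀ k, f (L.toFun^[k] (c (μ⁻¹ ^ i * t) : N)) = f (c (μ ^ k * (μ⁻¹ ^ i * t)) : N) :=
      fun k => by rw [L.iterate_toFun_mk, iterate_lift_curve hc]
    have hsum : Summable fun k : ℕ => r⁻¹ ^ (k + 1) * f (L.toFun^[k] (c (μ⁻¹ ^ i * t) : N)) := by
      have := (summable_pow_mul_of_bounded hx (C := 1)
        (c := fun k => f (L.toFun^[k] (c (μ⁻¹ ^ i * t) : N))) (fun k => by
          rw [abs_of_nonneg (hf01 _).1]; exact (hf01 _).2)).mul_left r⁻¹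
      refine this.congr fun k => ?_
      ring
    have hz : ∀ k ∈ Finset.range (i + 1),
        r⁻¹ ^ (k + 1) * f (L.toFun^[k] (c (μ⁻¹ ^ i * t) : N)) = 0 := by
      intro k hk
      rw [hterm, hneg, mul_zero]
      have hki : k ≤ i := by have := Finset.mem_range.1 hk; omega
      rw [← mul_assoc, abs_mul, htρ, abs_mul, abs_pow, abs_pow, abs_inv]
      refine mul_le_of_le_one_left hρ0.le ?_
      rw [inv_pow, ← div_eq_mul_inv, div_le_one (by positivity)]
      exact pow_le_pow_right₀ hμ.le hki
    rw [AnosovAutomorphism.potential, ← hsum.sum_add_tsum_nat_add (i + 1), Finset.sum_eq_zero hz,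
      zero_add, mul_neg, ← mul_assoc, ← tsum_mul_left]
    congr 1
    refine tsum_congr fun k => ?_
    rw [hterm, ha]
    have h1 : μ ^ (k + (i + 1)) * (μ⁻¹ ^ i * t) = μ ^ (k + 1) * t := by
      rw [show k + (i + 1) = (k + 1) + i by ring, pow_add, mul_assoc, ← mul_assoc (μ ^ i),
        ← mul_pow, mul_inv_cancel₀ hμ0, one_pow, one_mul]
    rw [h1]
    ring

end Jump


/-! ### Shears: differential, conjugacy, periodic data -/

section OrbitDeriv

variable {n : ℕ} {N : Type*} [TopologicalSpace N] [ChartedSpace (EuclideanSpace ℝ (Fin n)) N]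
  [Group N] {Γ : Subgroup N} [DiscreteTopology Γ]

variable (n) in
/-- The differential of a function on `N ⧸ Γ` in the right-invariant framing. -/
def orbitDeriv (φ : N ⧸ Γ → ℝ) (x : N ⧸ Γ) : Euc n →L[ℝ] ℝ :=
  mfderiv (𝓡 n) 𝓘(ℝ, ℝ) (fun g : N => φ (g • x)) 1

variable [LieGroup (𝓡 n) ∞ N] {φ : N ⧸ Γ → ℝ}

theorem hasMFDerivAt_orbitDeriv (hφ : ContMDiff (𝓡 n) 𝓘(ℝ, ℝ) ∞ φ) (x : N ⧸ Γ) :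
    HasMFDerivAt (𝓡 n) 𝓘(ℝ, ℝ) (fun g : N => φ (g • x)) 1 (orbitDeriv n φ x) :=
  ((hφ.comp (contMDiff_orbit x)).mdifferentiableAt (by simp)).hasMFDerivAt

theorem continuous_orbitDeriv (hφ : ContMDiff (𝓡 n) 𝓘(ℝ, ℝ) ∞ φ) :
    Continuous (orbitDeriv n φ) := by
  rw [continuous_iff_continuousAt]
  intro x₀
  have := isManifold_one (n := n) (N := N)
  have hsm : ContMDiff ((𝓡 n).prod (𝓡 n)) 𝓘(ℝ, ℝ) ∞ (fun p : (N ⧸ Γ) × N => φ (p.2 • p.1)) :=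
    hφ.comp (contMDiff_smul_quotient.comp (contMDiff_snd.prodMk contMDiff_fst))
  have h := ContMDiffAt.mfderiv (I := 𝓡 n) (I' := 𝓘(ℝ, ℝ)) (J := 𝓡 n) (x₀ := x₀) (n := ∞) (m := ∞)
    (fun (x : N ⧸ Γ) (g : N) => φ (g • x)) (fun _ => 1) hsm.contMDiffAt
    contMDiffAt_const (by simp)
  refine (h.congr_of_eventuallyEq (Eventually.of_forall fun x => ?_)).continuousAt
  have key : ∀ g : N ⧸ Γ → ℝ, inTangentCoordinates (𝓡 n) 𝓘(ℝ, ℝ) (fun _ : N ⧸ Γ => (1 : N)) g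
      (orbitDeriv n φ) x₀ x = orbitDeriv n φ x := by
    intro g
    rw [inTangentCoordinates_eq]
    · ext1 v
      have e1 := (tangentBundleCore (𝓡 n) N).coordChange_self
        (achart (EuclideanSpace ℝ (Fin n)) (1 : N)) 1 (mem_chart_source _ _)
      have e2 := (tangentBundleCore 𝓘(ℝ, ℝ) ℝ).coordChange_self
        (achart ℝ (g x)) (g x) (mem_chart_source _ _)
      simp only [ContinuousLinearMap.comp_apply]
      rw [e1]
      exact e2 _
    · exact mem_chart_source _ _
    · exact mem_univ _
  exact (key _).symm

theorem exists_norm_orbitDeriv_le [CompactSpace (N ⧸ Γ)] (hφ : ContMDiff (𝓡 n) 𝓘(ℝ, ℝ) ∞ φ) :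
    ∃ C, ∀ x, ‖orbitDeriv n φ x‖ ≤ C := by
  obtain ⟨C, hC⟩ := (isCompact_range (continuous_orbitDeriv hφ)).isBounded.exists_norm_le
  exact ⟨C, fun x => hC _ ⟨x, rfl⟩⟩

end OrbitDeriv

section Shear

variable {n : ℕ} {N : Type*} [TopologicalSpace N] [ChartedSpace (EuclideanSpace ℝ (Fin n)) N]
  [Group N] {Γ : Subgroup N}

/-- A central one-parameter subgroup that is expanded by an automorphism with simple spectrum. -/
structure CentralFlow (L : AnosovAutomorphism n Γ) where
  eigenbasis : L.Eigenbasis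
  flow : ℝ → N
  dir : Euc n
  rate : ℝ
  isOneParameterSubgroup : IsOneParameterSubgroup flow dir
  mem_center : ∀ t, flow t ∈ Subgroup.center N
  lift_flow : ∀ t, L.lift (flow t) = flow (rate * t)
  deriv_dir : L.deriv dir = rate • dir
  dir_ne_zero : dir ≠ 0
  one_lt_rate : 1 < |rate|

namespace CentralFlow

variable {L : AnosovAutomorphism n Γ} (S : CentralFlow L)

theorem rate_ne_zero : S.rate ≠ 0 := by
  intro h
  have := S.one_lt_rate
  rw [h, abs_zero] at this
  linarith

theorem abs_inv_rate_lt_one : |S.rate⁻¹| < 1 := by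
  rw [abs_inv]; exact inv_lt_one_of_one_lt₀ S.one_lt_rate

theorem flow_add (s t : ℝ) : S.flow (s + t) = S.flow s * S.flow t := S.isOneParameterSubgroup.2.1 s t

theorem flow_zero : S.flow 0 = 1 := S.isOneParameterSubgroup.1

theorem flow_neg (t : ℝ) : S.flow (-t) = (S.flow t)⁻¹ := S.isOneParameterSubgroup.neg t

theorem mul_flow (t : ℝ) (g : N) : g * S.flow t = S.flow t * g :=
  Subgroup.mem_center_iff.1 (S.mem_center t) g

theorem lift_symm_flow (t : ℝ) : L.lift.symm (S.flow t) = S.flow (S.rate⁻¹ * t) := by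
  rw [MulEquiv.symm_apply_eq, S.lift_flow, ← mul_assoc, mul_inv_cancel₀ S.rate_ne_zero, one_mul]

theorem iterate_flow_smul (k : ℕ) {z : N} (x : N ⧸ Γ) :
    L.toFun^[k] (z • x) = L.lift^[k] z • L.toFun^[k] x := by
  induction k with
  | zero => rfl
  | succ k ih => rw [Function.iterate_succ_apply', Function.iterate_succ_apply',
      Function.iterate_succ_apply', ih, L.toFun_smul]

/-- The automorphism restricts to the direction of the flow. -/
theorem exists_index : ∃ i, S.eigenbasis.ev i = S.rate ∧
    S.dir = S.eigenbasis.basis.repr S.dir i • S.eigenbasis.basis i ∧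
    S.eigenbasis.basis.repr S.dir i ≠ 0 :=
  S.eigenbasis.eigenvector S.deriv_dir S.dir_ne_zero

/-- The index of the direction of the flow in the eigenbasis. -/
def index : Fin n := S.exists_index.choose

theorem ev_index : S.eigenbasis.ev S.index = S.rate := S.exists_index.choose_spec.1

theorem apply_dir_eq_zero_iff (ℓ : Euc n →L[ℝ] ℝ) :
    ℓ S.dir = 0 ↔ ℓ (S.eigenbasis.basis S.index) = 0 := by
  obtain ⟨-, h1, h2⟩ := S.exists_index.choose_spec
  rw [h1, map_smul, smul_eq_mul, mul_eq_zero, or_iff_right h2]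
  rfl

theorem abs_ev_ne {i : Fin n} (hi : i ≠ S.index) : |S.eigenbasis.ev i| ≠ |S.rate| := by
  rw [← S.ev_index]
  exact fun h => hi (S.eigenbasis.abs_injective h)

/-- Two endomorphisms that differ by the shear along `ξ`. -/
theorem add_smulRight_comp {D D' : Euc n →L[ℝ] Euc n} {ℓ ξ ξ' : Euc n →L[ℝ] ℝ} (hℓ : ℓ S.dir = 0)
    {q : ℝ} (hD : D S.dir = q • S.dir) (hD' : D = D' + ℓ.smulRight S.dir)
    (h : ∀ v, q * ξ v + ℓ v = ξ' (D' v)) :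
    D.comp (1 + ξ.smulRight S.dir) = (1 + ξ'.smulRight S.dir).comp D' := by
  subst hD'
  have hq : D' S.dir = q • S.dir := by simpa [hℓ] using hD
  ext1 v
  simp only [ContinuousLinearMap.comp_apply, add_apply,
    one_apply_eq_self, ContinuousLinearMap.smulRight_apply, map_add, map_smul, hℓ, hq,
    ← h v]
  module

theorem one_add_smulRight_comp (ξ : Euc n →L[ℝ] ℝ) (hξ : ξ S.dir = 0) :
    (1 + ξ.smulRight S.dir).comp (1 + (-ξ).smulRight S.dir) = ContinuousLinearMap.id ℝ (Euc n) := by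
  ext1 v
  simp only [ContinuousLinearMap.comp_apply, add_apply, neg_apply,
    one_apply_eq_self, ContinuousLinearMap.smulRight_apply, map_add, map_smul, hξ,
    ContinuousLinearMap.id_apply]
  module

/-- The linear automorphism `v ↦ v + ξ v • w`. -/
def transvection (ξ : Euc n →L[ℝ] ℝ) (hξ : ξ S.dir = 0) : Euc n ≃L[ℝ] Euc n :=
  ContinuousLinearEquiv.equivOfInverse (1 + ξ.smulRight S.dir) (1 + (-ξ).smulRight S.dir)
    (fun v => by
      have := S.one_add_smulRight_comp (-ξ) (by simp [hξ])
      rw [neg_neg] at this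
      exact congrArg (fun D : Euc n →L[ℝ] Euc n => D v) this)
    (fun v => congrArg (fun D : Euc n →L[ℝ] Euc n => D v) (S.one_add_smulRight_comp ξ hξ))

theorem deriv_pow_dir (k : ℕ) : (L.deriv ^ k) S.dir = S.rate ^ k • S.dir := by
  induction k with
  | zero => simp
  | succ k ih =>
    rw [pow_succ', mul_apply_eq_comp, ih, map_smul, S.deriv_dir, smul_smul, pow_succ]

theorem deriv_pow_basis (k : ℕ) (i : Fin n) : (L.deriv ^ k) (S.eigenbasis.basis i) =
    S.eigenbasis.ev i ^ k • S.eigenbasis.basis i := by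
  induction k with
  | zero => simp
  | succ k ih =>
    rw [pow_succ', mul_apply_eq_comp, ih, map_smul, S.eigenbasis.apply_basis, smul_smul,
      pow_succ]

/-- A product of sheared copies of the differential is a shear of its power. -/
theorem cocycleProd_eq {ℓ : ℕ → Euc n →L[ℝ] ℝ} (hℓ : ∀ k, ℓ k S.dir = 0) (k : ℕ) :
    ∃ η : Euc n →L[ℝ] ℝ, η S.dir = 0 ∧
      cocycleProd (fun k => L.deriv + (ℓ k).smulRight S.dir) k = L.deriv ^ k + η.smulRight S.dir := by
  induction k with
  | zero => exact ⟨0, by simp, by ext1; simp [cocycleProd]⟩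
  | succ k ih =>
    obtain ⟨η, hη, hk⟩ := ih
    refine ⟨S.rate • η + (ℓ k).comp (L.deriv ^ k), by simp [hη, S.deriv_pow_dir, hℓ], ?_⟩
    rw [cocycleProd, hk]
    ext1 v
    simp only [ContinuousLinearMap.comp_apply, add_apply, smul_apply, pow_succ',
      ContinuousLinearMap.smulRight_apply, map_add, map_smul, hℓ, S.deriv_dir,
      mul_apply_eq_comp, smul_eq_mul]
    module

/-- A shear of a power of the differential is conjugate to it. -/
theorem exists_conj_pow {η : Euc n →L[ℝ] ℝ} (hη : η S.dir = 0) {k : ℕ} (hk : 0 < k) :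
    ∃ T : Euc n ≃L[ℝ] Euc n, ∀ v, T ((L.deriv ^ k) v) =
      (L.deriv ^ k + η.smulRight S.dir) (T v) := by
  set b := S.eigenbasis.basis
  -- On each eigenvector the equation r^k ξ + η = ξ ∘ L_*^k is scalar and is solved by division. At
  -- the index of w the divisor is zero, but there η vanishes and ξ is zero.
  let ξ₀ : Euc n →ₗ[ℝ] ℝ := b.constr ℝ fun i =>
    (S.eigenbasis.ev i ^ k - S.rate ^ k)⁻¹ * η (b i)
  let ξ : Euc n →L[ℝ] ℝ := LinearMap.toContinuousLinearMap ξ₀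
  have hξb : ∀ i, ξ (b i) = (S.eigenbasis.ev i ^ k - S.rate ^ k)⁻¹ * η (b i) := fun i =>
    b.constr_basis ℝ _ i
  have hη' := (S.apply_dir_eq_zero_iff η).1 hη
  have hξ : ξ S.dir = 0 := by
    rw [S.apply_dir_eq_zero_iff]
    exact (hξb _).trans (by rw [hη', mul_zero])
  have hlin : ∀ v, S.rate ^ k * ξ v + η v = ξ ((L.deriv ^ k) v) := by
    intro v
    have : (S.rate ^ k • ξ + η : Euc n →L[ℝ] ℝ) = ξ.comp (L.deriv ^ k) := by
      refine ContinuousLinearMap.coe_injective (b.ext fun i => ?_)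
      simp only [ContinuousLinearMap.coe_coe, add_apply, smul_apply, smul_eq_mul,
        ContinuousLinearMap.comp_apply]
      rw [S.deriv_pow_basis, map_smul, smul_eq_mul, hξb]
      by_cases hi : i = S.index
      · rw [hi, hη']; ring
      · have hne : S.eigenbasis.ev i ^ k - S.rate ^ k ≠ 0 := by
          intro h
          have h1 := congrArg abs (sub_eq_zero.1 h)
          rw [abs_pow, abs_pow] at h1
          exact S.abs_ev_ne hi ((pow_left_inj₀ (abs_nonneg _) (abs_nonneg _) hk.ne').1 h1)
        field_simp
        ring
    exact congrArg (fun D : Euc n →L[ℝ] ℝ => D v) this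
  refine ⟨S.transvection ξ hξ, fun v => ?_⟩
  have h1 := S.add_smulRight_comp (D := L.deriv ^ k + η.smulRight S.dir) (ξ := ξ) (ξ' := ξ) hη
    (q := S.rate ^ k) (by simp [S.deriv_pow_dir, hη]) rfl hlin
  exact (congrArg (fun D : Euc n →L[ℝ] Euc n => D v) h1).symm

variable [LieGroup (𝓡 n) ∞ N] [DiscreteTopology Γ]

theorem orbitDeriv_dir {φ : N ⧸ Γ → ℝ} (hφ : IsSmoothBaseFunction n Γ φ) (x : N ⧸ Γ) :
    orbitDeriv n φ x S.dir = 0 := by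
  have h1 := hasMFDerivAt_orbitDeriv hφ.1 x
  rw [← S.flow_zero] at h1
  have h2 := h1.comp (0 : ℝ) S.isOneParameterSubgroup.2.2
  have h3 : ((fun g : N => φ (g • x)) ∘ S.flow) = fun _ => φ x :=
    funext fun t => hφ.2 _ (S.mem_center t) x
  rw [h3] at h2
  have h4 := hasMFDerivAt_unique h2 (hasMFDerivAt_const (φ x) (0 : ℝ))
  have h5 := congrArg (fun D : ℝ →L[ℝ] ℝ => D 1) h4
  have h6 : orbitDeriv n φ x ((1 : ℝ) • S.dir) = 0 := h5
  rwa [one_smul] at h6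

/-- Centrality of the flow gives L_φ(g • x) = L(g) exp((φ(g • x) - φ(x))w) • L_φ(x), so only dφ
enters, through a rank-one term along w. -/
theorem hasFrameDeriv_shear {φ : N ⧸ Γ → ℝ} (hφ : IsSmoothBaseFunction n Γ φ) (x : N ⧸ Γ) :
    HasFrameDeriv (L.shear S.flow φ) x (L.deriv + (orbitDeriv n φ x).smulRight S.dir) := by
  refine ⟨fun g => L.lift g * S.flow (φ (g • x) - φ x), ?_, Eventually.of_forall fun g => ?_⟩
  · refine L.hasUnitDeriv.mul ?_
    have h1 : HasMFDerivAt (𝓡 n) 𝓘(ℝ, ℝ) (fun g : N => φ (g • x) - φ x) 1 (orbitDeriv n φ x) := by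
      have h2 : HasFDerivAt (fun s : ℝ => s - φ x) (ContinuousLinearMap.id ℝ ℝ)
        (φ ((1 : N) • x)) := (hasFDerivAt_id _).sub_const _
      exact h2.hasMFDerivAt.comp (1 : N) (hasMFDerivAt_orbitDeriv hφ.1 x)
    refine (S.isOneParameterSubgroup.hasUnitDeriv.comp (f := fun g : N => φ (g • x) - φ x)
      (by simp) h1).congr_deriv ?_
    ext1 v
    rfl
  · simp only [AnosovAutomorphism.shear]
    rw [L.toFun_smul, smul_smul, smul_smul, mul_assoc, ← S.flow_add, sub_add_cancel, S.mul_flow]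

theorem hasFrameDeriv_iterate_shear {φ : N ⧸ Γ → ℝ} (hφ : IsSmoothBaseFunction n Γ φ) (x : N ⧸ Γ)
    (k : ℕ) : HasFrameDeriv (L.shear S.flow φ)^[k] x
      (cocycleProd (fun k => L.deriv +
        (orbitDeriv n φ ((L.shear S.flow φ)^[k] x)).smulRight S.dir) k) :=
  HasFrameDeriv.iterate (fun _ => S.hasFrameDeriv_shear hφ _) k

theorem contMDiff_smul_flow {φ : N ⧸ Γ → ℝ} (hφ : ContMDiff (𝓡 n) 𝓘(ℝ, ℝ) ∞ φ)
    {f : N ⧸ Γ → N ⧸ Γ} (hf : ContMDiff (𝓡 n) (𝓡 n) ∞ f) :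
    ContMDiff (𝓡 n) (𝓡 n) ∞ fun x => S.flow (φ x) • f x :=
  contMDiff_smul_quotient.comp ((S.isOneParameterSubgroup.contMDiff.comp hφ).prodMk hf)

/-- Shears are diffeomorphisms. -/
theorem isSmoothDiffeo_shear {φ : N ⧸ Γ → ℝ} (hφ : IsSmoothBaseFunction n Γ φ) :
    IsSmoothDiffeo (EuclideanSpace ℝ (Fin n)) (L.shear S.flow φ) := by
  have h1 : ∀ t x, L.equiv.symm (S.flow t • x) = S.flow (S.rate⁻¹ * t) • L.equiv.symm x :=
    fun t x => by rw [L.equiv_symm_smul, S.lift_symm_flow]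
  have h2 : ∀ t x, φ (S.flow t • x) = φ x := fun t x => hφ.2 _ (S.mem_center t) x
  refine ⟨S.contMDiff_smul_flow hφ.1 L.contMDiff_toFun,
    fun y => S.flow (-(S.rate⁻¹ * φ (L.equiv.symm y))) • L.equiv.symm y, fun x => ?_, fun y => ?_, ?_⟩
  · simp only [AnosovAutomorphism.shear]
    rw [h1, h2, ← L.equiv_apply, Equiv.symm_apply_apply, smul_smul, ← S.flow_add, neg_add_cancel,
      S.flow_zero, one_smul]
  · simp only [AnosovAutomorphism.shear]
    rw [h2, L.toFun_smul, S.lift_flow, smul_smul, ← S.flow_add, ← L.equiv_apply,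
      Equiv.apply_symm_apply, mul_neg, ← mul_assoc, mul_inv_cancel₀ S.rate_ne_zero, one_mul,
      add_neg_cancel, S.flow_zero, one_smul]
  · refine S.contMDiff_smul_flow ?_ L.contMDiff_equiv_symm
    have h3 : ContDiff ℝ ∞ fun s : ℝ => -(S.rate⁻¹ * s) := (contDiff_const.mul contDiff_id).neg
    exact h3.contMDiff.comp (hφ.1.comp L.contMDiff_equiv_symm)

/-- In the frames at p and h(p) the two differentials are L_*^k and L_*^k + η ⊗ w with η(w) = 0,
which a transvection conjugates. The choice of h plays no role beyond making h(p) periodic. -/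
theorem samePeriodicData_shear {φ : N ⧸ Γ → ℝ} (hφ : IsSmoothBaseFunction n Γ φ)
    {h : (N ⧸ Γ) ≃ₜ (N ⧸ Γ)} (hh : IsConjugacy h L.toFun (L.shear S.flow φ)) :
    SamePeriodicData (EuclideanSpace ℝ (Fin n)) h L.toFun (L.shear S.flow φ) := by
  intro p k hk hp
  have hk' : (L.shear S.flow φ)^[k] (h p) = h p := by
    have : ∀ j, (L.shear S.flow φ)^[j] (h p) = h (L.toFun^[j] p) := fun j => by
      induction j with
      | zero => rfl
      | succ j ih => rw [Function.iterate_succ_apply', Function.iterate_succ_apply', ih, hh]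
    rw [this, hp]
  obtain ⟨η, hη, hD⟩ := S.cocycleProd_eq (ℓ := fun k => orbitDeriv n φ ((L.shear S.flow φ)^[k] (h p)))
    (fun k => S.orbitDeriv_dir hφ _) k
  have h1 := S.hasFrameDeriv_iterate_shear hφ (h p) k
  rw [hD] at h1
  have hprod : ∀ k, cocycleProd (fun _ => L.deriv) k = L.deriv ^ k := fun k => by
    induction k with
    | zero => rfl
    | succ k ih => rw [cocycleProd, ih, pow_succ']; rfl
  have h2 := HasFrameDeriv.iterate (f := L.toFun) (x := p) (fun k => L.hasFrameDeriv _) k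
  rw [hprod] at h2
  obtain ⟨T, hT⟩ := S.exists_conj_pow hη hk
  let e : ∀ x : N ⧸ Γ, Euc n ≃L[ℝ] Euc n := fun x =>
    ContinuousLinearEquiv.equivOfInverse (frame (n := n) Γ x) (frame (n := n) Γ x).inverse
      (fun v => congrArg (fun D : Euc n →L[ℝ] Euc n => D v) (frame_inverse_comp x))
      (fun v => congrArg (fun D : Euc n →L[ℝ] Euc n => D v) (frame_comp_inverse x))
  refine ⟨((e p).symm.trans T).trans (e (h p)), fun v => ?_⟩
  have e1 : diffAt (Euc n) L.toFun^[k] p v = e p ((L.deriv ^ k) ((e p).symm v)) :=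
    congrArg (fun D : Euc n →L[ℝ] Euc n => D v) (h2.diffAt_eq hp)
  have e2 : ∀ v, diffAt (Euc n) (L.shear S.flow φ)^[k] (h p) v =
      e (h p) ((L.deriv ^ k + η.smulRight S.dir) ((e (h p)).symm v)) := fun v =>
    congrArg (fun D : Euc n →L[ℝ] Euc n => D v) (h1.diffAt_eq hk')
  change (((e p).symm.trans T).trans (e (h p))) (diffAt (Euc n) L.toFun^[k] p v) = 
    diffAt (Euc n) (L.shear S.flow φ)^[k] (h p) (((e p).symm.trans T).trans (e (h p)) v)
  rw [e1, e2]
  simp only [ContinuousLinearEquiv.trans_apply, ContinuousLinearEquiv.symm_apply_apply, hT]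

variable [CompactSpace (N ⧸ Γ)]

theorem continuous_potential {φ : N ⧸ Γ → ℝ} (hφ : Continuous φ) :
    Continuous (L.potential S.rate φ) := by
  obtain ⟨C, hC⟩ := (isCompact_range hφ).isBounded.exists_norm_le
  refine (continuous_tsum (u := fun k => |S.rate⁻¹| ^ (k + 1) * C) (fun k => ?_) ?_ fun k x => ?_).neg
  · exact continuous_const.mul (hφ.comp (L.contMDiff_toFun.continuous.iterate k))
  · refine Summable.mul_right _ ?_
    exact (summable_nat_add_iff 1).2
      (summable_geometric_of_lt_one (abs_nonneg _) S.abs_inv_rate_lt_one)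
  · rw [norm_mul, norm_pow, Real.norm_eq_abs]
    gcongr
    exact hC _ ⟨_, rfl⟩

omit [LieGroup (𝓡 n) ∞ N] [DiscreteTopology Γ] in
theorem potential_toFun {φ : N ⧸ Γ → ℝ} (hφ : Continuous φ) (x : N ⧸ Γ) :
    L.potential S.rate φ (L.toFun x) = φ x + S.rate * L.potential S.rate φ x := by
  obtain ⟨C, hC⟩ := (isCompact_range hφ).isBounded.exists_norm_le
  have hs : Summable fun k : ℕ => S.rate⁻¹ ^ (k + 1) * φ (L.toFun^[k] x) := by
    have := (summable_pow_mul_of_bounded S.abs_inv_rate_lt_one (c := fun k => φ (L.toFun^[k] x))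
      (C := C) fun k => hC _ ⟨_, rfl⟩).mul_left S.rate⁻¹
    exact this.congr fun k => by ring
  have h1 := hs.tsum_eq_zero_add
  have h2 : ∑' k : ℕ, S.rate⁻¹ ^ (k + 1 + 1) * φ (L.toFun^[k + 1] x) =
      S.rate⁻¹ * ∑' k : ℕ, S.rate⁻¹ ^ (k + 1) * φ (L.toFun^[k] (L.toFun x)) := by
    rw [← tsum_mul_left]
    refine tsum_congr fun k => ?_
    rw [Function.iterate_succ_apply]; ring
  rw [AnosovAutomorphism.potential, AnosovAutomorphism.potential, h1, h2]
  simp only [zero_add, pow_one, Function.iterate_zero, id]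
  have := S.rate_ne_zero
  field_simp
  ring

omit [CompactSpace (N ⧸ Γ)] in
-- The automorphism preserves the center, so every φ∘L^k in the series is invariant under it.
theorem potential_smul_center {φ : N ⧸ Γ → ℝ} {r : ℝ} (hφ : IsSmoothBaseFunction n Γ φ) {z : N}
    (hz : z ∈ Subgroup.center N) (x : N ⧸ Γ) : L.potential r φ (z • x) = L.potential r φ x := by
  have hzk : ∀ k, L.lift^[k] z ∈ Subgroup.center N := fun k => by
    induction k with
    | zero => exact hz
    | succ k ih => rw [Function.iterate_succ_apply']; exact L.lift_mem_center ih
  rw [AnosovAutomorphism.potential, AnosovAutomorphism.potential]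
  congr 1
  refine tsum_congr fun k => ?_
  rw [iterate_flow_smul, hφ.2 _ (hzk k)]

/-- The conjugacy `x ↦ exp (ψ x w) x` from the automorphism to the shear. -/
def shearConj {φ : N ⧸ Γ → ℝ} (hφ : IsSmoothBaseFunction n Γ φ) : (N ⧸ Γ) ≃ₜ (N ⧸ Γ) where
  toFun x := S.flow (L.potential S.rate φ x) • x
  invFun x := S.flow (-L.potential S.rate φ x) • x
  left_inv x := by
    simp only
    rw [potential_smul_center hφ (S.mem_center _), smul_smul, ← S.flow_add, neg_add_cancel,
      S.flow_zero, one_smul]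
  right_inv x := by
    simp only
    rw [potential_smul_center hφ (S.mem_center _), smul_smul, ← S.flow_add, add_neg_cancel,
      S.flow_zero, one_smul]
  continuous_toFun := by
    have h1 : Continuous fun p : N × (N ⧸ Γ) => p.1 • p.2 :=
      (contMDiff_smul_quotient (n := n)).continuous
    exact h1.comp (((S.isOneParameterSubgroup.contMDiff.continuous).comp
      (S.continuous_potential hφ.1.continuous)).prodMk continuous_id)
  continuous_invFun := by
    have h1 : Continuous fun p : N × (N ⧸ Γ) => p.1 • p.2 :=
      (contMDiff_smul_quotient (n := n)).continuous
    exact h1.comp (((S.isOneParameterSubgroup.contMDiff.continuous).comp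
      (S.continuous_potential hφ.1.continuous).neg).prodMk continuous_id)

/-- As φ does not see the flow, L_φ(exp(ψw)x) = exp((φ + rψ)w)L(x). The cohomological equation says
that the exponent is ψ(L(x))w. -/
theorem isConjugacy_shearConj {φ : N ⧸ Γ → ℝ} (hφ : IsSmoothBaseFunction n Γ φ) :
    IsConjugacy (S.shearConj hφ) L.toFun (L.shear S.flow φ) := by
  intro x
  change S.flow (L.potential S.rate φ (L.toFun x)) • L.toFun x =
    S.flow (φ (S.flow (L.potential S.rate φ x) • x)) • L.toFun (S.flow (L.potential S.rate φ x) • x)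
  rw [hφ.2 _ (S.mem_center _), L.toFun_smul, S.lift_flow, smul_smul, ← S.flow_add,
    S.potential_toFun hφ.1.continuous]

end CentralFlow

end Shear


/-! ### The Lyapunov spectrum of a shear -/

section Growth

theorem tendsto_log_of_bounds {u : ℕ → ℝ} {m c C : ℝ} (hm : 0 < m) (hc : 0 < c) (hC : 0 < C)
    (h : ∀ k, c * m ^ k ≤ u k ∧ u k ≤ C * m ^ k) :
    Tendsto (fun k : ℕ => (1 / (k : ℝ)) * Real.log (u k)) atTop (𝓝 (Real.log m)) := by
  rw [tendsto_iff_norm_sub_tendsto_zero]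
  have h1 : Tendsto (fun k : ℕ => (|Real.log c| + |Real.log C|) / (k : ℝ)) atTop (𝓝 0) :=
    tendsto_const_div_atTop_nhds_zero_nat _
  refine squeeze_zero' (Eventually.of_forall fun k => norm_nonneg _) ?_ h1
  filter_upwards [eventually_gt_atTop 0] with k hk
  have hk' : (0 : ℝ) < k := Nat.cast_pos.2 hk
  have hpos : 0 < c * m ^ k := by positivity
  have e1 := Real.log_le_log hpos (h k).1
  have e2 := Real.log_le_log (hpos.trans_le (h k).1) (h k).2
  rw [Real.log_mul hc.ne' (by positivity), Real.log_pow] at e1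
  rw [Real.log_mul hC.ne' (by positivity), Real.log_pow] at e2
  have e3 : 1 / (k : ℝ) * Real.log (u k) - Real.log m = (Real.log (u k) - k * Real.log m) / k := by
    field_simp
  rw [e3, Real.norm_eq_abs, abs_div, abs_of_pos hk']
  gcongr
  rw [abs_le]
  constructor
  · linarith [neg_abs_le (Real.log c), abs_nonneg (Real.log C)]
  · linarith [le_abs_self (Real.log C), abs_nonneg (Real.log c)]

/-- Bounded solutions of a scalar cohomological equation along a forward orbit. -/
theorem exists_bounded_solution {r e : ℝ} (he : e ≠ 0) (hr : r ≠ 0) (hne : |e| ≠ |r|) {l : ℕ → ℝ}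
    {C : ℝ} (hl : ∀ j, |l j| ≤ C) :
    ∃ (x : ℕ → ℝ) (C' : ℝ), (∀ j, |x j| ≤ C') ∧ ∀ j, r * x j + l j = e * x (j + 1) := by
  have hC : 0 ≤ C := (abs_nonneg _).trans (hl 0)
  -- For |e| < |r| the bounded solution is a sum over the future of the orbit. For |e| > |r| the
  -- recursion started at 0 contracts, so it stays bounded.
  rcases lt_or_gt_of_ne hne with h | h
  · have hq : |e / r| < 1 := by rwa [abs_div, div_lt_one (abs_pos.2 hr)]
    have hs : ∀ j, Summable fun m : ℕ => (e / r) ^ m * l (j + m) := fun j =>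
      summable_pow_mul_of_bounded hq fun m => hl _
    refine ⟨fun j => -(r⁻¹ * ∑' m : ℕ, (e / r) ^ m * l (j + m)), |r⁻¹| * (C * (1 - |e / r|)⁻¹),
      fun j => ?_, fun j => ?_⟩
    · rw [abs_neg, abs_mul]
      refine mul_le_mul_of_nonneg_left ?_ (abs_nonneg _)
      rw [← Real.norm_eq_abs]
      refine tsum_of_norm_bounded ((hasSum_geometric_of_lt_one (abs_nonneg _) hq).mul_left C)
        fun m => ?_
      rw [norm_mul, norm_pow, Real.norm_eq_abs, Real.norm_eq_abs, mul_comm]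
      gcongr
      exact hl _
    · have h1 := (hs j).tsum_eq_zero_add
      have h2 : ∑' m : ℕ, (e / r) ^ (m + 1) * l (j + (m + 1)) =
          e / r * ∑' m : ℕ, (e / r) ^ m * l (j + 1 + m) := by
        rw [← tsum_mul_left]
        refine tsum_congr fun m => ?_
        rw [pow_succ', show j + (m + 1) = j + 1 + m by ring]; ring
      beta_reduce
      rw [h1, h2]
      simp only [pow_zero, one_mul, add_zero]
      field_simp
      ring
  · let x : ℕ → ℝ := fun j => Nat.rec 0 (fun j y => (r * y + l j) / e) j
    have hx : ∀ j, x (j + 1) = (r * x j + l j) / e := fun _ => rfl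
    have hd : 0 < |e| - |r| := by linarith
    refine ⟨x, C / (|e| - |r|), fun j => ?_, fun j => by rw [hx, mul_div_cancel₀ _ he]⟩
    induction j with
    | zero =>
      change |(0 : ℝ)| ≤ _
      rw [abs_zero]
      positivity
    | succ j ih =>
      rw [hx, abs_div, div_le_iff₀ (abs_pos.2 he)]
      calc |r * x j + l j| ≤ |r| * |x j| + |l j| := by rw [← abs_mul]; exact abs_add_le _ _
        _ ≤ |r| * (C / (|e| - |r|)) + C := by gcongr; exact hl j
        _ = C / (|e| - |r|) * |e| := by field_simp; ring

end Growth

section Lyapunov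

variable {n : ℕ} {N : Type*} [TopologicalSpace N] [ChartedSpace (EuclideanSpace ℝ (Fin n)) N]
  [Group N] {Γ : Subgroup N}

namespace CentralFlow

variable {L : AnosovAutomorphism n Γ} (S : CentralFlow L)

/-- The coordinate functionals of the eigenbasis. -/
def coord (i : Fin n) : Euc n →L[ℝ] ℝ := LinearMap.toContinuousLinearMap (S.eigenbasis.basis.coord i)

theorem coord_apply (i : Fin n) (v : Euc n) : S.coord i v = S.eigenbasis.basis.repr v i := rfl

theorem repr_deriv_pow (k : ℕ) (v : Euc n) (i : Fin n) :
    S.eigenbasis.basis.repr ((L.deriv ^ k) v) i =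
      S.eigenbasis.ev i ^ k * S.eigenbasis.basis.repr v i := by
  induction k with
  | zero => simp
  | succ k ih => rw [pow_succ', mul_apply_eq_comp, S.eigenbasis.coord_apply, ih, pow_succ']; ring

/-- Bounded solutions of the cohomological equation for functionals along a forward orbit. -/
theorem exists_bounded_functionals {ℓ : ℕ → Euc n →L[ℝ] ℝ} (hℓ : ∀ k, ℓ k S.dir = 0) {C : ℝ}
    (hC : ∀ k, ‖ℓ k‖ ≤ C) : ∃ (ξ : ℕ → Euc n →L[ℝ] ℝ) (C' : ℝ), (∀ k, ξ k S.dir = 0) ∧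
      (∀ k, ‖ξ k‖ ≤ C') ∧ ∀ k v, S.rate * ξ k v + ℓ k v = ξ (k + 1) (L.deriv v) := by
  set b := S.eigenbasis.basis with hb
  have h1 : ∀ i, ∃ (x : ℕ → ℝ) (C' : ℝ), (∀ j, |x j| ≤ C') ∧
      (∀ j, S.rate * x j + ℓ j (b i) = S.eigenbasis.ev i * x (j + 1)) ∧
      (i = S.index → ∀ j, x j = 0) := by
    intro i
    by_cases hi : i = S.index
    · refine ⟨fun _ => 0, 0, by simp, fun j => ?_, fun _ _ => rfl⟩
      rw [hi, (S.apply_dir_eq_zero_iff _).1 (hℓ j)]; ring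
    · obtain ⟨x, C', h, h'⟩ := exists_bounded_solution (S.eigenbasis.ne_zero i) S.rate_ne_zero
        (S.abs_ev_ne hi) (l := fun j => ℓ j (b i)) (C := C * ‖b i‖) fun j =>
          ((ℓ j).le_opNorm _).trans (by gcongr; exact hC j)
      exact ⟨x, C', h, h', fun h => absurd h hi⟩
  choose x C' hx hx' hx0 using h1
  have hval : ∀ k i, (∑ j, x j k • S.coord j) (b i) = x i k := by
    intro k i
    rw [sum_apply, Finset.sum_eq_single i]
    · simp [coord_apply, ← hb]
    · intro j _ hj
      simp [coord_apply, ← hb, Finsupp.single_eq_of_ne hj]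
    · simp
  refine ⟨fun k => ∑ i, x i k • S.coord i, ∑ i, C' i * ‖S.coord i‖, fun k => ?_, fun k => ?_,
    fun k v => ?_⟩
  · rw [S.apply_dir_eq_zero_iff]
    exact (hval k S.index).trans (hx0 _ rfl k)
  · refine (norm_sum_le _ _).trans (Finset.sum_le_sum fun i _ => ?_)
    rw [norm_smul, Real.norm_eq_abs]
    gcongr
    exact hx i k
  · have : (S.rate • (∑ i, x i k • S.coord i) + ℓ k : Euc n →L[ℝ] ℝ) =
        (∑ i, x i (k + 1) • S.coord i).comp L.deriv := by
      refine ContinuousLinearMap.coe_injective (b.ext fun i => ?_)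
      simp only [ContinuousLinearMap.coe_coe, add_apply, smul_apply, smul_eq_mul,
        ContinuousLinearMap.comp_apply]
      rw [S.eigenbasis.apply_basis, map_smul, hval, hval, smul_eq_mul, hx']
    exact congrArg (fun D : Euc n →L[ℝ] ℝ => D v) this

/-- The products of sheared differentials are uniformly conjugate to the powers of the
differential. -/
theorem exists_conj_cocycleProd {ℓ : ℕ → Euc n →L[ℝ] ℝ} (hℓ : ∀ k, ℓ k S.dir = 0) {C : ℝ}
    (hC : ∀ k, ‖ℓ k‖ ≤ C) : ∃ (P : Euc n ≃L[ℝ] Euc n) (K : ℝ), 0 < K ∧ ∀ v k,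
      ‖cocycleProd (fun k => L.deriv + (ℓ k).smulRight S.dir) k v‖ ≤ K * ‖(L.deriv ^ k) (P v)‖ ∧
      ‖(L.deriv ^ k) (P v)‖ ≤
        K * ‖cocycleProd (fun k => L.deriv + (ℓ k).smulRight S.dir) k v‖ := by
  obtain ⟨ξ, C', hξ, hC', h⟩ := S.exists_bounded_functionals hℓ hC
  have hC0 : 0 ≤ C' := (norm_nonneg _).trans (hC' 0)
  set D := cocycleProd (fun k => L.deriv + (ℓ k).smulRight S.dir) with hD
  -- One step intertwines 1 + ξ_k ⊗ w with 1 + ξ_{k+1} ⊗ w, so the product telescopes. Boundedness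
  -- of the ξ_k makes the comparison constant independent of k.
  have h1 : ∀ k, (D k).comp (1 + (ξ 0).smulRight S.dir) =
      (1 + (ξ k).smulRight S.dir).comp (L.deriv ^ k) := by
    intro k
    induction k with
    | zero => rfl
    | succ k ih =>
      have h2 := S.add_smulRight_comp (ξ := ξ k) (ξ' := ξ (k + 1)) (hℓ k) (q := S.rate)
        (D := L.deriv + (ℓ k).smulRight S.dir) (by simp [S.deriv_dir, hℓ]) rfl (h k)
      rw [hD, cocycleProd, ContinuousLinearMap.comp_assoc, ← hD, ih,
        ← ContinuousLinearMap.comp_assoc, h2, pow_succ', ContinuousLinearMap.comp_assoc]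
      rfl
  have hbd : ∀ (ζ : Euc n →L[ℝ] ℝ), ‖ζ‖ ≤ C' → ∀ y,
      ‖(1 + ζ.smulRight S.dir : Euc n →L[ℝ] Euc n) y‖ ≤ (1 + C' * ‖S.dir‖) * ‖y‖ := by
    intro ζ hζ y
    rw [add_apply, one_apply_eq_self, ContinuousLinearMap.smulRight_apply]
    calc ‖y + ζ y • S.dir‖ ≤ ‖y‖ + ‖ζ y‖ * ‖S.dir‖ := by
          rw [← norm_smul]; exact norm_add_le _ _
      _ ≤ ‖y‖ + (C' * ‖y‖) * ‖S.dir‖ := by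
          gcongr
          exact (ζ.le_opNorm y).trans (by gcongr)
      _ = _ := by ring
  refine ⟨(S.transvection (ξ 0) (hξ 0)).symm, 1 + C' * ‖S.dir‖, by positivity, fun v k => ?_⟩
  set v' := (S.transvection (ξ 0) (hξ 0)).symm v with hv'
  have h3 : D k v = (1 + (ξ k).smulRight S.dir : Euc n →L[ℝ] Euc n) ((L.deriv ^ k) v') := by
    have h4 := congrArg (fun T : Euc n →L[ℝ] Euc n => T v') (h1 k)
    have h5 : (1 + (ξ 0).smulRight S.dir : Euc n →L[ℝ] Euc n) v' = v :=
      (S.transvection (ξ 0) (hξ 0)).apply_symm_apply v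
    simp only [ContinuousLinearMap.comp_apply] at h4
    rwa [h5] at h4
  refine ⟨h3 ▸ hbd _ (hC' k) _, ?_⟩
  have h6 : (1 + (-ξ k).smulRight S.dir : Euc n →L[ℝ] Euc n) (D k v) = (L.deriv ^ k) v' := by
    rw [h3]
    exact (S.transvection (ξ k) (hξ k)).symm_apply_apply _
  rw [← h6]
  exact hbd _ (by rw [norm_neg]; exact hC' k) _

/-- The largest eigenvalue modulus among the nonzero coordinates governs the growth: the
corresponding coordinate gives the lower bound, the triangle inequality the upper one. -/
theorem exists_growth {v : Euc n} (hv : v ≠ 0) : ∃ i, S.eigenbasis.basis.repr v i ≠ 0 ∧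
    (∀ j, S.eigenbasis.basis.repr v j ≠ 0 → |S.eigenbasis.ev j| ≤ |S.eigenbasis.ev i|) ∧
    ∃ c C : ℝ, 0 < c ∧ 0 < C ∧ ∀ k : ℕ, c * |S.eigenbasis.ev i| ^ k ≤ ‖(L.deriv ^ k) v‖ ∧
      ‖(L.deriv ^ k) v‖ ≤ C * |S.eigenbasis.ev i| ^ k := by
  set b := S.eigenbasis.basis with hb
  have hne : (b.repr v).support.Nonempty :=
    Finsupp.support_nonempty_iff.2 fun h => hv (b.repr.map_eq_zero_iff.1 h)
  obtain ⟨i, hi, hmax⟩ := Finset.exists_max_image (b.repr v).support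
    (fun i => |S.eigenbasis.ev i|) hne
  have hi' := Finsupp.mem_support_iff.1 hi
  refine ⟨i, hi', fun j hj => hmax j (Finsupp.mem_support_iff.2 hj),
    |b.repr v i| / (‖S.coord i‖ + 1), (∑ j, |b.repr v j| * ‖b j‖) + 1, by positivity, by positivity,
    fun k => ⟨?_, ?_⟩⟩
  · rw [div_mul_eq_mul_div, div_le_iff₀ (by positivity)]
    have h1 := (S.coord i).le_opNorm ((L.deriv ^ k) v)
    rw [S.coord_apply, S.repr_deriv_pow, Real.norm_eq_abs, abs_mul, abs_pow, mul_comm] at h1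
    refine h1.trans ?_
    rw [mul_comm]
    gcongr
    linarith
  · have h1 : (L.deriv ^ k) v = ∑ j, (S.eigenbasis.ev j ^ k * b.repr v j) • b j := by
      conv_lhs => rw [← b.sum_repr ((L.deriv ^ k) v)]
      exact Finset.sum_congr rfl fun j _ => by rw [hb, S.repr_deriv_pow]
    rw [h1]
    calc ‖∑ j, (S.eigenbasis.ev j ^ k * b.repr v j) • b j‖
        ≤ ∑ j, |b.repr v j| * ‖b j‖ * |S.eigenbasis.ev i| ^ k := by
          refine (norm_sum_le _ _).trans (Finset.sum_le_sum fun j _ => ?_)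
          rw [norm_smul, Real.norm_eq_abs, abs_mul, abs_pow]
          by_cases hj : b.repr v j = 0
          · simp [hj]
          · calc |S.eigenbasis.ev j| ^ k * |b.repr v j| * ‖b j‖
                ≤ |S.eigenbasis.ev i| ^ k * |b.repr v j| * ‖b j‖ := by
                  refine mul_le_mul_of_nonneg_right (mul_le_mul_of_nonneg_right ?_
                    (abs_nonneg _)) (norm_nonneg _)
                  exact pow_le_pow_left₀ (abs_nonneg _) (hmax j (Finsupp.mem_support_iff.2 hj)) k
              _ = _ := by ring
      _ ≤ _ := by
          rw [← Finset.sum_mul]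
          gcongr
          linarith

variable [LieGroup (𝓡 n) ∞ N] [DiscreteTopology Γ] [CompactSpace (N ⧸ Γ)]
  [MeasurableSpace (N ⧸ Γ)]

/-- All shears have the same Lyapunov spectrum. -/
theorem hasLyapunovSpectrum_shear (μ : Measure (N ⧸ Γ)) {φ : N ⧸ Γ → ℝ}
    (hφ : IsSmoothBaseFunction n Γ φ) : HasLyapunovSpectrum n Γ μ (L.shear S.flow φ)
      (Finset.univ.val.map fun i => Real.log |S.eigenbasis.ev i|) := by
  refine ae_of_all _ fun x => ?_
  set b := S.eigenbasis.basis with hb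
  obtain ⟨C, hC⟩ := exists_norm_orbitDeriv_le (n := n) hφ.1
  obtain ⟨P, K, hK, hP⟩ := S.exists_conj_cocycleProd
    (ℓ := fun k => orbitDeriv n φ ((L.shear S.flow φ)^[k] x)) (fun k => S.orbitDeriv_dir hφ _)
    (fun k => hC _)
  let e : Euc n ≃L[ℝ] Euc n :=
    ContinuousLinearEquiv.equivOfInverse (frame (n := n) Γ x) (frame (n := n) Γ x).inverse
      (fun v => congrArg (fun D : Euc n →L[ℝ] Euc n => D v) (frame_inverse_comp x))
      (fun v => congrArg (fun D : Euc n →L[ℝ] Euc n => D v) (frame_comp_inverse x))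
  -- Q sends a tangent vector at x to the vector whose growth under powers of L_* is comparable to
  -- its own growth along the orbit. This works at every x, not only almost everywhere.
  let Q : Euc n ≃L[ℝ] Euc n := e.symm.trans P
  have hexp : ∀ v : Euc n, v ≠ 0 → ∃ i, b.repr (Q v) i ≠ 0 ∧
      (∀ j, b.repr (Q v) j ≠ 0 → |S.eigenbasis.ev j| ≤ |S.eigenbasis.ev i|) ∧
      HasLyapunovExponent Γ (L.shear S.flow φ) x v (Real.log |S.eigenbasis.ev i|) := by
    intro v hv
    obtain ⟨i, hi, hmax, c, C, hc, hC, hcC⟩ := S.exists_growth (v := Q v)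
      (fun h => hv (Q.map_eq_zero_iff.1 h))
    refine ⟨i, hi, hmax, tendsto_log_of_bounds (c := c / K) (C := K * C)
      (abs_pos.2 (S.eigenbasis.ne_zero i)) (by positivity) (by positivity) fun k => ?_⟩
    rw [(S.hasFrameDeriv_iterate_shear hφ x k).tangentNorm_mfderiv]
    have h1 := hP ((frame (n := n) Γ x).inverse v) k
    change _ ≤ K * ‖(L.deriv ^ k) (Q v)‖ ∧ ‖(L.deriv ^ k) (Q v)‖ ≤ _ at h1
    constructor
    · rw [div_mul_eq_mul_div, div_le_iff₀ hK, mul_comm _ K]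
      exact (hcC k).1.trans h1.2
    · refine h1.1.trans ?_
      rw [mul_assoc]
      gcongr
      exact (hcC k).2
  refine ⟨fun v hv => ?_, fun t => ?_⟩
  · obtain ⟨i, -, -, h⟩ := hexp v hv
    exact ⟨_, Multiset.mem_map.2 ⟨i, Finset.mem_univ_val i, rfl⟩, h⟩
  -- The filtration is the preimage under Q of the span of the eigenvectors with log-modulus at most
  -- t.
  · set I : Set (Fin n) := {i | Real.log |S.eigenbasis.ev i| ≤ t} with hI
    have hmem : ∀ v, v ∈ (Submodule.span ℝ (b '' I)).map (Q.symm : Euc n →ₗ[ℝ] Euc n) ↔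
        ∀ i, b.repr (Q v) i ≠ 0 → i ∈ I := by
      intro v
      have h1 : v ∈ (Submodule.span ℝ (b '' I)).map (Q.symm : Euc n →ₗ[ℝ] Euc n) ↔
          Q v ∈ Submodule.span ℝ (b '' I) := by
        constructor
        · rintro ⟨y, hy, rfl⟩
          simpa using hy
        · exact fun h => ⟨Q v, h, by simp⟩
      rw [h1, Module.Basis.mem_span_image]
      exact ⟨fun h i hi => h (by simpa using hi), fun h i hi => h i (by simpa using hi)⟩
    refine ⟨(Submodule.span ℝ (b '' I)).map (Q.symm : Euc n →ₗ[ℝ] Euc n), fun v => ?_, ?_⟩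
    · rw [hmem]
      constructor
      · intro h
        by_cases hv : v = 0
        · exact Or.inl hv
        · obtain ⟨i, hi, -, hexp⟩ := hexp v hv
          exact Or.inr ⟨_, h i hi, hexp⟩
      · rintro (rfl | ⟨χ, hχ, h⟩) j hj
        · simp at hj
        · have hv : v ≠ 0 := by rintro rfl; simp at hj
          obtain ⟨i, hi, hmax, hexp⟩ := hexp v hv
          have := tendsto_nhds_unique hexp h
          exact (Real.log_le_log (abs_pos.2 (S.eigenbasis.ne_zero j)) (hmax j hj)).trans
            (this.trans_le hχ)
    · classical
      rw [LinearEquiv.finrank_map_eq (Q.symm.toLinearEquiv), finrank_span_set_eq_card]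
      · rw [Multiset.filter_map, Multiset.card_map, Set.toFinset_image,
          Finset.card_image_of_injective _ b.injective, ← Finset.card_val]
        congr 1
        ext i
        simp [hI]
      · exact b.linearIndependent.linearIndepOn_id.mono (image_subset_range _ _)

theorem hasLyapunovSpectrum_toFun (μ : Measure (N ⧸ Γ)) : HasLyapunovSpectrum n Γ μ L.toFun
      (Finset.univ.val.map fun i => Real.log |S.eigenbasis.ev i|) := by
  have h := S.hasLyapunovSpectrum_shear μ (φ := fun _ => 0) ⟨contMDiff_const, fun _ _ _ => rfl⟩
  have : L.shear S.flow (fun _ => 0) = L.toFun := by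
    funext x; simp [AnosovAutomorphism.shear, S.flow_zero]
  rwa [this] at h

end CentralFlow

end Lyapunov


/-! ### Invariance of the volume -/

section InvariantMeasures

open scoped ENNReal

variable {G X : Type*} [Group G] [TopologicalSpace G] [IsTopologicalGroup G]
  [TopologicalSpace X] [SecondCountableTopology X] [MeasurableSpace X] [BorelSpace X]
  [MulAction G X] [ContinuousSMul G X]

/-- The density dμ/dν is almost everywhere invariant under each group element. Fubini against Haar
measure and transitivity turn this into being almost everywhere constant. -/
theorem exists_eq_smul_of_invariant [LocallyCompactSpace G] [SecondCountableTopology G]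
    [MulAction.IsPretransitive G X] {μ ν : Measure X} [IsFiniteMeasure μ]
    [IsFiniteMeasure ν] [SMulInvariantMeasure G X μ] [SMulInvariantMeasure G X ν] (hμν : μ ≪ ν) :
    ∃ k : ℝ≥0∞, μ = k • ν := by
  borelize G
  by_cases hν : ν = 0
  · exact ⟨0, by rw [hν] at hμν ⊢; simpa using hμν⟩
  have : NeZero ν := ⟨hν⟩
  set f := μ.rnDeriv ν with hf
  have hfm : Measurable f := Measure.measurable_rnDeriv μ ν
  have hinv : ∀ g : G, ∀ᵐ x ∂ν, f (g • x) = f x := fun g =>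
    (measurePreserving_smul g μ).rnDeriv_comp_aeEq (measurePreserving_smul g ν)
  have hact : Measurable fun p : G × X => p.1 • p.2 := continuous_smul.measurable
  set lam : Measure G := Measure.haar with hlam
  have h1 : ∀ᵐ x ∂ν, ∀ᵐ g ∂lam, f (g • x) = f x := by
    refine (Measure.ae_ae_comm (p := fun g x => f (g • x) = f x) (μ := lam) (ν := ν) ?_).1
      (Eventually.of_forall hinv)
    exact measurableSet_eq_fun (hfm.comp hact) (hfm.comp measurable_snd)
  obtain ⟨x₀, hx₀⟩ := h1.exists
  -- Every x is a translate of x₀, and right translation preserves null sets of Haar measure. The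
  -- statement thus holds for all x, and Fubini can be applied in the other direction.
  have h2 : ∀ x, ∀ᵐ g ∂lam, f (g • x) = f x₀ := by
    intro x
    obtain ⟨h, rfl⟩ := MulAction.exists_smul_eq G x₀ x
    have h3 := (measure_mul_right_null lam (s := {g | ¬ f (g • x₀) = f x₀}) h).2 hx₀
    change lam {g | ¬ f (g • h • x₀) = f x₀} = 0
    simpa [← mul_smul] using! h3
  have h3 : ∀ᵐ g ∂lam, ∀ᵐ x ∂ν, f (g • x) = f x₀ := by
    refine (Measure.ae_ae_comm (p := fun g x => f (g • x) = f x₀) (μ := lam) (ν := ν) ?_).2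
      (Eventually.of_forall h2)
    exact measurableSet_eq_fun (hfm.comp hact) measurable_const
  obtain ⟨g, hg⟩ := h3.exists
  have h4 : f =ᵐ[ν] fun _ => f x₀ := by
    filter_upwards [hg, hinv g] with x hx hx'
    rw [← hx', hx]
  refine ⟨f x₀, ?_⟩
  rw [← withDensity_const, ← withDensity_congr_ae h4, hf, Measure.withDensity_rnDeriv_eq _ _ hμν]

/-- An invariant probability measure of a transitive action is unique. -/
theorem eq_of_invariant [LocallyCompactSpace G] [SecondCountableTopology G]
    [MulAction.IsPretransitive G X] (μ ν : Measure X) [IsProbabilityMeasure μ]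
    [IsProbabilityMeasure ν] [SMulInvariantMeasure G X μ] [SMulInvariantMeasure G X ν] : μ = ν := by
  -- Comparing both measures with μ + ν makes absolute continuity automatic. Total masses then
  -- identify the two constants.
  obtain ⟨k, hk⟩ := exists_eq_smul_of_invariant (G := G) (μ := μ) (ν := μ + ν)
    (Measure.AbsolutelyContinuous.rfl.add_right ν)
  obtain ⟨l, hl⟩ := exists_eq_smul_of_invariant (G := G) (μ := ν) (ν := μ + ν)
    (by rw [add_comm]; exact Measure.AbsolutelyContinuous.rfl.add_right μ)
  have h1 : k * (1 + 1) = 1 := by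
    have := congrArg (fun m : Measure X => m univ) hk
    simpa [mul_add] using this.symm
  have h2 : l * (1 + 1) = 1 := by
    have := congrArg (fun m : Measure X => m univ) hl
    simpa [mul_add] using this.symm
  have h3 : k = l := by
    rw [ENNReal.eq_inv_of_mul_eq_one_left h1, ENNReal.eq_inv_of_mul_eq_one_left h2]
  exact (h3 ▸ hk : μ = l • (μ + ν)).trans hl.symm

omit [IsTopologicalGroup G] in
/-- Moving points along a flow, by times that are constant along the flow, preserves the invariant
measure. -/
theorem measurePreserving_flow_smul (μ : Measure X) [IsFiniteMeasure μ]
    [SMulInvariantMeasure G X μ] {c : ℝ → G} (hc : Continuous c)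
    (hadd : ∀ s t, c (s + t) = c s * c t) {ψ : X → ℝ} (hψ : Continuous ψ)
    (hinv : ∀ t x, ψ (c t • x) = ψ x) : MeasurePreserving (fun x => c (ψ x) • x) μ μ := by
  have hT : Continuous fun x => c (ψ x) • x := (hc.comp hψ).smul continuous_id
  refine ⟨hT.measurable, Measure.ext_of_lintegral _ fun F hF => ?_⟩
  rw [lintegral_map hF hT.measurable]
  -- Averaging over flow times in [0,1] makes room for a change of variables: s = ψ(x) + t turns the
  -- moving point into a fixed time s with shifted kernel k(s - ψ(x)). Invariance under c(s) then
  -- removes the flow, and the kernel integrates to 1.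
  set k : ℝ → ℝ≥0∞ := (Icc (0 : ℝ) 1).indicator 1 with hk
  have hkm : Measurable k := measurable_one.indicator measurableSet_Icc
  have hk1 : ∫⁻ t, k t = 1 := by
    rw [hk, lintegral_indicator_one measurableSet_Icc]; simp
  have hmp : ∀ t, MeasurePreserving (fun x : X => c t • x) μ μ := fun t => measurePreserving_smul _ _
  have hact : Continuous fun p : X × ℝ => c p.2 • p.1 := (hc.comp continuous_snd).smul continuous_fst
  have hact' : Continuous fun p : X × ℝ => c (ψ p.1 + p.2) • p.1 :=
    (hc.comp ((hψ.comp continuous_fst).add continuous_snd)).smul continuous_fst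
  calc ∫⁻ x, F (c (ψ x) • x) ∂μ
      = ∫⁻ t, k t * ∫⁻ x, F (c (ψ x) • x) ∂μ := by
        rw [lintegral_mul_const _ hkm, hk1, one_mul]
    _ = ∫⁻ t, ∫⁻ x, k t * F (c (ψ x + t) • x) ∂μ := by
        refine lintegral_congr fun t => ?_
        have h1 : Measurable fun x => F (c (ψ x + t) • x) :=
          hF.comp (hact'.comp (Continuous.prodMk_left t)).measurable
        have h2 : Measurable fun x => F (c (ψ x) • x) := hF.comp hT.measurable
        rw [lintegral_const_mul _ h1, ← (hmp t).lintegral_comp h2]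
        simp only [hinv, smul_smul, ← hadd]
    _ = ∫⁻ x, (∫⁻ t, k t * F (c (ψ x + t) • x)) ∂μ := by
        rw [lintegral_lintegral_swap]
        refine Measurable.aemeasurable ?_
        exact (hkm.comp measurable_fst).mul
          (hF.comp (hact'.comp continuous_swap).measurable)
    _ = ∫⁻ x, (∫⁻ s, k (s - ψ x) * F (c s • x)) ∂μ := by
        refine lintegral_congr fun x => ?_
        rw [← lintegral_sub_right_eq_self _ (ψ x)]
        simp only [add_sub_cancel]
    _ = ∫⁻ s, ∫⁻ x, k (s - ψ x) * F (c s • x) ∂μ := by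
        rw [lintegral_lintegral_swap]
        refine Measurable.aemeasurable ?_
        exact (hkm.comp (measurable_snd.sub (hψ.measurable.comp measurable_fst))).mul
          (hF.comp hact.measurable)
    _ = ∫⁻ s, ∫⁻ x, k (s - ψ x) * F x ∂μ := by
        refine lintegral_congr fun s => ?_
        have h1 : Measurable fun x => k (s - ψ x) * F x :=
          (hkm.comp (measurable_const.sub hψ.measurable)).mul hF
        rw [← (hmp s).lintegral_comp h1]
        simp only [hinv]
    _ = ∫⁻ x, (∫⁻ s, k (s - ψ x) * F x) ∂μ := by
        rw [lintegral_lintegral_swap]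
        refine Measurable.aemeasurable ?_
        exact (hkm.comp (measurable_fst.sub (hψ.measurable.comp measurable_snd))).mul
          (hF.comp measurable_snd)
    _ = ∫⁻ x, F x ∂μ := by
        refine lintegral_congr fun x => ?_
        have h1 : Measurable fun s => k (s - ψ x) := hkm.comp (measurable_id.sub_const _)
        rw [lintegral_mul_const _ h1, lintegral_sub_right_eq_self k, hk1, one_mul]

end InvariantMeasures

section Countability

variable {N : Type*} [TopologicalSpace N] [Group N] [IsTopologicalGroup N] (Γ : Subgroup N)

theorem countable_lattice [LocallyCompactSpace N] [T2Space N] [PreconnectedSpace N]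
    [DiscreteTopology Γ] [CompactSpace (N ⧸ Γ)] : Countable Γ := by
  obtain ⟨F, hF, hFΓ⟩ := exists_finite_generators Γ
  have : Countable F := hF.countable
  rw [FreeGroup.closure_eq_range] at hFΓ
  have : Countable (FreeGroup F) := by unfold FreeGroup; infer_instance
  rw [← hFΓ]
  exact (FreeGroup.lift ((↑) : F → N)).rangeRestrict_surjective.countable

/-- The countable lattice moves one compact fundamental set over the whole group. This yields the
second countability that Fubini needs. -/
theorem sigmaCompactSpace_of_lattice [LocallyCompactSpace N] [T2Space N] [PreconnectedSpace N]
    [DiscreteTopology Γ] [CompactSpace (N ⧸ Γ)] : SigmaCompactSpace N := by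
  have := countable_lattice Γ
  obtain ⟨K, hK, hKΓ⟩ := exists_compact_interior_cover Γ
  refine SigmaCompactSpace.of_countable (range fun γ : Γ => (fun y : N => y * (γ : N)) '' K)
    (countable_range _) ?_ ?_
  · rintro _ ⟨γ, rfl⟩
    exact hK.image (continuous_mul_const _)
  · refine eq_univ_of_forall fun y => ?_
    obtain ⟨γ, hγ, hy⟩ := hKΓ y
    exact ⟨_, ⟨⟨γ, hγ⟩⁻¹, rfl⟩, y * γ, interior_subset hy, by simp⟩

theorem secondCountable_of_lattice (n : ℕ) [ChartedSpace (EuclideanSpace ℝ (Fin n)) N]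
    [T2Space N] [PreconnectedSpace N] [DiscreteTopology Γ] [CompactSpace (N ⧸ Γ)] :
    SecondCountableTopology N := by
  have := ChartedSpace.locallyCompactSpace (EuclideanSpace ℝ (Fin n)) N
  have := sigmaCompactSpace_of_lattice Γ
  exact ChartedSpace.secondCountable_of_sigmaCompact (EuclideanSpace ℝ (Fin n)) N

end Countability

section Volume

variable {n : ℕ} {N : Type*} [TopologicalSpace N] [ChartedSpace (EuclideanSpace ℝ (Fin n)) N]
  [Group N] [LieGroup (𝓡 n) ∞ N] [T2Space N] [PreconnectedSpace N] {Γ : Subgroup N}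
  [DiscreteTopology Γ] [CompactSpace (N ⧸ Γ)] [MeasurableSpace (N ⧸ Γ)] [BorelSpace (N ⧸ Γ)]
  (vol : Measure (N ⧸ Γ)) [IsProbabilityMeasure vol] [SMulInvariantMeasure N (N ⧸ Γ) vol]
  {L : AnosovAutomorphism n Γ}

include n in
omit [MeasurableSpace (N ⧸ Γ)] [BorelSpace (N ⧸ Γ)] in
theorem secondCountable_quotient : SecondCountableTopology (N ⧸ Γ) := by
  have := isTopGroup n N
  have := secondCountable_of_lattice Γ n
  infer_instance

/-- The pushforward of the volume by L is again N-invariant because L is an automorphism, so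
uniqueness applies. -/
theorem AnosovAutomorphism.measurePreserving_toFun (L : AnosovAutomorphism n Γ) :
    MeasurePreserving L.toFun vol vol := by
  have := isTopGroup n N
  have := secondCountable_of_lattice Γ n
  have := ChartedSpace.locallyCompactSpace (EuclideanSpace ℝ (Fin n)) N
  have hm : Measurable L.toFun := L.contMDiff_toFun.continuous.measurable
  refine ⟨hm, ?_⟩
  have : IsProbabilityMeasure (vol.map L.toFun) := Measure.isProbabilityMeasure_map hm.aemeasurable
  have : SMulInvariantMeasure N (N ⧸ Γ) (vol.map L.toFun) := by
    refine ⟨fun g s hs => ?_⟩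
    have hg : Measurable fun x : N ⧸ Γ => g • x := (continuous_const_smul g).measurable
    rw [Measure.map_apply hm (hg hs), Measure.map_apply hm hs,
      ← measure_preimage_smul vol (L.lift.symm g) (L.toFun ⁻¹' s)]
    congr 1
    ext x
    simp [L.toFun_smul]
  exact eq_of_invariant (G := N) _ _

/-- The shear is L followed by the flow for time φ∘L⁻¹, and this time is constant along the flow. -/
theorem CentralFlow.measurePreserving_shear (S : CentralFlow L) {φ : N ⧸ Γ → ℝ}
    (hφ : IsSmoothBaseFunction n Γ φ) : MeasurePreserving (L.shear S.flow φ) vol vol := by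
  have := isTopGroup n N
  have := secondCountable_of_lattice Γ n
  have h1 : ∀ t x, L.equiv.symm (S.flow t • x) = S.flow (S.rate⁻¹ * t) • L.equiv.symm x :=
    fun t x => by rw [L.equiv_symm_smul, S.lift_symm_flow]
  have h := measurePreserving_flow_smul vol (c := S.flow)
    S.isOneParameterSubgroup.contMDiff.continuous S.flow_add
    (ψ := fun y => φ (L.equiv.symm y))
    (hφ.1.continuous.comp L.contMDiff_equiv_symm.continuous) fun t x => by
      rw [h1, hφ.2 _ (S.mem_center _)]
  have h2 := h.comp (L.measurePreserving_toFun vol)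
  have h3 : L.shear S.flow φ = (fun x => S.flow (φ (L.equiv.symm x)) • x) ∘ L.toFun := by
    funext x
    simp only [AnosovAutomorphism.shear, Function.comp_apply]
    rw [← L.equiv_apply, Equiv.symm_apply_apply]
  rwa [h3]

end Volume


/-! ### Small shears in the C^r topologies -/

section SmoothFamilies

variable {E E' : Type*} [NormedAddCommGroup E] [NormedSpace ℝ E]
  [NormedAddCommGroup E'] [NormedSpace ℝ E']

/-- After translating by (s, 0), the inclusion of the slice is linear, so higher derivatives compose
with it termwise. Continuity of the full derivatives then gives joint continuity of the partial
ones. -/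
theorem iteratedFDeriv_partial {Ω : Set (ℝ × E)} (hΩ : IsOpen Ω) {G : ℝ × E → E'}
    (hG : ContDiffOn ℝ ∞ G Ω) {s : ℝ} {y : E} (h : (s, y) ∈ Ω) (i : ℕ) :
    iteratedFDeriv ℝ i (fun y => G (s, y)) y = (iteratedFDeriv ℝ i G (s, y)).compContinuousLinearMap
      fun _ => ContinuousLinearMap.inr ℝ ℝ E := by
  set Ω' : Set (ℝ × E) := (fun p => p + (s, 0)) ⁻¹' Ω with hΩ'
  have hopen : IsOpen Ω' := hΩ.preimage (continuous_add_const _)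
  have hopen2 : IsOpen (ContinuousLinearMap.inr ℝ ℝ E ⁻¹' Ω') :=
    hopen.preimage (ContinuousLinearMap.continuous _)
  have hH : ContDiffOn ℝ ∞ (fun p => G (p + (s, 0))) Ω' :=
    hG.comp (contDiff_id.add contDiff_const).contDiffOn fun p hp => hp
  have hy : ContinuousLinearMap.inr ℝ ℝ E y ∈ Ω' := by simpa [hΩ'] using h
  have h1 := (ContinuousLinearMap.inr ℝ ℝ E).iteratedFDerivWithin_comp_right hH
    hopen.uniqueDiffOn hopen2.uniqueDiffOn hy (i := i) (by exact_mod_cast le_top)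
  rw [iteratedFDerivWithin_of_isOpen i hopen2 hy, iteratedFDerivWithin_of_isOpen i hopen hy,
    iteratedFDeriv_comp_add_right] at h1
  have h2 : (fun p => G (p + (s, 0))) ∘ ContinuousLinearMap.inr ℝ ℝ E = fun y => G (s, y) := by
    funext y; simp
  rw [h2] at h1
  simpa using h1

variable {M : Type*} [TopologicalSpace M] [ChartedSpace E M] [IsManifold 𝓘(ℝ, E) ∞ M]
  {M' : Type*} [TopologicalSpace M'] [ChartedSpace E' M'] [IsManifold 𝓘(ℝ, E') ∞ M']

/-- A smooth one-parameter family of maps is continuous for the `C^r` topology. -/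
theorem tendsto_crTopology {F : ℝ → M → M'} {s₀ : ℝ}
    (hF : ContMDiff (𝓘(ℝ, ℝ).prod 𝓘(ℝ, E)) 𝓘(ℝ, E') ∞ fun p : ℝ × M => F p.1 p.2) (r : ℕ∞) :
    Tendsto F (𝓝 s₀) (@nhds (M → M') (crTopology E M E' M' r) (F s₀)) := by
  rw [TopologicalSpace.tendsto_nhds_generateFrom_iff]
  rintro _ ⟨k, f, c, d, K, ε, hk, hf, hc, hd, hK, hKc, hfK, hε, rfl⟩ ⟨hs₀, hs₀'⟩
  have hc1 := IsManifold.subset_maximalAtlas (I := 𝓘(ℝ, E)) (n := ∞) hc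
  have hd1 := IsManifold.subset_maximalAtlas (I := 𝓘(ℝ, E')) (n := ∞) hd
  have hFc : Continuous fun p : ℝ × M => F p.1 p.2 := hF.continuous
  have hmaps : ∀ᶠ s in 𝓝 s₀, ∀ x ∈ K, F s x ∈ d.source :=
    hK.eventually_forall_of_forall_eventually fun x hx =>
      hFc.continuousAt.eventually (d.open_source.mem_nhds (hs₀ hx))
  set G : ℝ × E → E' := fun p => d (F p.1 (c.symm p.2)) with hGdef
  set Ω : Set (ℝ × E) := (univ ×ˢ c.target) ∩ (fun p => F p.1 (c.symm p.2)) ⁻¹' d.source with hΩdef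
  have hsm : ContMDiffOn 𝓘(ℝ, ℝ × E) 𝓘(ℝ, E') ∞ (fun p : ℝ × E => F p.1 (c.symm p.2))
      (univ ×ˢ c.target) := by
    have h1 : ContMDiffOn 𝓘(ℝ, ℝ × E) 𝓘(ℝ, ℝ) ∞ (fun p : ℝ × E => p.1) (univ ×ˢ c.target) :=
      contDiff_fst.contMDiff.contMDiffOn
    have h2 : ContMDiffOn 𝓘(ℝ, ℝ × E) 𝓘(ℝ, E) ∞ (fun p : ℝ × E => c.symm p.2)
        (univ ×ˢ c.target) :=
      (contMDiffOn_symm_of_mem_maximalAtlas hc1).comp contDiff_snd.contMDiff.contMDiffOn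
        fun p hp => hp.2
    exact hF.comp_contMDiffOn (h1.prodMk h2)
  have hΩ : IsOpen Ω :=
    hsm.continuousOn.isOpen_inter_preimage (isOpen_univ.prod c.open_target) d.open_source
  have hG : ContDiffOn ℝ ∞ G Ω := by
    rw [← contMDiffOn_iff_contDiffOn]
    exact (contMDiffOn_of_mem_maximalAtlas hd1).comp (hsm.mono inter_subset_left)
      fun p hp => hp.2
  -- The strict inequality at s₀ persists near each point of K by joint continuity, and compactness
  -- of K makes it uniform.
  have hderiv : ∀ᶠ s in 𝓝 s₀, ∀ x ∈ K, ∀ i ≤ k,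
      ‖iteratedFDeriv ℝ i (d ∘ F s ∘ c.symm) (c x) -
        iteratedFDeriv ℝ i (d ∘ f ∘ c.symm) (c x)‖ < ε := by
    refine hK.eventually_forall_of_forall_eventually fun x hx => ?_
    refine (eventually_all_finite (finite_Iic k)).2 fun i hi => ?_
    have hxc := hKc hx
    have hcx : ContinuousAt c x := c.continuousAt hxc
    have hmem : (s₀, c x) ∈ Ω := by
      refine ⟨⟨mem_univ _, c.map_source hxc⟩, ?_⟩
      simpa [c.left_inv hxc] using hs₀ hx
    have hcp : ContinuousAt (fun z : ℝ × M => (z.1, c z.2)) (s₀, x) :=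
      continuousAt_fst.prodMk (ContinuousAt.comp (f := Prod.snd) (g := c) hcx continuousAt_snd)
    have e1 : ContinuousAt (fun z : ℝ × M => iteratedFDeriv ℝ i (d ∘ F z.1 ∘ c.symm) (c z.2))
        (s₀, x) := by
      have h1 : ContinuousAt (fun z : ℝ × M => iteratedFDeriv ℝ i G (z.1, c z.2)) (s₀, x) :=
        ContinuousAt.comp (f := fun z : ℝ × M => (z.1, c z.2))
          (ContDiffAt.continuousAt_iteratedFDeriv (hG.contDiffAt (hΩ.mem_nhds hmem))
            (by exact_mod_cast le_top)) hcp
      have h2 := ((ContinuousMultilinearMap.compContinuousLinearMapL (F := E')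
        fun _ : Fin i => ContinuousLinearMap.inr ℝ ℝ E).continuous.continuousAt).comp h1
      refine h2.congr ?_
      filter_upwards [hcp.eventually (hΩ.mem_nhds hmem)] with z hz
      exact (iteratedFDeriv_partial hΩ hG hz i).symm
    have e2 : ContinuousAt (fun z : ℝ × M => iteratedFDeriv ℝ i (d ∘ f ∘ c.symm) (c z.2))
        (s₀, x) := by
      have hle : (r : WithTop ℕ∞) ≤ ∞ := by exact_mod_cast le_top
      have h3 : ContMDiffAt 𝓘(ℝ, E) 𝓘(ℝ, E) r c.symm (c x) :=
        ((contMDiffOn_symm_of_mem_maximalAtlas hc1).contMDiffAt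
          (c.open_target.mem_nhds (c.map_source hxc))).of_le hle
      have h4 : ContMDiffAt 𝓘(ℝ, E') 𝓘(ℝ, E') r d (f (c.symm (c x))) := by
        rw [c.left_inv hxc]
        exact ((contMDiffOn_of_mem_maximalAtlas hd1).contMDiffAt
          (d.open_source.mem_nhds (hfK hx))).of_le hle
      have h5 : ContDiffAt ℝ r (d ∘ f ∘ c.symm) (c x) :=
        contMDiffAt_iff_contDiffAt.1
          (ContMDiffAt.comp (f := f ∘ c.symm) (c x) h4 (hf.contMDiffAt.comp (c x) h3))
      have hi' : ((i : ℕ) : WithTop ℕ∞) ≤ r := by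
        have : (i : ℕ∞) ≤ r := le_trans (by exact_mod_cast hi) hk
        exact_mod_cast this
      exact ContinuousAt.comp (f := fun z : ℝ × M => c z.2) (x := (s₀, x))
        (h5.continuousAt_iteratedFDeriv hi')
        (ContinuousAt.comp (f := Prod.snd) (g := c) hcx continuousAt_snd)
    exact (e1.sub e2).norm.eventually (gt_mem_nhds (hs₀' x hx i hi))
  filter_upwards [hmaps, hderiv] with s h1 h2 using ⟨h1, h2⟩

end SmoothFamilies

section Regularity

variable {E : Type*} [NormedAddCommGroup E] [NormedSpace ℝ E]
  {M : Type*} [TopologicalSpace M] [ChartedSpace E M] [IsManifold 𝓘(ℝ, E) ∞ M]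

omit [IsManifold 𝓘(ℝ, E) ∞ M] in
theorem contDiffAt_writtenInExtChartAt {f : M → M} {r : WithTop ℕ∞} (hf : ContMDiff 𝓘(ℝ, E) 𝓘(ℝ, E) r f)
    (x : M) : ContDiffAt ℝ r (writtenInExtChartAt 𝓘(ℝ, E) 𝓘(ℝ, E) x f)
      (extChartAt 𝓘(ℝ, E) x x) := by
  have h := (contMDiffAt_iff.1 (hf x)).2
  simpa [contDiffWithinAt_univ] using h

omit [IsManifold 𝓘(ℝ, E) ∞ M] in
theorem IsC1Plus.isLipschitz {f : M → M} (hf : IsC1Plus E f) : IsLipschitz E f :=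
  ⟨hf.1.continuous, fun x =>
    (contDiffAt_writtenInExtChartAt hf.1 x).exists_lipschitzOnWith⟩

omit [IsManifold 𝓘(ℝ, E) ∞ M] in
theorem isC1Plus_of_contMDiff {f : M → M} (hf : ContMDiff 𝓘(ℝ, E) 𝓘(ℝ, E) ∞ f) :
    IsC1Plus E f := by
  refine ⟨hf.of_le (by exact_mod_cast le_top), 1, one_pos, fun x => ?_⟩
  have h1 := (contDiffAt_writtenInExtChartAt hf x).fderiv_right (m := ∞) (by simp)
  obtain ⟨C, s, hs, h⟩ := (h1.of_le (by exact_mod_cast le_top)).exists_lipschitzOnWith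
  exact ⟨C, s, hs, holderOnWith_one.2 h⟩

omit [IsManifold 𝓘(ℝ, E) ∞ M] in
theorem IsSmoothDiffeo.isC1PlusDiffeo {f : M → M} (hf : IsSmoothDiffeo E f) : IsC1PlusDiffeo E f := by
  obtain ⟨h1, g, h2, h3, h4⟩ := hf
  exact ⟨isC1Plus_of_contMDiff h1, g, h2, h3, isC1Plus_of_contMDiff h4⟩

end Regularity

section ShearFamily

variable {n : ℕ} {N : Type*} [TopologicalSpace N] [ChartedSpace (EuclideanSpace ℝ (Fin n)) N]
  [Group N] [LieGroup (𝓡 n) ∞ N] {Γ : Subgroup N} [DiscreteTopology Γ]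
  {L : AnosovAutomorphism n Γ} (S : CentralFlow L)

theorem isSmoothBaseFunction_smul {φ : N ⧸ Γ → ℝ} (hφ : IsSmoothBaseFunction n Γ φ) (s : ℝ) :
    IsSmoothBaseFunction n Γ fun x => s * φ x :=
  ⟨(contDiff_const.mul contDiff_id : ContDiff ℝ ∞ fun t : ℝ => s * t).contMDiff.comp hφ.1,
    fun z hz x => congrArg (s * ·) (hφ.2 z hz x)⟩

theorem contMDiff_smul_family {φ : N ⧸ Γ → ℝ} (hφ : ContMDiff (𝓡 n) 𝓘(ℝ, ℝ) ∞ φ) :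
    ContMDiff (𝓘(ℝ, ℝ).prod (𝓡 n)) 𝓘(ℝ, ℝ) ∞ fun p : ℝ × (N ⧸ Γ) => p.1 * φ p.2 := by
  have h : ContDiff ℝ ∞ fun q : ℝ × ℝ => q.1 * q.2 := contDiff_fst.mul contDiff_snd
  exact h.contMDiff.comp (contMDiff_fst.prodMk_space (hφ.comp contMDiff_snd))

theorem tendsto_smul_crTopology {φ : N ⧸ Γ → ℝ} (hφ : IsSmoothBaseFunction n Γ φ) (r : ℕ∞) :
    Tendsto (fun (s : ℝ) (x : N ⧸ Γ) => s * φ x) (𝓝 0)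
      (@nhds (N ⧸ Γ → ℝ) (crTopology (EuclideanSpace ℝ (Fin n)) (N ⧸ Γ) ℝ ℝ r) fun _ => 0) := by
  have h := tendsto_crTopology (s₀ := 0) (F := fun (s : ℝ) (x : N ⧸ Γ) => s * φ x) (contMDiff_smul_family hφ.1) r
  simpa using h

theorem CentralFlow.tendsto_shear_crTopology {φ : N ⧸ Γ → ℝ} (hφ : IsSmoothBaseFunction n Γ φ)
    (r : ℕ∞) : Tendsto (fun s : ℝ => L.shear S.flow fun x => s * φ x) (𝓝 0)
      (@nhds (N ⧸ Γ → N ⧸ Γ) (crTopology (EuclideanSpace ℝ (Fin n)) (N ⧸ Γ)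
        (EuclideanSpace ℝ (Fin n)) (N ⧸ Γ) r) L.toFun) := by
  have h := tendsto_crTopology (s₀ := 0) (F := fun s : ℝ => L.shear S.flow fun x => s * φ x)
    (contMDiff_smul_quotient.comp
      ((S.isOneParameterSubgroup.contMDiff.comp (contMDiff_smul_family hφ.1)).prodMk
        (L.contMDiff_toFun.comp contMDiff_snd))) r
  have h0 : (L.shear S.flow fun x => 0 * φ x) = L.toFun := by
    funext x; simp [AnosovAutomorphism.shear, S.flow_zero]
  rwa [h0] at h

end ShearFamily


/-! ### Lipschitz maps in terms of small translations -/

section Displacement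

variable {n : ℕ} {N : Type*} [TopologicalSpace N] [ChartedSpace (EuclideanSpace ℝ (Fin n)) N]
  [Group N] [LieGroup (𝓡 n) ∞ N] {Γ : Subgroup N} [DiscreteTopology Γ]

theorem continuous_smul_quotient (n : ℕ) [ChartedSpace (EuclideanSpace ℝ (Fin n)) N]
    [LieGroup (𝓡 n) ∞ N] : Continuous fun p : N × (N ⧸ Γ) => p.1 • p.2 :=
  (contMDiff_smul_quotient (n := n)).continuous

/-- Points close to each other differ by a small translation. -/
theorem eventually_exists_smul_eq (n : ℕ) [ChartedSpace (EuclideanSpace ℝ (Fin n)) N]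
    [LieGroup (𝓡 n) ∞ N] {V : Set N} (hV : V ∈ 𝓝 (1 : N)) (x : N ⧸ Γ) :
    ∀ᶠ p : (N ⧸ Γ) × (N ⧸ Γ) in 𝓝 (x, x), ∃ m ∈ V, p.2 = m • p.1 := by
  have := isTopGroup n N
  obtain ⟨s, hs, hsx, hs1, -⟩ := exists_orbit_section (n := n) x
  have h1 : ContinuousAt (fun p : (N ⧸ Γ) × (N ⧸ Γ) => s p.2 * (s p.1)⁻¹) (x, x) :=
    (ContinuousAt.comp (f := Prod.snd) (g := s) hs.continuousAt continuousAt_snd).mul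
      (ContinuousAt.comp (f := Prod.fst) (g := s) hs.continuousAt continuousAt_fst).inv
  have h2 : ∀ᶠ p : (N ⧸ Γ) × (N ⧸ Γ) in 𝓝 (x, x), s p.2 * (s p.1)⁻¹ ∈ V :=
    h1.eventually (by simpa [hsx] using hV)
  filter_upwards [h2, (continuous_fst.tendsto (x, x)).eventually hs1,
    (continuous_snd.tendsto (x, x)).eventually hs1] with p hp h3 h4
  refine ⟨_, hp, ?_⟩
  calc p.2 = (s p.2 * (s p.1)⁻¹) • s p.1 • x := by rw [smul_smul, inv_mul_cancel_right, h4]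
    _ = _ := by rw [h3]

variable [CompactSpace (N ⧸ Γ)]

/-- Small elements act without fixed points. -/
theorem eventually_eq_one_of_smul_eq (n : ℕ) [ChartedSpace (EuclideanSpace ℝ (Fin n)) N]
    [LieGroup (𝓡 n) ∞ N] (Γ : Subgroup N) [DiscreteTopology Γ] [CompactSpace (N ⧸ Γ)] :
    ∀ᶠ g in 𝓝 (1 : N), ∀ x : N ⧸ Γ, g • x = x → g = 1 := by
  have := isTopGroup n N
  have : LocallyCompactSpace N := Manifold.locallyCompact_of_finiteDimensional (𝓡 n)
  obtain ⟨K, hK, hKΓ⟩ := exists_compact_interior_cover Γ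
  have hone : ({1} : Set Γ) ∈ 𝓝 (1 : Γ) := by simp
  rw [nhds_subtype_eq_comap, mem_comap] at hone
  obtain ⟨V, hV, hV'⟩ := hone
  -- The stabilizer of kΓ is kΓk⁻¹. Choosing k in a compact fundamental set keeps k⁻¹gk uniformly
  -- small, hence trivial once it lies in Γ.
  have h1 : ∀ᶠ g in 𝓝 (1 : N), ∀ k ∈ K, k⁻¹ * g * k ∈ V := by
    refine hK.eventually_forall_of_forall_eventually fun k _ => ?_
    have hc : Continuous fun p : N × N => p.2⁻¹ * p.1 * p.2 := by fun_prop
    exact hc.continuousAt.eventually (by simpa using hV)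
  filter_upwards [h1] with g hg x hx
  obtain ⟨y, rfl⟩ := QuotientGroup.mk_surjective x
  obtain ⟨γ, hγ, hy⟩ := hKΓ y
  set k := y * γ with hk
  have hyk : (y : N ⧸ Γ) = k := (QuotientGroup.mk_mul_of_mem y hγ).symm
  rw [hyk] at hx
  have h2 : k⁻¹ * (g * k) ∈ Γ := QuotientGroup.eq.1 hx.symm
  have h3 : k⁻¹ * g * k ∈ V := hg k (interior_subset hy)
  rw [← mul_assoc] at h2
  have h4 : k⁻¹ * g * k = 1 := congrArg Subtype.val (hV' (show (⟨_, h2⟩ : Γ) ∈ _ from h3))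
  have h5 : g = k * (k⁻¹ * g * k) * k⁻¹ := by group
  rw [h5, h4]; group

/-- Small translations are determined by their effect on a single point. This lets equations in the
quotient be lifted to N. -/
theorem eventually_eq_of_smul_eq (n : ℕ) [ChartedSpace (EuclideanSpace ℝ (Fin n)) N]
    [LieGroup (𝓡 n) ∞ N] (Γ : Subgroup N) [DiscreteTopology Γ] [CompactSpace (N ⧸ Γ)] :
    ∀ᶠ p : N × N in 𝓝 (1, 1), ∀ x : N ⧸ Γ, p.1 • x = p.2 • x → p.1 = p.2 := by
  have := isTopGroup n N
  have hc : Continuous fun p : N × N => p.2⁻¹ * p.1 := by fun_prop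
  have h := hc.tendsto' (1, 1) 1 (by simp)
  filter_upwards [h.eventually (eventually_eq_one_of_smul_eq n Γ)] with p hp x hx
  have h1 := hp x (by rw [mul_smul, hx, inv_smul_smul])
  rwa [inv_mul_eq_one, eq_comm] at h1

omit [LieGroup (𝓡 n) ∞ N] [ChartedSpace (EuclideanSpace ℝ (Fin n)) N] [DiscreteTopology Γ] in
-- Compactness replaces the local constants by one constant and one neighborhood of 1, valid for all
-- points of the quotient.
theorem exists_uniform_bound {P : ℝ → N → N ⧸ Γ → Prop}
    (hmono : ∀ K K' a x, K ≤ K' → P K a x → P K' a x)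
    (h : ∀ x₀, ∃ K, ∀ᶠ q : N × (N ⧸ Γ) in 𝓝 (1, x₀), P K q.1 q.2) :
    ∃ K, ∀ᶠ a in 𝓝 (1 : N), ∀ x, P K a x := by
  have key : ∃ K, ∀ᶠ a in 𝓝 (1 : N), ∀ x ∈ (univ : Set (N ⧸ Γ)), P K a x := by
    refine isCompact_univ.induction_on (p := fun s => ∃ K, ∀ᶠ a in 𝓝 (1 : N), ∀ x ∈ s, P K a x)
      ⟨0, by simp⟩ ?_ ?_ ?_
    · rintro s t hst ⟨K, hK⟩
      exact ⟨K, hK.mono fun a ha x hx => ha x (hst hx)⟩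
    · rintro s t ⟨K, hK⟩ ⟨K', hK'⟩
      refine ⟨max K K', ?_⟩
      filter_upwards [hK, hK'] with a h1 h2 x hx
      rcases hx with hx | hx
      · exact hmono _ _ _ _ (le_max_left _ _) (h1 x hx)
      · exact hmono _ _ _ _ (le_max_right _ _) (h2 x hx)
    · intro x _
      obtain ⟨K, hK⟩ := h x
      rw [nhds_prod_eq] at hK
      obtain ⟨pa, ha, pb, hb, hab⟩ := eventually_prod_iff.1 hK
      exact ⟨{y | pb y}, nhdsWithin_le_nhds hb, K, ha.mono fun a ha x hx => hab ha hx⟩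
  obtain ⟨K, hK⟩ := key
  exact ⟨K, hK.mono fun a ha x => ha x (mem_univ x)⟩

omit [CompactSpace (N ⧸ Γ)] in
theorem exists_displacement_in_charts (x₀ : N ⧸ Γ) : ∃ C : ℝ, 0 < C ∧
    ∀ᶠ q : N × (N ⧸ Γ) in 𝓝 (1, x₀), ‖extChartAt (𝓡 n) x₀ (q.1 • q.2) - extChartAt (𝓡 n) x₀ q.2‖ ≤
      C * ‖unitChart n q.1‖ := by
  have := isManifold_one (n := n) (N := N)
  obtain ⟨C, hC, h⟩ := exists_lipschitz_fst_in_charts (E₁ := Euc n) (E₂ := Euc n) (E₃ := Euc n)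
    (F := fun p : N × (N ⧸ Γ) => p.1 • p.2) (a := 1) (b := x₀)
    ((contMDiff_smul_quotient.of_le (by exact_mod_cast le_top)).contMDiffAt)
  refine ⟨C, hC, ?_⟩
  have ht : Tendsto (fun q : N × (N ⧸ Γ) => ((q.1, (1 : N)), q.2)) (𝓝 (1, x₀)) (𝓝 ((1, 1), x₀)) :=
    Continuous.tendsto' (by fun_prop) _ _ rfl
  filter_upwards [ht.eventually h] with q hq
  simpa using! hq

/-- The translation needed in the image is compared with the one in the source, both measured at the
identity of N. No distance on the quotient is involved. -/
theorem exists_displacement_le {k : N ⧸ Γ → N ⧸ Γ} (hk : IsLipschitz (Euc n) k) :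
    ∃ K : ℝ, ∀ᶠ a in 𝓝 (1 : N), ∀ x, ∃ m ∈ unitSource n N, k (a • x) = m • k x ∧
      ‖unitChart n m‖ ≤ K * ‖unitChart n a‖ := by
  have := isManifold_one (n := n) (N := N)
  have := isTopGroup n N
  refine exists_uniform_bound (P := fun K a x => ∃ m ∈ unitSource n N, k (a • x) = m • k x ∧
      ‖unitChart n m‖ ≤ K * ‖unitChart n a‖) ?_ fun x₀ => ?_
  · rintro K K' a x hKK' ⟨m, hm, h1, h2⟩
    exact ⟨m, hm, h1, h2.trans (by gcongr)⟩
  obtain ⟨C, hC, hCx⟩ := exists_displacement_in_charts (n := n) x₀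
  obtain ⟨hkc, hkL⟩ := hk
  obtain ⟨K, t, ht, hKt⟩ := hkL x₀
  obtain ⟨s, hs, hsx, hs1, -⟩ := exists_orbit_section (n := n) (k x₀)
  obtain ⟨C', hC', hC'x⟩ := exists_lipschitz_fst_in_charts (E₁ := Euc n) (E₂ := Euc n) (E₃ := Euc n)
    (F := fun p : (N ⧸ Γ) × (N ⧸ Γ) => s p.1 * (s p.2)⁻¹) (a := k x₀) (b := k x₀)
    ((((ContMDiffAt.comp (g := s) (k x₀, k x₀) hs contMDiffAt_fst).mul
      (ContMDiffAt.comp (g := s) (k x₀, k x₀) hs contMDiffAt_snd).inv)).of_le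
        (by exact_mod_cast le_top))
  have hact : Tendsto (fun q : N × (N ⧸ Γ) => q.1 • q.2) (𝓝 (1, x₀)) (𝓝 x₀) :=
    (continuous_smul_quotient n).tendsto' _ _ (by simp)
  have hact' : Tendsto (fun q : N × (N ⧸ Γ) => q.2) (𝓝 (1, x₀)) (𝓝 x₀) :=
    continuous_snd.tendsto' _ _ rfl
  have hk1 := (hkc.tendsto x₀).comp hact
  have hk2 := (hkc.tendsto x₀).comp hact'
  have he := continuousAt_extChartAt (I := 𝓡 n) x₀
  have hsrc := extChartAt_source_mem_nhds (I := 𝓡 n) x₀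
  have hone : s (k x₀) * (s (k x₀))⁻¹ = 1 := mul_inv_cancel _
  have hm : Tendsto (fun q : N × (N ⧸ Γ) => s (k (q.1 • q.2)) * (s (k q.2))⁻¹) (𝓝 (1, x₀)) (𝓝 1) := by
    have := (hs.continuousAt.tendsto.comp hk1).mul (hs.continuousAt.tendsto.comp hk2).inv
    rwa [hone] at this
  refine ⟨C' * (K * C), ?_⟩
  filter_upwards [hCx, hact.eventually (he.eventually ht), hact'.eventually (he.eventually ht),
    hact.eventually hsrc, hact'.eventually hsrc, hk1.eventually hs1, hk2.eventually hs1,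
    hm.eventually (unitSource_mem_nhds (n := n)),
    ((hk1.prodMk_nhds hk2).prodMk_nhds hk2).eventually hC'x]
    with q h1 h2 h3 h4 h5 h6 h7 h8 h9
  simp only [Function.comp_apply] at h6 h7 h9
  refine ⟨s (k (q.1 • q.2)) * (s (k q.2))⁻¹, h8, ?_, ?_⟩
  · calc k (q.1 • q.2) = (s (k (q.1 • q.2)) * (s (k q.2))⁻¹) • s (k q.2) • k x₀ := by
          rw [smul_smul, inv_mul_cancel_right, h6]
      _ = _ := by rw [h7]
  · have h10 := hKt.norm_sub_le h2 h3
    simp only [writtenInExtChartAt, Function.comp_apply] at h10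
    rw [(extChartAt 𝓘(ℝ, Euc n) x₀).left_inv h4, (extChartAt 𝓘(ℝ, Euc n) x₀).left_inv h5] at h10
    rw [hone, mul_inv_cancel] at h9
    calc ‖unitChart n (s (k (q.1 • q.2)) * (s (k q.2))⁻¹)‖
        ≤ C' * (K * (C * ‖unitChart n q.1‖)) := by
          refine h9.trans ?_
          gcongr
          exact h10.trans (by gcongr)
      _ = _ := by ring

theorem exists_function_displacement_le {θ : N ⧸ Γ → ℝ} (hθ : ContMDiff (𝓡 n) 𝓘(ℝ, ℝ) ∞ θ) :
    ∃ K : ℝ, ∀ᶠ a in 𝓝 (1 : N), ∀ x, |θ (a • x) - θ x| ≤ K * ‖unitChart n a‖ := by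
  have := isManifold_one (n := n) (N := N)
  refine exists_uniform_bound (P := fun K a x => |θ (a • x) - θ x| ≤ K * ‖unitChart n a‖) ?_
    fun x₀ => ?_
  · intro K K' a x hKK' h
    exact h.trans (by gcongr)
  obtain ⟨C, hC, h⟩ := exists_lipschitz_fst_in_charts (E₁ := Euc n) (E₂ := Euc n) (E₃ := ℝ)
    (F := fun p : N × (N ⧸ Γ) => θ (p.1 • p.2)) (a := 1) (b := x₀)
    (((hθ.comp contMDiff_smul_quotient).of_le (by exact_mod_cast le_top)).contMDiffAt)
  refine ⟨C, ?_⟩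
  have ht : Tendsto (fun q : N × (N ⧸ Γ) => ((q.1, (1 : N)), q.2)) (𝓝 (1, x₀)) (𝓝 ((1, 1), x₀)) :=
    Continuous.tendsto' (by fun_prop) _ _ rfl
  filter_upwards [ht.eventually h] with q hq
  simpa using! hq

end Displacement


/-! ### Expansivity and the centralizer of the automorphism -/

section Expansive

theorem nonpos_of_bounded_of_growth {a : ℕ → ℝ} {c : ℝ} (hc : 0 < c) {C : ℝ} (hC : ∀ j, a j ≤ C)
    (h : ∀ j, 0 < a j → (1 + c) * a j ≤ a (j + 1)) : a 0 ≤ 0 := by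
  by_contra! h0
  have h1 : ∀ j, (1 + c) ^ j * a 0 ≤ a j := by
    intro j
    induction j with
    | zero => simp
    | succ j ih =>
      have hpos : 0 < a j := lt_of_lt_of_le (by positivity) ih
      calc (1 + c) ^ (j + 1) * a 0 = (1 + c) * ((1 + c) ^ j * a 0) := by ring
        _ ≤ (1 + c) * a j := by gcongr
        _ ≤ _ := h j hpos
  have h2 := (tendsto_pow_atTop_atTop_of_one_lt (show (1 : ℝ) < 1 + c by linarith)).atTop_mul_const h0
  obtain ⟨j, hj⟩ := (h2.eventually_gt_atTop C).exists
  linarith [h1 j, hC j]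

/-- A positive value would grow exponentially in the future, and a negative one in the past. -/
theorem eq_zero_of_bounded_of_growth {q : ℤ → ℝ} {c : ℝ} (hc : 0 < c) {C : ℝ}
    (hC : ∀ k, |q k| ≤ C) (h : ∀ k, q k + c * |q k| ≤ q (k + 1)) (k : ℤ) : q k = 0 := by
  refine le_antisymm ?_ ?_
  · have := nonpos_of_bounded_of_growth (a := fun j => q (k + j)) hc
      (fun j => (le_abs_self _).trans (hC _)) fun j hj => by
        have h1 := h (k + j)
        rw [abs_of_pos hj] at h1
        push_cast
        rw [← add_assoc]
        linarith
    simpa using this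
  · have := nonpos_of_bounded_of_growth (a := fun j => -q (k - j)) hc
      (fun j => (neg_le_abs _).trans (hC _)) fun j hj => by
        have h1 := h (k - (j + 1 : ℕ))
        have h2 : k - ((j + 1 : ℕ) : ℤ) + 1 = k - j := by push_cast; ring
        rw [h2] at h1
        have h3 : -q (k - j) ≤ |q (k - (j + 1 : ℕ))| := by
          have := mul_nonneg hc.le (abs_nonneg (q (k - (j + 1 : ℕ))))
          linarith [neg_le_abs (q (k - (j + 1 : ℕ)))]
        have h4 := mul_le_mul_of_nonneg_left h3 hc.le
        linarith
    simpa using this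

variable {n : ℕ} {N : Type*} [TopologicalSpace N] [ChartedSpace (EuclideanSpace ℝ (Fin n)) N]
  [Group N] {Γ : Subgroup N}

namespace AnosovAutomorphism

variable {L : AnosovAutomorphism n Γ}

/-- A quadratic form that increases along the orbits of the differential. -/
def Eigenbasis.form (B : L.Eigenbasis) (v : Euc n) : ℝ :=
  ∑ i, SignType.sign (B.ev i ^ 2 - 1) * B.basis.repr v i ^ 2

/-- With the chosen signs, each eigencoordinate contributes its square times |ev² - 1|, which is
positive by hyperbolicity. -/
theorem Eigenbasis.exists_le_form_sub (B : L.Eigenbasis) : ∃ c : ℝ, 0 < c ∧ ∀ v, c * ‖v‖ ^ 2 ≤ B.form (L.deriv v) - B.form v := by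
  have hpos : ∀ i, 0 < |B.ev i ^ 2 - 1| := fun i => abs_pos.2 fun h => by
    have h1 : |B.ev i| ^ 2 = 1 := by rw [sq_abs]; linarith
    exact B.abs_ne_one i ((pow_eq_one_iff_of_nonneg (abs_nonneg _) two_ne_zero).1 h1)
  obtain ⟨m, hm, hmi⟩ : ∃ m : ℝ, 0 < m ∧ ∀ i, m ≤ |B.ev i ^ 2 - 1| := by
    have hs : 0 ≤ ∑ i, |B.ev i ^ 2 - 1|⁻¹ := Finset.sum_nonneg fun i _ => by positivity
    refine ⟨(∑ i, |B.ev i ^ 2 - 1|⁻¹ + 1)⁻¹, by positivity, fun i => ?_⟩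
    rw [inv_le_comm₀ (by positivity) (hpos i)]
    have := Finset.single_le_sum (f := fun i => |B.ev i ^ 2 - 1|⁻¹) (fun i _ => by positivity)
      (Finset.mem_univ i)
    linarith
  set R : ℝ := ∑ i, ‖B.basis i‖ ^ 2 with hR
  have hR0 : 0 ≤ R := Finset.sum_nonneg fun i _ => by positivity
  refine ⟨m / (R + 1), by positivity, fun v => ?_⟩
  have h1 : ‖v‖ ^ 2 ≤ (∑ i, B.basis.repr v i ^ 2) * R := by
    have h2 : ‖v‖ ≤ ∑ i, |B.basis.repr v i| * ‖B.basis i‖ := by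
      conv_lhs => rw [← B.basis.sum_repr v]
      refine (norm_sum_le _ _).trans (le_of_eq (Finset.sum_congr rfl fun i _ => ?_))
      rw [norm_smul, Real.norm_eq_abs]
    calc ‖v‖ ^ 2 ≤ (∑ i, |B.basis.repr v i| * ‖B.basis i‖) ^ 2 := by gcongr
      _ ≤ (∑ i, |B.basis.repr v i| ^ 2) * R := Finset.sum_mul_sq_le_sq_mul_sq _ _ _
      _ = _ := by simp only [sq_abs]
  have h3 : B.form (L.deriv v) - B.form v = ∑ i, |B.ev i ^ 2 - 1| * B.basis.repr v i ^ 2 := by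
    rw [Eigenbasis.form, Eigenbasis.form, ← Finset.sum_sub_distrib]
    refine Finset.sum_congr rfl fun i _ => ?_
    rw [B.coord_apply, ← sign_mul_self (B.ev i ^ 2 - 1)]
    ring
  rw [h3, div_mul_eq_mul_div, div_le_iff₀ (by positivity)]
  have h4 : 0 ≤ ∑ i, B.basis.repr v i ^ 2 := Finset.sum_nonneg fun i _ => sq_nonneg _
  calc m * ‖v‖ ^ 2 ≤ m * ((∑ i, B.basis.repr v i ^ 2) * R) := by gcongr
    _ ≤ m * ((∑ i, B.basis.repr v i ^ 2) * (R + 1)) := by gcongr; linarith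
    _ = (∑ i, m * B.basis.repr v i ^ 2) * (R + 1) := by rw [← Finset.mul_sum]; ring
    _ ≤ _ := by
      gcongr with i
      exact hmi i

theorem Eigenbasis.exists_form_sub_le (B : L.Eigenbasis) : ∃ K : ℝ, 0 < K ∧
    ∀ v w, |B.form v - B.form w| ≤ K * (‖v - w‖ * ‖v + w‖) := by
  set ℓ : Fin n → Euc n →L[ℝ] ℝ := fun i => LinearMap.toContinuousLinearMap (B.basis.coord i)
  have hℓ : ∀ i v, B.basis.repr v i = ℓ i v := fun i v => rfl
  refine ⟨(∑ i, ‖ℓ i‖ ^ 2) + 1, by positivity, fun v w => ?_⟩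
  rw [Eigenbasis.form, Eigenbasis.form, ← Finset.sum_sub_distrib]
  refine (Finset.abs_sum_le_sum_abs _ _).trans ?_
  calc ∑ i, |SignType.sign (B.ev i ^ 2 - 1) * B.basis.repr v i ^ 2 -
        SignType.sign (B.ev i ^ 2 - 1) * B.basis.repr w i ^ 2|
      ≤ ∑ i, ‖ℓ i‖ ^ 2 * (‖v - w‖ * ‖v + w‖) := by
        refine Finset.sum_le_sum fun i _ => ?_
        rw [← mul_sub, abs_mul, hℓ, hℓ]
        have h1 : |((SignType.sign (B.ev i ^ 2 - 1) : SignType) : ℝ)| ≤ 1 := by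
          rcases SignType.sign (B.ev i ^ 2 - 1) with _ | _ | _ <;> simp
        have h2 : ℓ i v ^ 2 - ℓ i w ^ 2 = ℓ i (v - w) * ℓ i (v + w) := by
          rw [map_sub, map_add]; ring
        rw [h2, abs_mul]
        calc _ ≤ 1 * (|ℓ i (v - w)| * |ℓ i (v + w)|) := by gcongr
          _ ≤ 1 * ((‖ℓ i‖ * ‖v - w‖) * (‖ℓ i‖ * ‖v + w‖)) := by
            gcongr
            · exact (ℓ i).le_opNorm _
            · exact (ℓ i).le_opNorm _
          _ = _ := by ring
    _ ≤ _ := by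
      rw [← Finset.sum_mul]
      gcongr
      linarith

theorem Eigenbasis.form_zero (B : L.Eigenbasis) : B.form 0 = 0 := by simp [Eigenbasis.form]

variable [LieGroup (𝓡 n) ∞ N]

omit [LieGroup (𝓡 n) ∞ N] in
theorem Eigenbasis.eventually_le_form_sub (B : L.Eigenbasis) : ∃ c : ℝ, 0 < c ∧ ∀ᶠ y in 𝓝 (1 : N),
    c * ‖unitChart n y‖ ^ 2 ≤ B.form (unitChart n (L.lift y)) - B.form (unitChart n y) := by
  obtain ⟨c, hc, h⟩ := B.exists_le_form_sub
  obtain ⟨K, hK, h'⟩ := B.exists_form_sub_le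
  -- With nonlinear error at most ε‖v‖, the factor ε ≤ 1 bounds ‖v' + Lv‖ by (2‖L‖ + 1)‖v‖, and the
  -- second bound makes the error in the form at most c/2 · ‖v‖².
  set ε : ℝ := min 1 (c / 2 / (K * (2 * ‖L.deriv‖ + 1))) with hε
  have hε0 : 0 < ε := by positivity
  have hε1 : ε ≤ 1 := min_le_left _ _
  have hε2 : K * (ε * (2 * ‖L.deriv‖ + 1)) ≤ c / 2 := by
    have h1 : ε ≤ c / 2 / (K * (2 * ‖L.deriv‖ + 1)) := min_le_right _ _
    rw [le_div_iff₀ (by positivity)] at h1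
    linarith
  refine ⟨c / 2, by positivity, ?_⟩
  filter_upwards [L.hasUnitDeriv.isLittleO.bound hε0] with y hy
  set v := unitChart n y
  set v' := unitChart n (L.lift y)
  have h1 : |B.form v' - B.form (L.deriv v)| ≤ c / 2 * ‖v‖ ^ 2 := by
    refine (h' _ _).trans ?_
    have h2 : ‖v' + L.deriv v‖ ≤ (2 * ‖L.deriv‖ + 1) * ‖v‖ := by
      have h3 : v' + L.deriv v = (v' - L.deriv v) + (2 : ℝ) • L.deriv v := by module
      rw [h3]
      refine (norm_add_le _ _).trans ?_
      rw [norm_smul, Real.norm_ofNat]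
      have h4 := L.deriv.le_opNorm v
      have h5 : ε * ‖v‖ ≤ 1 * ‖v‖ := by gcongr
      linarith
    calc K * (‖v' - L.deriv v‖ * ‖v' + L.deriv v‖)
        ≤ K * ((ε * ‖v‖) * ((2 * ‖L.deriv‖ + 1) * ‖v‖)) := by gcongr
      _ = K * (ε * (2 * ‖L.deriv‖ + 1)) * ‖v‖ ^ 2 := by ring
      _ ≤ _ := by gcongr
  have h2 := h v
  have h3 := (abs_le.1 h1).1
  linarith

omit [LieGroup (𝓡 n) ∞ N] in
/-- A full orbit of the automorphism near the identity is trivial. -/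
theorem Eigenbasis.exists_no_small_orbit (B : L.Eigenbasis) : ∃ V ∈ 𝓝 (1 : N), ∀ m : ℤ → N, (∀ k, m k ∈ V) →
    (∀ k, m (k + 1) = L.lift (m k)) → m 0 = 1 := by
  obtain ⟨c, hc, h⟩ := B.eventually_le_form_sub
  obtain ⟨K, hK, h'⟩ := B.exists_form_sub_le
  have hK' : ∀ v, |B.form v| ≤ K * ‖v‖ ^ 2 := fun v => by
    have := h' v 0
    simpa [B.form_zero, sq] using this
  have hb : ∀ᶠ y in 𝓝 (1 : N), K * ‖unitChart n y‖ ^ 2 < 1 := by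
    have h1 : Tendsto (fun y : N => K * ‖unitChart n y‖ ^ 2) (𝓝 1) (𝓝 (K * ‖(0 : Euc n)‖ ^ 2)) :=
      (tendsto_unitChart.norm.pow 2).const_mul K
    exact h1.eventually (gt_mem_nhds (by simp))
  refine ⟨_, inter_mem (inter_mem h hb) (unitSource_mem_nhds (n := n)), fun m hm hm' => ?_⟩
  -- The form is bounded along the orbit and increases by at least a multiple of its absolute value.
  -- It thus vanishes identically, and so do the coordinates.
  have hq := eq_zero_of_bounded_of_growth (q := fun k => B.form (unitChart n (m k))) (c := c / K)
    (by positivity) (C := 1) (fun k => (hK' _).trans (hm k).1.2.le) fun k => by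
      have h1 : c * ‖unitChart n (m k)‖ ^ 2 ≤ _ := (hm k).1.1
      rw [← hm'] at h1
      have h2 : c / K * |B.form (unitChart n (m k))| ≤ c * ‖unitChart n (m k)‖ ^ 2 := by
        rw [div_mul_eq_mul_div, div_le_iff₀ hK]
        have := mul_le_mul_of_nonneg_left (hK' (unitChart n (m k))) hc.le
        linarith
      linarith
  have h1 : c * ‖unitChart n (m 0)‖ ^ 2 ≤ _ := (hm 0).1.1
  rw [← hm', hq, hq] at h1
  have h2 : ‖unitChart n (m 0)‖ ^ 2 ≤ 0 := by nlinarith [sq_nonneg ‖unitChart n (m 0)‖]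
  have h3 : ‖unitChart n (m 0)‖ = 0 := pow_eq_zero_iff two_ne_zero |>.1 (le_antisymm h2 (sq_nonneg _))
  exact eq_one_of_unitChart (hm 0).2 (norm_eq_zero.1 h3)

variable [DiscreteTopology Γ] [CompactSpace (N ⧸ Γ)]

/-- Anosov automorphisms are expansive. -/
theorem Eigenbasis.exists_expansive (B : L.Eigenbasis) : ∃ V ∈ 𝓝 (1 : N), ∀ x y : ℤ → N ⧸ Γ,
    (∀ k, x (k + 1) = L.toFun (x k)) → (∀ k, y (k + 1) = L.toFun (y k)) →
    (∀ k, ∃ m ∈ V, y k = m • x k) → y 0 = x 0 := by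
  obtain ⟨V, hV, h⟩ := B.exists_no_small_orbit
  have h1 : Tendsto (fun p : N × N => (L.lift p.1, p.2)) (𝓝 (1, 1)) (𝓝 (1, 1)) := by
    refine Continuous.tendsto' ?_ _ _ (by simp)
    exact (L.contMDiff_lift.continuous.comp continuous_fst).prodMk continuous_snd
  have h2 := h1.eventually (eventually_eq_of_smul_eq n Γ)
  rw [nhds_prod_eq] at h2
  obtain ⟨pa, ha, pb, hb, hab⟩ := eventually_prod_iff.1 h2
  refine ⟨_, inter_mem hV (inter_mem ha hb), fun x y hx hy hxy => ?_⟩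
  choose m hm hmx using hxy
  -- Both m(k+1) and L(m(k)) are small and translate x(k+1) to y(k+1), so they agree. The
  -- displacements therefore form a full orbit near 1.
  have h3 := h m (fun k => (hm k).1) fun k => by
    refine (hab (hm k).2.1 (hm (k + 1)).2.2 (x (k + 1)) ?_).symm
    change L.lift (m k) • x (k + 1) = m (k + 1) • x (k + 1)
    rw [← hmx, hx, ← L.toFun_smul, ← hmx, hy]
  rw [hmx, h3, one_smul]

/-- Only countably many continuous maps commute with an Anosov automorphism. -/
theorem Eigenbasis.countable_centralizer (B : L.Eigenbasis) [T2Space N] [PreconnectedSpace N] :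
    {f : C(N ⧸ Γ, N ⧸ Γ) | ∀ x, f (L.toFun x) = L.toFun (f x)}.Countable := by
  have := isTopGroup n N
  have : SecondCountableTopology (N ⧸ Γ) := secondCountable_quotient (n := n)
  have : LocallyCompactSpace (N ⧸ Γ) := Manifold.locallyCompact_of_finiteDimensional (𝓡 n)
  obtain ⟨V, hV, h⟩ := B.exists_expansive
  set T := {f : C(N ⧸ Γ, N ⧸ Γ) | ∀ x, f (L.toFun x) = L.toFun (f x)} with hT
  -- Two uniformly close elements of the centralizer carry each full orbit to two orbits that stay
  -- close, so expansivity makes them equal. A discrete subset of the second countable space of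
  -- continuous maps is countable.
  have hdisc : DiscreteTopology T := by
    rw [discreteTopology_iff_isOpen_singleton]
    intro f
    rw [isOpen_iff_mem_nhds]
    rintro _ rfl
    rename_i f
    have h1 : ∀ᶠ g : C(N ⧸ Γ, N ⧸ Γ) in 𝓝 f.1, ∀ x ∈ (univ : Set (N ⧸ Γ)),
        ∃ m ∈ V, g x = m • f.1 x := by
      refine isCompact_univ.eventually_forall_of_forall_eventually fun x _ => ?_
      have h2 : Continuous fun z : C(N ⧸ Γ, N ⧸ Γ) × (N ⧸ Γ) => (f.1 z.2, z.1 z.2) :=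
        (f.1.continuous.comp continuous_snd).prodMk continuous_eval
      exact (h2.tendsto (f.1, x)).eventually (eventually_exists_smul_eq n hV (f.1 x))
    have h2 : ∀ᶠ g : T in 𝓝 f, ∀ x ∈ (univ : Set (N ⧸ Γ)), ∃ m ∈ V, g.1 x = m • f.1 x :=
      continuous_subtype_val.continuousAt.eventually h1
    filter_upwards [h2] with g hg
    refine Subtype.ext (ContinuousMap.ext fun z => ?_)
    let e : Equiv.Perm (N ⧸ Γ) := L.equiv
    have he : ∀ k : ℤ, (e ^ (k + 1)) z = L.toFun ((e ^ k) z) := fun k => by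
      rw [add_comm, zpow_one_add, Equiv.Perm.mul_apply]
      exact L.equiv_apply _
    have h3 := h (fun k => f.1 ((e ^ k) z)) (fun k => g.1 ((e ^ k) z))
      (fun k => by rw [he]; exact f.2 _) (fun k => by rw [he]; exact g.2 _)
      (fun k => hg _ (mem_univ _))
    simpa using h3
  have : Countable T := TopologicalSpace.separableSpace_iff_countable.1 inferInstance
  exact countable_coe_iff.1 this

end AnosovAutomorphism

end Expansive


/-! ### Two Lipschitz shears are incompatible -/

section Increments

/-- A continuous function with small increments along a sequence of steps is constant. -/
theorem eq_of_small_increments {f : ℝ → ℝ} (hf : Continuous f) {δ r : ℕ → ℝ} (hδ0 : ∀ i, δ i ≠ 0)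
    (hδ : Tendsto δ atTop (𝓝 0)) (hr : Tendsto (fun i => r i / |δ i|) atTop (𝓝 0))
    (h : ∀ᶠ i in atTop, ∀ t, |f (t + δ i) - f t| ≤ r i) (T : ℝ) : f T = f 0 := by
  have hnat : ∀ i, (∀ t, |f (t + δ i) - f t| ≤ r i) → ∀ (m : ℕ) t, |f (t + m * δ i) - f t| ≤ m * r i := by
    intro i hi m t
    induction m with
    | zero => simp
    | succ m ih =>
      have h1 := hi (t + m * δ i)
      have h2 : t + (m + 1 : ℕ) * δ i = t + m * δ i + δ i := by push_cast; ring
      rw [h2]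
      calc _ ≤ |f (t + m * δ i + δ i) - f (t + m * δ i)| + |f (t + m * δ i) - f t| :=
            abs_sub_le _ _ _
        _ ≤ r i + m * r i := add_le_add h1 ih
        _ = _ := by push_cast; ring
  have hint : ∀ i, (∀ t, |f (t + δ i) - f t| ≤ r i) → ∀ (j : ℤ), |f (j * δ i) - f 0| ≤ |(j : ℝ)| * r i := by
    intro i hi j
    obtain ⟨m, rfl | rfl⟩ := Int.eq_nat_or_neg j
    · simpa using hnat i hi m 0
    · have h1 := hnat i hi m (-(m * δ i))
      rw [neg_add_cancel, abs_sub_comm] at h1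
      simpa using h1
  have h1 : Tendsto (fun i => (⌊T / δ i⌋ : ℝ) * δ i) atTop (𝓝 T) := by
    rw [tendsto_iff_norm_sub_tendsto_zero]
    refine squeeze_zero (fun i => norm_nonneg _) (fun i => ?_) (tendsto_zero_iff_abs_tendsto_zero _ |>.1 hδ)
    have h2 : (⌊T / δ i⌋ : ℝ) * δ i - T = -(Int.fract (T / δ i) * δ i) := by
      rw [← Int.self_sub_floor, sub_mul, div_mul_cancel₀ _ (hδ0 i)]; ring
    rw [h2, norm_neg, norm_mul, Real.norm_eq_abs, Real.norm_eq_abs, abs_of_nonneg (Int.fract_nonneg _)]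
    exact mul_le_of_le_one_left (abs_nonneg _) (Int.fract_lt_one _).le
  have h2 : Tendsto (fun i => f ((⌊T / δ i⌋ : ℝ) * δ i)) atTop (𝓝 (f T)) := (hf.tendsto T).comp h1
  -- Reaching T takes at most |T|/|δ| + 1 steps, each changing f by at most r. The total is |T|
  -- r/|δ| + r, which tends to 0.
  have h3 : Tendsto (fun i => f ((⌊T / δ i⌋ : ℝ) * δ i)) atTop (𝓝 (f 0)) := by
    rw [tendsto_iff_norm_sub_tendsto_zero]
    have h4 : Tendsto (fun i => |T| * (r i / |δ i|) + r i / |δ i| * |δ i|) atTop (𝓝 0) := by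
      have := (hr.const_mul |T|).add (hr.mul (tendsto_zero_iff_abs_tendsto_zero _ |>.1 hδ))
      simpa using! this
    refine squeeze_zero' (Eventually.of_forall fun i => norm_nonneg _) ?_ h4
    filter_upwards [h] with i hi
    have hr0 : 0 ≤ r i := (abs_nonneg _).trans (hi 0)
    have hδi : 0 < |δ i| := abs_pos.2 (hδ0 i)
    refine (hint i hi _).trans ?_
    have h5 : |(⌊T / δ i⌋ : ℝ)| ≤ |T| / |δ i| + 1 := by
      rw [← abs_div]
      have h6 := Int.floor_le (T / δ i)
      have h7 := Int.lt_floor_add_one (T / δ i)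
      rw [abs_le]
      constructor
      · linarith [neg_abs_le (T / δ i)]
      · linarith [le_abs_self (T / δ i)]
    calc |(⌊T / δ i⌋ : ℝ)| * r i ≤ (|T| / |δ i| + 1) * r i := by gcongr
      _ = _ := by field_simp
  exact tendsto_nhds_unique h2 h3

end Increments

section Rigidity

variable {n : ℕ} {N : Type*} [TopologicalSpace N] [ChartedSpace (EuclideanSpace ℝ (Fin n)) N]
  [Group N]

theorem exists_norm_unitChart_lt_mem {W : Set N} (hW : W ∈ 𝓝 (1 : N)) :
    ∃ ε : ℝ, 0 < ε ∧ ∀ m ∈ unitSource n N, ‖unitChart n m‖ < ε → m ∈ W := by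
  have h1 : Tendsto (id : N → N) (𝓟 (unitSource n N) ⊓ comap (unitChart n) (𝓝 0)) (𝓝 1) :=
    tendsto_one_of_unitChart (mem_inf_of_left (mem_principal_self _)) (tendsto_comap.mono_left inf_le_right)
  have h2 := h1 hW
  rw [mem_map, mem_inf_iff] at h2
  obtain ⟨s, hs, t, ht, hst⟩ := h2
  obtain ⟨u, hu, hut⟩ := mem_comap.1 ht
  obtain ⟨ε, hε, hεu⟩ := Metric.mem_nhds_iff.1 hu
  refine ⟨ε, hε, fun m hm hmε => ?_⟩
  have : m ∈ id ⁻¹' W := hst ▸ ⟨hs hm, hut (hεu (by simpa using hmε))⟩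
  exact this

variable [LieGroup (𝓡 n) ∞ N] {Γ : Subgroup N} [DiscreteTopology Γ]

/-- Smooth functions separate points, so constancy of curves in the quotient can be tested on
real-valued functions. -/
theorem eq_of_smooth_functions (n : ℕ) [ChartedSpace (EuclideanSpace ℝ (Fin n)) N]
    [LieGroup (𝓡 n) ∞ N] [T2Space N] [CompactSpace (N ⧸ Γ)] {x y : N ⧸ Γ}
    (h : ∀ θ : N ⧸ Γ → ℝ, ContMDiff (𝓡 n) 𝓘(ℝ, ℝ) ∞ θ → θ x = θ y) : x = y := by
  have := isTopGroup n N
  by_contra hxy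
  obtain ⟨f, h0, h1, -⟩ := exists_contMDiffMap_zero_one_of_isClosed (n := ⊤) (𝓡 n)
    (isClosed_singleton (x := x)) (isClosed_singleton (x := y)) (by simpa using hxy)
  have := h f f.contMDiff
  rw [h0 rfl, h1 rfl] at this
  simp at this

variable [CompactSpace (N ⧸ Γ)]

theorem exists_function_displacement_of_norm_lt {θ : N ⧸ Γ → ℝ} (hθ : ContMDiff (𝓡 n) 𝓘(ℝ, ℝ) ∞ θ) :
    ∃ K ε : ℝ, 0 < K ∧ 0 < ε ∧ ∀ m ∈ unitSource n N, ‖unitChart n m‖ < ε → ∀ x,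
      |θ (m • x) - θ x| ≤ K * ‖unitChart n m‖ := by
  obtain ⟨K, hK⟩ := exists_function_displacement_le (n := n) hθ
  obtain ⟨ε, hε, h⟩ := exists_norm_unitChart_lt_mem (n := n) hK
  refine ⟨max K 1, ε, by positivity, hε, fun m hm hmε x => (h m hm hmε x).trans ?_⟩
  gcongr
  exact le_max_left _ _

/-- A Lipschitz map moves points by an amount controlled by the translation. -/
theorem exists_norm_unitChart_le_of_lipschitz {k : N ⧸ Γ → N ⧸ Γ} (hk : IsLipschitz (Euc n) k) :
    ∃ K : ℝ, 0 < K ∧ ∀ {ι : Type} (l : Filter ι) (x : ι → N ⧸ Γ) (b a : ι → N), Tendsto b l (𝓝 1) →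
      Tendsto a l (𝓝 1) → (∀ᶠ i in l, k (b i • x i) = a i • k (x i)) →
      ∀ᶠ i in l, ‖unitChart n (a i)‖ ≤ K * ‖unitChart n (b i)‖ := by
  obtain ⟨K, hK⟩ := exists_displacement_le hk
  refine ⟨max K 1, by positivity, fun l x b a hb ha h => ?_⟩
  have h1 := eventually_eq_of_smul_eq n Γ
  rw [nhds_prod_eq] at h1
  obtain ⟨pa, hpa, pb, hpb, hab⟩ := eventually_prod_iff.1 h1
  obtain ⟨ε, hε, hεm⟩ := exists_norm_unitChart_lt_mem (n := n) hpb
  have h2 : ∀ᶠ i in l, max K 1 * ‖unitChart n (b i)‖ < ε := by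
    have h3 : Tendsto (fun i => max K 1 * ‖unitChart n (b i)‖) l (𝓝 (max K 1 * ‖(0 : Euc n)‖)) :=
      ((tendsto_unitChart.comp hb).norm).const_mul _
    exact h3.eventually (gt_mem_nhds (by simpa using hε))
  filter_upwards [h2, hb.eventually hK, h, ha.eventually hpa] with i h2 h3 h4 h5
  obtain ⟨m, hm, hm1, hm2⟩ := h3 (x i)
  have h6 : ‖unitChart n m‖ ≤ max K 1 * ‖unitChart n (b i)‖ :=
    hm2.trans (by gcongr; exact le_max_left _ _)
  -- Uniqueness of small translations identifies the prescribed a i with the one supplied by the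
  -- Lipschitz estimate.
  have h7 : a i = m := hab h5 (hεm m hm (h6.trans_lt h2)) (k (x i)) (h4.symm.trans hm1)
  rw [h7]
  exact h6

/-- A one-parameter subgroup moves every point. -/
theorem IsOneParameterSubgroup.exists_smul_ne {c : ℝ → N} {v : Euc n}
    (hc : IsOneParameterSubgroup c v) (hv : v ≠ 0) (x : N ⧸ Γ) : ∃ t, c t • x ≠ x := by
  by_contra! h
  have h2 : ∀ᶠ t in 𝓝 (0 : ℝ), c t = 1 := by
    filter_upwards [hc.hasUnitDeriv.tendsto.eventually (eventually_eq_one_of_smul_eq n Γ)] with t ht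
      using ht x (h t)
  obtain ⟨t, ht, ht0⟩ := (((h2.and (hc.eventually_norm_unitChart hv)).filter_mono
    nhdsWithin_le_nhds).and (self_mem_nhdsWithin : {(0 : ℝ)}ᶜ ∈ 𝓝[≠] 0)).exists
  rw [ht.1, unitChart_one, norm_zero] at ht
  have h4 : 0 < ‖v‖ / 2 * |t| := by
    have := norm_pos_iff.2 hv
    have := abs_pos.2 ht0
    positivity
  linarith [ht.2]

namespace CentralFlow

variable {L : AnosovAutomorphism n Γ} (S : CentralFlow L)

variable [T2Space N]

/-- Both maps agree with G on the flow line of p, where ψ = 0. Moving off this line by b_i shifts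
the argument of G along the flow by -s q_i or -s' q_i. Comparing the two shows that G changes by
only O(‖b_i‖) = o(q_i) along flow steps of length (s' - s)q_i. So G is constant on the flow line,
against injectivity. -/
theorem not_isLipschitz_of_inverse_shears {ψ : N ⧸ Γ → ℝ}
    (hψ : ∀ t x, ψ (S.flow t • x) = ψ x) {p : N ⧸ Γ} (hp : ψ p = 0) {G : N ⧸ Γ → N ⧸ Γ}
    (hG : Continuous G) (hinj : Function.Injective G) {b : ℕ → N} (hb : Tendsto b atTop (𝓝 1))
    {q : ℕ → ℝ} (hq0 : ∀ i, q i ≠ 0) (hq : Tendsto q atTop (𝓝 0)) (hψq : ∀ i, ψ (b i • p) = q i)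
    (hbq : Tendsto (fun i => ‖unitChart n (b i)‖ / |q i|) atTop (𝓝 0)) {s s' : ℝ} (hs : s ≠ s')
    (hk : IsLipschitz (Euc n) fun x => G (S.flow (-(s * ψ x)) • x))
    (hk' : IsLipschitz (Euc n) fun x => G (S.flow (-(s' * ψ x)) • x)) : False := by
  have := isTopGroup n N
  obtain ⟨K, hK⟩ := exists_displacement_le hk
  obtain ⟨K', hK'⟩ := exists_displacement_le hk'
  have hss : s' - s ≠ 0 := sub_ne_zero.2 hs.symm
  have hflow : Continuous S.flow := S.isOneParameterSubgroup.contMDiff.continuous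
  set Q : ℝ → N ⧸ Γ := fun t => G (S.flow t • p) with hQ
  have hQc : Continuous Q :=
    hG.comp ((continuous_smul_quotient n).comp (hflow.prodMk continuous_const))
  have hψp : ∀ t, ψ (S.flow t • p) = 0 := fun t => (hψ t p).trans hp
  have hψb : ∀ i t, ψ (b i • S.flow t • p) = q i := fun i t => by
    rw [smul_smul, S.mul_flow, mul_smul, hψ, hψq]
  have hmove : ∀ i t s₀, S.flow (-(s₀ * q i)) • b i • S.flow t • p = (S.flow (t - s₀ * q i) * b i) • p :=
    fun i t s₀ => by
      rw [smul_smul, smul_smul, mul_assoc, S.mul_flow t, ← mul_assoc, ← S.flow_add]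
      congr 3
      ring
  have hconst : ∀ T, Q T = Q 0 := by
    refine fun T => eq_of_smooth_functions n fun θ hθ => ?_
    obtain ⟨C, ε, hC, hε, hθC⟩ := exists_function_displacement_of_norm_lt hθ
    have hsmall : ∀ K : ℝ, ∀ᶠ i in atTop, K * ‖unitChart n (b i)‖ < ε := fun K => by
      have h3 : Tendsto (fun i => K * ‖unitChart n (b i)‖) atTop (𝓝 (K * ‖(0 : Euc n)‖)) :=
        ((tendsto_unitChart.comp hb).norm).const_mul _
      exact h3.eventually (gt_mem_nhds (by simpa using hε))
    refine eq_of_small_increments (f := fun t => θ (Q t)) (hθ.continuous.comp hQc)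
      (δ := fun i => (s' - s) * q i) (r := fun i => C * (K + K') * ‖unitChart n (b i)‖)
      (fun i => mul_ne_zero hss (hq0 i)) (by simpa using hq.const_mul (s' - s)) ?_ ?_ T
    · have h1 := hbq.const_mul (C * (K + K') / |s' - s|)
      rw [mul_zero] at h1
      refine h1.congr fun i => ?_
      rw [abs_mul]
      have := abs_pos.2 hss
      have := abs_pos.2 (hq0 i)
      field_simp
    · filter_upwards [hsmall K, hsmall K', hb.eventually hK, hb.eventually hK'] with i h1 h2 h3 h4 t
      obtain ⟨m, hm, hm1, hm2⟩ := h3 (S.flow t • p)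
      obtain ⟨m', hm', hm1', hm2'⟩ := h4 (S.flow (t + (s' - s) * q i) • p)
      simp only [hψb, hψp, mul_zero, neg_zero, S.flow_zero, one_smul, hmove] at hm1 hm1'
      -- The second map is evaluated at a shifted starting time so that both land at the same image
      -- point G(flow(t - s q_i) b_i p).
      have h5 : t + (s' - s) * q i - s' * q i = t - s * q i := by ring
      rw [h5, hm1] at hm1'
      have h6 := hθC m hm (hm2.trans_lt h1) (Q t)
      have h7 := hθC m' hm' (hm2'.trans_lt h2) (Q (t + (s' - s) * q i))
      rw [← show m • Q t = m' • Q (t + (s' - s) * q i) from hm1', abs_sub_comm] at h7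
      calc |θ (Q (t + (s' - s) * q i)) - θ (Q t)|
          ≤ |θ (Q (t + (s' - s) * q i)) - θ (m • Q t)| + |θ (m • Q t) - θ (Q t)| := abs_sub_le _ _ _
        _ ≤ C * (K' * ‖unitChart n (b i)‖) + C * (K * ‖unitChart n (b i)‖) :=
            add_le_add (h7.trans (by gcongr)) (h6.trans (by gcongr))
        _ = _ := by ring
  obtain ⟨t, ht⟩ := S.isOneParameterSubgroup.exists_smul_ne S.dir_ne_zero p
  refine ht (hinj ((hconst t).trans ?_))
  simp [hQ, S.flow_zero]

end CentralFlow

end Rigidity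


section Shears

variable {n : ℕ} {N : Type*} [TopologicalSpace N] [ChartedSpace (EuclideanSpace ℝ (Fin n)) N]
  [Group N] [LieGroup (𝓡 n) ∞ N] {Γ : Subgroup N} [DiscreteTopology Γ] [CompactSpace (N ⧸ Γ)]

/-- The two Lipschitz bounds control flow(s q_i)e_i and flow(s' q_i)e_i by a multiple of ‖b_i‖. In
their quotient the unknown e_i cancels, leaving flow((s - s')q_i), whose size is comparable to |q_i|
and hence much larger than ‖b_i‖. -/
theorem CentralFlow.not_isLipschitz_of_shears {L : AnosovAutomorphism n Γ} (S : CentralFlow L)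
    {ψ : N ⧸ Γ → ℝ} {p : N ⧸ Γ} (hp : ψ p = 0) {g : N ⧸ Γ → N ⧸ Γ} {x₀ : N ⧸ Γ} (hx₀ : g x₀ = p)
    {b e : ℕ → N} (hb : Tendsto b atTop (𝓝 1)) (he : Tendsto e atTop (𝓝 1))
    (hbe : ∀ i, g (b i • x₀) = e i • p) {q : ℕ → ℝ} (hq0 : ∀ i, q i ≠ 0)
    (hq : Tendsto q atTop (𝓝 0)) (hψq : ∀ i, ψ (e i • p) = q i)
    (hbq : Tendsto (fun i => ‖unitChart n (b i)‖ / |q i|) atTop (𝓝 0)) {s s' : ℝ} (hs : s ≠ s')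
    (hk : IsLipschitz (Euc n) fun x => S.flow (s * ψ (g x)) • g x)
    (hk' : IsLipschitz (Euc n) fun x => S.flow (s' * ψ (g x)) • g x) : False := by
  have := isTopGroup n N
  have := isManifold_one (n := n) (N := N)
  have hss : s - s' ≠ 0 := sub_ne_zero.2 hs
  have hflow : Tendsto S.flow (𝓝 0) (𝓝 1) := S.isOneParameterSubgroup.hasUnitDeriv.tendsto
  have hA : ∀ s₀, Tendsto (fun i => S.flow (s₀ * q i) * e i) atTop (𝓝 1) := fun s₀ => by
    have h1 : Tendsto (fun i => s₀ * q i) atTop (𝓝 0) := by simpa using hq.const_mul s₀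
    simpa using (hflow.comp h1).mul he
  have key : ∀ s₀, IsLipschitz (Euc n) (fun x => S.flow (s₀ * ψ (g x)) • g x) → ∃ K, 0 < K ∧
      ∀ᶠ i in atTop, ‖unitChart n (S.flow (s₀ * q i) * e i)‖ ≤ K * ‖unitChart n (b i)‖ := by
    intro s₀ h
    obtain ⟨K, hK0, hK⟩ := exists_norm_unitChart_le_of_lipschitz h
    refine ⟨K, hK0, hK atTop (fun _ => x₀) b _ hb (hA s₀) (Eventually.of_forall fun i => ?_)⟩
    simp only [hbe, hψq, hx₀, hp, mul_zero, S.flow_zero, one_smul, mul_smul]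
  obtain ⟨K, hK0, hK⟩ := key s hk
  obtain ⟨K', hK0', hK'⟩ := key s' hk'
  obtain ⟨C, hC, hdiv⟩ := exists_lipschitz_fst_in_charts (E₁ := Euc n) (E₂ := Euc n) (E₃ := Euc n)
    (F := fun p : N × N => p.1 * p.2⁻¹) (a := 1) (b := 1)
    (((contMDiff_fst.mul contMDiff_snd.inv).of_le
      (show (1 : WithTop ℕ∞) ≤ ∞ by exact_mod_cast le_top)).contMDiffAt)
  have hdiv' := (((hA s).prodMk_nhds (hA s')).prodMk_nhds (hA s')).eventually hdiv
  have hlow : Tendsto (fun i => (s - s') * q i) atTop (𝓝 0) := by simpa using hq.const_mul (s - s')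
  have hlow' := hlow.eventually (S.isOneParameterSubgroup.eventually_norm_unitChart S.dir_ne_zero)
  have hfinal : ∀ᶠ i in atTop, ‖S.dir‖ / 2 * |s - s'| ≤
      C * (K + K') * (‖unitChart n (b i)‖ / |q i|) := by
    filter_upwards [hK, hK', hdiv', hlow'] with i h1 h2 h3 h4
    have h5 : S.flow (s * q i) * e i * (S.flow (s' * q i) * e i)⁻¹ = S.flow ((s - s') * q i) := by
      rw [mul_inv_rev, ← S.flow_neg, mul_assoc, mul_inv_cancel_left, ← S.flow_add]
      congr 1; ring
    simp only [h5, mul_inv_cancel, inv_one, mul_one] at h3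
    have h6 : ‖unitChart n (S.flow ((s - s') * q i))‖ ≤
        C * ‖unitChart n (S.flow (s * q i) * e i) - unitChart n (S.flow (s' * q i) * e i)‖ := by
      simpa [unitChart] using! h3
    have h7 : ‖S.dir‖ / 2 * |(s - s') * q i| ≤ C * (K * ‖unitChart n (b i)‖ + K' * ‖unitChart n (b i)‖) :=
      h4.trans (h6.trans (by gcongr; exact (norm_sub_le _ _).trans (add_le_add h1 h2)))
    rw [mul_div_assoc', le_div_iff₀ (abs_pos.2 (hq0 i)), mul_assoc, ← abs_mul]
    linarith
  have hlim := hbq.const_mul (C * (K + K'))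
  rw [mul_zero] at hlim
  have h8 := ge_of_tendsto hlim hfinal
  have h9 : 0 < ‖S.dir‖ / 2 * |s - s'| := by
    have := norm_pos_iff.2 S.dir_ne_zero
    have := abs_pos.2 hss
    positivity
  linarith

end Shears

/-! ### Velocities of central Lipschitz curves -/

section BlowUp

variable {n : ℕ} {N : Type*} [TopologicalSpace N] [ChartedSpace (EuclideanSpace ℝ (Fin n)) N]
  [Group N]

theorem HasUnitDeriv.tendsto_smul {f : N → N} {D : Euc n →L[ℝ] Euc n} (h : HasUnitDeriv f 1 D)
    {ι : Type*} {l : Filter ι} {y : ι → N} (hy : Tendsto y l (𝓝 1)) {r : ι → ℝ} {v : Euc n}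
    (hv : Tendsto (fun i => r i • unitChart n (y i)) l (𝓝 v)) :
    Tendsto (fun i => r i • unitChart n (f (y i))) l (𝓝 (D v)) := by
  have h1 := h.isLittleO.comp_tendsto hy
  have h2 : (fun i => r i • (unitChart n (f (y i)) - D (unitChart n (y i)))) =o[l]
      fun i => r i • unitChart n (y i) := (Asymptotics.isBigO_refl r l).smul_isLittleO h1
  have h3 := (Asymptotics.isLittleO_one_iff ℝ).1 (h2.trans_isBigO (hv.isBigO_one ℝ))
  have h4 := h3.add ((D.continuous.tendsto v).comp hv)
  rw [zero_add] at h4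
  refine h4.congr fun i => ?_
  simp only [Function.comp_apply, map_smul]
  module

/-- `v` is a velocity of the curve `c` at `t` along some sequence of times. -/
def IsBlowUp (c : ℝ → N) (t : ℝ) (v : Euc n) : Prop :=
  ∃ τ : ℕ → ℝ, (∀ j, τ j ≠ 0) ∧ Tendsto τ atTop (𝓝 0) ∧
    Tendsto (fun j => (τ j)⁻¹ • unitChart n (c (t + τ j) * (c t)⁻¹)) atTop (𝓝 v)

variable [LieGroup (𝓡 n) ∞ N] {c : ℝ → N}

theorem tendsto_increment (n : ℕ) [ChartedSpace (EuclideanSpace ℝ (Fin n)) N]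
    [LieGroup (𝓡 n) ∞ N] (hc : Continuous c) (t : ℝ) :
    Tendsto (fun τ => c (t + τ) * (c t)⁻¹) (𝓝 0) (𝓝 1) := by
  have := isTopGroup n N
  exact Continuous.tendsto' (by fun_prop) _ _ (by simp)

omit [LieGroup (𝓡 n) ∞ N] in
theorem exists_tendsto_increment {t K : ℝ}
    (hK : ∀ᶠ τ in 𝓝 (0 : ℝ), ‖unitChart n (c (t + τ) * (c t)⁻¹)‖ ≤ K * |τ|)
    {τ : ℕ → ℝ} (hτ0 : ∀ j, τ j ≠ 0) (hτ : Tendsto τ atTop (𝓝 0)) :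
    ∃ (v : Euc n) (φ : ℕ → ℕ), StrictMono φ ∧
      Tendsto (fun j => (τ (φ j))⁻¹ • unitChart n (c (t + τ (φ j)) * (c t)⁻¹)) atTop (𝓝 v) := by
  have h1 : ∀ᶠ j in atTop, (τ j)⁻¹ • unitChart n (c (t + τ j) * (c t)⁻¹) ∈
      Metric.closedBall (0 : Euc n) K := by
    filter_upwards [hτ.eventually hK] with j hj
    rw [mem_closedBall_zero_iff, norm_smul, norm_inv, Real.norm_eq_abs,
      inv_mul_le_iff₀ (abs_pos.2 (hτ0 j)), mul_comm]
    exact hj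
  obtain ⟨v, -, φ, hφ, hv⟩ := (isCompact_closedBall (0 : Euc n) K).tendsto_subseq' h1.frequently
  exact ⟨v, φ, hφ, hv⟩

/-- Since L(c(t)) = c(μt), the automorphism sends a velocity v at t to the velocity μ⁻¹L_*v at μt.
The set of all velocities is thereby invariant under a linear map. -/
theorem tendsto_blowUp_map {L : N ≃* N} {D : Euc n →L[ℝ] Euc n} (hL : HasUnitDeriv L 1 D)
    (hc : Continuous c) {μ : ℝ} (hμ : ∀ t, L (c t) = c (μ * t)) {τ : ℕ → ℝ}
    (hτ : Tendsto τ atTop (𝓝 0)) {t : ℝ} {v : Euc n}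
    (hv : Tendsto (fun j => (τ j)⁻¹ • unitChart n (c (t + τ j) * (c t)⁻¹)) atTop (𝓝 v)) :
    Tendsto (fun j => (μ * τ j)⁻¹ • unitChart n (c (μ * t + μ * τ j) * (c (μ * t))⁻¹)) atTop
      (𝓝 (μ⁻¹ • D v)) := by
  have h1 := (hL.tendsto_smul ((tendsto_increment n hc t).comp hτ) hv).const_smul μ⁻¹
  refine h1.congr fun j => ?_
  simp only [Function.comp_apply]
  rw [smul_smul, mul_inv, map_mul, map_inv, hμ, hμ, mul_add]

theorem IsBlowUp.adj_eq {t : ℝ} {v : Euc n} (hv : IsBlowUp c t v) (hc : Continuous c)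
    (hZ : ∀ t, c t ∈ Subgroup.center N) (y : N) : adj n y v = v := by
  obtain ⟨τ, -, hτ, hv⟩ := hv
  have h1 := (hasUnitDeriv_conj (n := n) y).tendsto_smul ((tendsto_increment n hc t).comp hτ) hv
  refine tendsto_nhds_unique h1 (hv.congr fun j => ?_)
  have h2 : c (t + τ j) * (c t)⁻¹ ∈ Subgroup.center N := mul_mem (hZ _) (inv_mem (hZ _))
  simp only [Function.comp_apply]
  congr 2
  rw [Subgroup.mem_center_iff.1 h2 y, mul_inv_cancel_right]

/-- For |q| > 1 a nonzero element would be blown up beyond the bound. For |q| < 1 every element is a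
deep iterate of bounded ones, hence arbitrarily small. -/
theorem eq_zero_of_scaling {X : Set ℝ} {C q : ℝ} (hX : ∀ x ∈ X, |x| ≤ C) (hq : |q| ≠ 1)
    (h1 : ∀ x ∈ X, q * x ∈ X) (h2 : ∀ x ∈ X, ∃ y ∈ X, x = q * y) : ∀ x ∈ X, x = 0 := by
  intro x hx
  rcases lt_or_gt_of_ne hq with h | h
  · have h3 : ∀ i : ℕ, ∃ y ∈ X, x = q ^ i * y := by
      intro i
      induction i with
      | zero => exact ⟨x, hx, by simp⟩
      | succ i ih =>
        obtain ⟨y, hy, hxy⟩ := ih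
        obtain ⟨z, hz, hyz⟩ := h2 y hy
        exact ⟨z, hz, by rw [hxy, hyz]; ring⟩
    have h4 : ∀ i : ℕ, |x| ≤ |q| ^ i * C := fun i => by
      obtain ⟨y, hy, hxy⟩ := h3 i
      rw [hxy, abs_mul, abs_pow]
      gcongr
      exact hX y hy
    have h5 := (tendsto_pow_atTop_nhds_zero_of_lt_one (abs_nonneg q) h).mul_const C
    rw [zero_mul] at h5
    exact abs_eq_zero.1 (le_antisymm (ge_of_tendsto' h5 h4) (abs_nonneg x))
  · have h3 : ∀ i : ℕ, q ^ i * x ∈ X := by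
      intro i
      induction i with
      | zero => simpa using hx
      | succ i ih => rw [pow_succ', mul_assoc]; exact h1 _ ih
    by_contra hx0
    have h4 := (tendsto_pow_atTop_atTop_of_one_lt h).atTop_mul_const (abs_pos.2 hx0)
    obtain ⟨i, hi⟩ := (h4.eventually_gt_atTop C).exists
    have h5 := hX _ (h3 i)
    rw [abs_mul, abs_pow] at h5
    linarith

variable {Γ : Subgroup N}

/-- A central Lipschitz curve on which the automorphism acts with the rate of a noncentral
eigenvector has no velocity. -/
theorem IsBlowUp.eq_zero {L : AnosovAutomorphism n Γ} (B : L.Eigenbasis) {u : Euc n} {μ : ℝ}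
    (hu : L.deriv u = μ • u) (hu0 : u ≠ 0) (hne : ∃ y : N, adj n y u ≠ u) (hc : Continuous c)
    (hμ0 : μ ≠ 0)
    (hZ : ∀ t, c t ∈ Subgroup.center N) (hμ : ∀ t, L.lift (c t) = c (μ * t)) {K : ℝ}
    (hK : ∀ t, ∀ᶠ τ in 𝓝 (0 : ℝ), ‖unitChart n (c (t + τ) * (c t)⁻¹)‖ ≤ K * |τ|) {t : ℝ} {v : Euc n}
    (hv : IsBlowUp c t v) : v = 0 := by
  have hbound : ∀ t (v : Euc n), IsBlowUp c t v → ‖v‖ ≤ K := by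
    rintro t v ⟨τ, hτ0, hτ, hv⟩
    refine le_of_tendsto hv.norm ?_
    filter_upwards [hτ.eventually (hK t)] with j hj
    rw [norm_smul, norm_inv, Real.norm_eq_abs, inv_mul_le_iff₀ (abs_pos.2 (hτ0 j)), mul_comm]
    exact hj
  have hfor : ∀ t (v : Euc n), IsBlowUp c t v → IsBlowUp c (μ * t) (μ⁻¹ • L.deriv v) := by
    rintro t v ⟨τ, hτ0, hτ, hv⟩
    refine ⟨fun j => μ * τ j, fun j => mul_ne_zero hμ0 (hτ0 j), by simpa using hτ.const_mul μ, ?_⟩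
    exact tendsto_blowUp_map L.hasUnitDeriv hc hμ hτ hv
  have hback : ∀ t (v : Euc n), IsBlowUp c t v → ∃ v', IsBlowUp c (μ⁻¹ * t) v' ∧ v = μ⁻¹ • L.deriv v' := by
    rintro t v ⟨τ, hτ0, hτ, hv⟩
    have hτ' : Tendsto (fun j => μ⁻¹ * τ j) atTop (𝓝 0) := by simpa using hτ.const_mul μ⁻¹
    have hτ0' : ∀ j, μ⁻¹ * τ j ≠ 0 := fun j => mul_ne_zero (inv_ne_zero hμ0) (hτ0 j)
    obtain ⟨v', φ, hφ, hv'⟩ := exists_tendsto_increment (hK (μ⁻¹ * t)) hτ0' hτ'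
    have hφτ := hτ'.comp hφ.tendsto_atTop
    refine ⟨v', ⟨_, fun j => hτ0' (φ j), hφτ, hv'⟩, ?_⟩
    have h1 := tendsto_blowUp_map L.hasUnitDeriv hc hμ hφτ hv'
    simp only [Function.comp_apply, mul_inv_cancel_left₀ hμ0] at h1
    exact tendsto_nhds_unique (hv.comp hφ.tendsto_atTop) h1
  obtain ⟨i₀, hi₀, hui, hui0⟩ := B.eigenvector hu hu0
  -- The i-th coordinates of all velocities at all times form a bounded set invariant in both
  -- directions under scaling by ev_i/μ, which has modulus different from 1 unless i is the index of
  -- u.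
  have hcoord : ∀ i, i ≠ i₀ → B.basis.repr v i = 0 := by
    intro i hi
    set ℓ : Euc n →L[ℝ] ℝ := LinearMap.toContinuousLinearMap (B.basis.coord i)
    have hℓ : ∀ v, B.basis.repr v i = ℓ v := fun v => rfl
    have hq : |μ⁻¹ * B.ev i| ≠ 1 := by
      rw [abs_mul, abs_inv, ← hi₀]
      intro h
      rw [inv_mul_eq_one₀ (by rw [hi₀]; exact abs_ne_zero.2 hμ0)] at h
      exact hi (B.abs_injective h.symm)
    refine eq_zero_of_scaling (X := {x | ∃ (t : ℝ) (v : Euc n), IsBlowUp c t v ∧ B.basis.repr v i = x})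
      (C := ‖ℓ‖ * K) ?_ hq ?_ ?_ _ ⟨t, v, hv, rfl⟩
    · rintro x ⟨t, v, hv, rfl⟩
      rw [hℓ]
      exact (ℓ.le_opNorm v).trans (by gcongr; exact hbound t v hv)
    · rintro x ⟨t, v, hv, rfl⟩
      refine ⟨_, _, hfor t v hv, ?_⟩
      rw [map_smul, Finsupp.smul_apply, B.coord_apply, smul_eq_mul, mul_assoc]
    · rintro x ⟨t, v, hv, rfl⟩
      obtain ⟨v', hv', h⟩ := hback t v hv
      refine ⟨_, ⟨_, v', hv', rfl⟩, ?_⟩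
      rw [h, map_smul, Finsupp.smul_apply, B.coord_apply, smul_eq_mul, mul_assoc]
  have hv1 : v = B.basis.repr v i₀ • B.basis i₀ := by
    conv_lhs => rw [← B.basis.sum_repr v]
    refine Finset.sum_eq_single i₀ (fun i _ hi => by rw [hcoord i hi, zero_smul]) (by simp)
  by_cases h0 : B.basis.repr v i₀ = 0
  · rw [hv1, h0, zero_smul]
  -- A nonzero velocity would be a multiple of u. Velocities of a central curve are fixed by Ad, but
  -- u is not.
  · exfalso
    obtain ⟨y, hy⟩ := hne
    have h1 := hv.adj_eq hc hZ y
    have h2 : u = (B.basis.repr u i₀ * (B.basis.repr v i₀)⁻¹) • v := by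
      have h3 : B.basis i₀ = (B.basis.repr v i₀)⁻¹ • v :=
        (eq_inv_smul_iff₀ h0).2 hv1.symm
      rw [mul_smul, ← h3]
      exact hui
    apply hy
    rw [h2, map_smul, h1]

variable [DiscreteTopology Γ] [CompactSpace (N ⧸ Γ)] [T2Space N]

/-- The Lipschitz map transfers the Lipschitz bound of the one-parameter subgroup d to c. By
compactness, increments of c have limiting velocities along subsequences. All of them vanish, so
smooth functions have zero derivative along c(t) • p. -/
theorem smul_eq_of_lipschitz_central {L : AnosovAutomorphism n Γ} (B : L.Eigenbasis) {u : Euc n}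
    {μ : ℝ} (hu : L.deriv u = μ • u) (hu0 : u ≠ 0) (hne : ∃ y : N, adj n y u ≠ u) (hμ0 : μ ≠ 0)
    {d : ℝ → N} (hd : IsOneParameterSubgroup d u) (hc : Continuous c)
    (hZ : ∀ t, c t ∈ Subgroup.center N) (hμ : ∀ t, L.lift (c t) = c (μ * t))
    {k : N ⧸ Γ → N ⧸ Γ} (hk : IsLipschitz (Euc n) k) {x₀ p : N ⧸ Γ}
    (hkc : ∀ t, k (d t • x₀) = c t • p) (t : ℝ) : c t • p = c 0 • p := by
  obtain ⟨K, hK0, hK⟩ := exists_norm_unitChart_le_of_lipschitz hk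
  obtain ⟨C, hC⟩ := hd.hasUnitDeriv.hasFDerivAt.isBigO_sub.bound
  simp only [hd.1, unitChart_one, sub_zero, Real.norm_eq_abs] at hC
  have hinc : ∀ t τ, (c (t + τ) * (c t)⁻¹) • c t • p = c (t + τ) • p := fun t τ => by
    rw [smul_smul, inv_mul_cancel_right]
  have hbd : ∀ t, ∀ᶠ τ in 𝓝 (0 : ℝ), ‖unitChart n (c (t + τ) * (c t)⁻¹)‖ ≤ K * C * |τ| := by
    intro t
    have h1 := hK (𝓝 (0 : ℝ)) (fun _ => d t • x₀) d _ hd.hasUnitDeriv.tendsto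
      (tendsto_increment n hc t) (Eventually.of_forall fun τ => by
        rw [smul_smul, ← hd.2.1, hkc, hkc, hinc, add_comm τ t])
    filter_upwards [h1, hC] with τ h1 h2
    exact h1.trans (by rw [mul_assoc]; gcongr)
  have hlittle : ∀ t, (fun τ => unitChart n (c (t + τ) * (c t)⁻¹)) =o[𝓝 0] fun τ : ℝ => τ := by
    intro t
    rw [Asymptotics.isLittleO_iff]
    intro ε hε
    by_contra hcon
    obtain ⟨τ, hτ, hτε⟩ := exists_seq_forall_of_frequently (not_eventually.1 hcon)
    have hτ0 : ∀ j, τ j ≠ 0 := fun j h => hτε j (by simp [h])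
    obtain ⟨v, φ, hφ, hv⟩ := exists_tendsto_increment (hbd t) hτ0 hτ
    have hv0 := IsBlowUp.eq_zero B hu hu0 hne hc hμ0 hZ hμ hbd
      ⟨_, fun j => hτ0 (φ j), hτ.comp hφ.tendsto_atTop, hv⟩
    have h1 : ε ≤ ‖v‖ := by
      refine ge_of_tendsto' hv.norm fun j => ?_
      rw [norm_smul, norm_inv, Real.norm_eq_abs, le_inv_mul_iff₀ (abs_pos.2 (hτ0 _)), mul_comm]
      exact (not_le.1 (hτε (φ j))).le
    rw [hv0, norm_zero] at h1
    linarith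
  refine eq_of_smooth_functions n fun θ hθ => ?_
  obtain ⟨C', hC'⟩ := exists_function_displacement_le (n := n) hθ
  have hderiv : ∀ t, HasDerivAt (fun t => θ (c t • p)) 0 t := by
    intro t
    rw [hasDerivAt_iff_isLittleO_nhds_zero]
    refine Asymptotics.IsBigO.trans_isLittleO ?_ (hlittle t)
    refine Asymptotics.IsBigO.of_bound C' ?_
    filter_upwards [(tendsto_increment n hc t).eventually hC'] with τ hτ
    have := hτ (c t • p)
    rw [hinc] at this
    simpa using this
  exact is_const_of_deriv_eq_zero (fun t => (hderiv t).differentiableAt)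
    (fun t => (hderiv t).deriv) t 0

end BlowUp


/-! ### Excluding every Lipschitz conjugacy -/

section NonRigidity

variable {n : ℕ} {N : Type*} [TopologicalSpace N] [ChartedSpace (EuclideanSpace ℝ (Fin n)) N]
  [Group N]

/-- The numerator is O(|μ|^{-i}) and the denominator is of order |r|^{-i}. The assumption |r| < |μ|
on the two eigenvalues enters here. -/
theorem IsOneParameterSubgroup.tendsto_ratio {d : ℝ → N} {u : Euc n}
    (hd : IsOneParameterSubgroup d u) {r μ : ℝ} (hr0 : r ≠ 0) (hlt : |r| < |μ|) (t : ℝ) {a : ℝ}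
    (ha : a ≠ 0) (h1 : 1 < |μ|) :
    Tendsto (fun i : ℕ => ‖unitChart n (d (μ⁻¹ ^ i * t))‖ / |r⁻¹ ^ i * a|) atTop (𝓝 0) := by
  obtain ⟨C, hC⟩ := hd.hasUnitDeriv.hasFDerivAt.isBigO_sub.bound
  simp only [hd.1, unitChart_one, sub_zero, Real.norm_eq_abs] at hC
  have hτ : Tendsto (fun i : ℕ => μ⁻¹ ^ i * t) atTop (𝓝 0) := by
    have := (tendsto_pow_atTop_nhds_zero_of_abs_lt_one (r := μ⁻¹)
      (by rw [abs_inv]; exact inv_lt_one_of_one_lt₀ h1)).mul_const t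
    rwa [zero_mul] at this
  have hμ : 0 < |μ| := by linarith
  have hlim : Tendsto (fun i : ℕ => C * |t| / |a| * (|r| / |μ|) ^ i) atTop (𝓝 0) := by
    have := (tendsto_pow_atTop_nhds_zero_of_lt_one (r := |r| / |μ|) (by positivity)
      ((div_lt_one hμ).2 hlt)).const_mul (C * |t| / |a|)
    rwa [mul_zero] at this
  refine squeeze_zero' (Eventually.of_forall fun i => by positivity) ?_ hlim
  filter_upwards [hτ.eventually hC] with i hi
  have hr := abs_pos.2 hr0
  have ha' := abs_pos.2 ha
  rw [div_le_iff₀ (abs_pos.2 (mul_ne_zero (pow_ne_zero _ (inv_ne_zero hr0)) ha))]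
  refine hi.trans (le_of_eq ?_)
  rw [abs_mul, abs_mul, abs_pow, abs_pow, abs_inv, abs_inv, div_pow, inv_pow, inv_pow]
  field_simp

variable [LieGroup (𝓡 n) ∞ N] {Γ : Subgroup N} [DiscreteTopology Γ]

/-- Curves in `N ⧸ Γ` lift to `N`. -/
theorem exists_unique_lift (n : ℕ) [ChartedSpace (EuclideanSpace ℝ (Fin n)) N]
    [LieGroup (𝓡 n) ∞ N] {Q : ℝ → N ⧸ Γ} (hQ : Continuous Q) (hQ0 : Q 0 = ((1 : N) : N ⧸ Γ)) :
    ∃ c : ℝ → N, (Continuous c ∧ c 0 = 1 ∧ ∀ t, (c t : N ⧸ Γ) = Q t) ∧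
      ∀ c' : ℝ → N, Continuous c' → c' 0 = 1 → (∀ t, (c' t : N ⧸ Γ) = Q t) → c' = c := by
  have := isTopGroup n N
  obtain ⟨F, ⟨h0, h1⟩, h2⟩ :=
    (Γ.isQuotientCoveringMap ⟨inferInstance⟩).isCoveringMap.existsUnique_continuousMap_lifts
      ⟨Q, hQ⟩ 0 (1 : N) hQ0.symm
  refine ⟨F, ⟨F.continuous, h0, fun t => congrFun h1 t⟩, fun c' hc hc0 hcQ => ?_⟩
  have := h2 ⟨c', hc⟩ ⟨hc0, funext hcQ⟩
  exact congrArg DFunLike.coe this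

variable {L : AnosovAutomorphism n Γ}

omit [LieGroup (𝓡 n) ∞ N] [DiscreteTopology Γ] in
theorem potential_mul (r s : ℝ) (φ : N ⧸ Γ → ℝ) (x : N ⧸ Γ) :
    L.potential r (fun y => s * φ y) x = s * L.potential r φ x := by
  simp only [AnosovAutomorphism.potential]
  rw [mul_neg, ← tsum_mul_left]
  congr 1
  exact tsum_congr fun k => by ring

namespace CentralFlow

variable (S : CentralFlow L) [CompactSpace (N ⧸ Γ)] [T2Space N] [PreconnectedSpace N]

omit [T2Space N] [PreconnectedSpace N] in
theorem shearConj_mul_apply {φ : N ⧸ Γ → ℝ} (hφ : IsSmoothBaseFunction n Γ φ) (s : ℝ) (x : N ⧸ Γ) :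
    S.shearConj (isSmoothBaseFunction_smul hφ s) x = S.flow (s * L.potential S.rate φ x) • x := by
  rw [← potential_mul]; rfl

omit [T2Space N] [PreconnectedSpace N] in
theorem shearConj_mul_symm_apply {φ : N ⧸ Γ → ℝ} (hφ : IsSmoothBaseFunction n Γ φ) (s : ℝ)
    (x : N ⧸ Γ) : (S.shearConj (isSmoothBaseFunction_smul hφ s)).symm x =
      S.flow (-(s * L.potential S.rate φ x)) • x := by
  rw [← potential_mul]; rfl

/-- Arbitrarily small multiples of some base function define shears for which no conjugacy is
Lipschitz. -/
theorem exists_base_function_not_isLipschitz [Group.IsNilpotent N] {u : Euc n} {μ : ℝ} (hu : L.deriv u = μ • u)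
    (hu0 : u ≠ 0) (hne : ∃ y : N, adj n y u ≠ u) (hlt : |S.rate| < |μ|) :
    ∃ f : N ⧸ Γ → ℝ, IsSmoothBaseFunction n Γ f ∧ ∀ s₀ > 0, ∃ s ∈ Ioo 0 s₀,
      ∀ h : (N ⧸ Γ) ≃ₜ (N ⧸ Γ), IsConjugacy h L.toFun (L.shear S.flow fun x => s * f x) →
        ¬ IsLipschitz (Euc n) h ∧ ¬ IsLipschitz (Euc n) h.symm := by
  have := isTopGroup n N
  have hμ1 : 1 < |μ| := S.one_lt_rate.trans hlt
  have hμ0 : μ ≠ 0 := by rintro rfl; simp at hμ1; linarith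
  obtain ⟨f, hf, -, hp, hjump⟩ := exists_base_function_potential_jump S.eigenbasis S.one_lt_rate
  refine ⟨f, hf, fun s₀ hs₀ => ?_⟩
  by_contra! hcon
  set ψ := L.potential S.rate f with hψ
  set p : N ⧸ Γ := ((1 : N) : N ⧸ Γ) with hpdef
  have hψZ : ∀ {z : N}, z ∈ Subgroup.center N → ∀ x, ψ (z • x) = ψ x := fun hz x =>
    potential_smul_center hf hz x
  have hsmulp : ∀ y : N, y • p = (y : N ⧸ Γ) := fun y => by
    change ((y * 1 : N) : N ⧸ Γ) = y
    rw [mul_one]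
  obtain ⟨d, hd⟩ := exists_isOneParameterSubgroup (n := n) (N := N) u
  have hdc : Continuous d := hd.contMDiff.continuous
  have hdL : ∀ t, L.lift (d t) = d (μ * t) :=
    hd.map_eigenvector L.lift.toMonoidHom L.hasUnitDeriv hu
  have hdZ : ∃ t, d t ∉ Subgroup.center N := by
    by_contra! h
    obtain ⟨y, hy⟩ := hne
    exact hy (hd.adj_of_mem_center (Eventually.of_forall h) y)
  have hτ : ∀ t : ℝ, Tendsto (fun i : ℕ => μ⁻¹ ^ i * t) atTop (𝓝 0) := fun t => by
    have := (tendsto_pow_atTop_nhds_zero_of_abs_lt_one (r := μ⁻¹)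
      (by rw [abs_inv]; exact inv_lt_one_of_one_lt₀ hμ1)).mul_const t
    rwa [zero_mul] at this
  have hq : ∀ a : ℝ, Tendsto (fun i : ℕ => S.rate⁻¹ ^ i * a) atTop (𝓝 0) := fun a => by
    have := (tendsto_pow_atTop_nhds_zero_of_abs_lt_one S.abs_inv_rate_lt_one).mul_const a
    rwa [zero_mul] at this
  have hq0 : ∀ {a : ℝ}, a ≠ 0 → ∀ i : ℕ, S.rate⁻¹ ^ i * a ≠ 0 := fun ha i =>
    mul_ne_zero (pow_ne_zero _ (inv_ne_zero S.rate_ne_zero)) ha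
  -- the conjugacies and the maps commuting with the automorphism that they define
  have hex : ∀ s : Ioo 0 s₀, ∃ h : (N ⧸ Γ) ≃ₜ (N ⧸ Γ),
      IsConjugacy h L.toFun (L.shear S.flow fun x => s.1 * f x) ∧
        (IsLipschitz (Euc n) h ∨ IsLipschitz (Euc n) h.symm) := fun s => by
    obtain ⟨h, hh, hL⟩ := hcon s.1 s.2
    exact ⟨h, hh, or_iff_not_imp_left.2 hL⟩
  choose h hh hLip using hex
  let k : Ioo 0 s₀ → (N ⧸ Γ) ≃ₜ (N ⧸ Γ) := fun s => S.shearConj (isSmoothBaseFunction_smul hf s.1)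
  have hk : ∀ s, IsConjugacy (k s) L.toFun (L.shear S.flow fun x => s.1 * f x) := fun s =>
    S.isConjugacy_shearConj _
  -- Any two conjugacies differ by a map commuting with L. Each hypothetical h is compared with the
  -- explicit conjugacy for the same parameter.
  let g : Ioo 0 s₀ → (N ⧸ Γ) ≃ₜ (N ⧸ Γ) := fun s => (h s).trans (k s).symm
  have hg : ∀ s x, g s (L.toFun x) = L.toFun (g s x) := fun s x => by
    change (k s).symm (h s (L.toFun x)) = L.toFun ((k s).symm (h s x))
    rw [Homeomorph.symm_apply_eq, hk, Homeomorph.apply_symm_apply, hh]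
  have hcount := S.eigenbasis.countable_centralizer
  have : Countable {f : C(N ⧸ Γ, N ⧸ Γ) | ∀ x, f (L.toFun x) = L.toFun (f x)} := hcount
  classical
  -- The Boolean records which of h and its inverse is Lipschitz, so a collision of Φ gives two
  -- parameters with the same g and the same alternative. A collision exists because the target is
  -- countable and the interval is not.
  let Φ : Ioo 0 s₀ → {f : C(N ⧸ Γ, N ⧸ Γ) | ∀ x, f (L.toFun x) = L.toFun (f x)} × Bool := fun s =>
    (⟨⟨g s, (g s).continuous⟩, hg s⟩, decide (IsLipschitz (Euc n) (h s)))
  have hninj : ¬ Function.Injective Φ := by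
    intro hinj
    have h1 : (Ioo 0 s₀).Countable := countable_coe_iff.1 hinj.countable
    exact absurd (Cardinal.Real.Ioo_countable_iff.1 h1) (not_le.2 hs₀)
  obtain ⟨s, s', hΦ, hss⟩ : ∃ s s', Φ s = Φ s' ∧ s ≠ s' := by
    rw [Function.Injective] at hninj
    push Not at hninj
    exact hninj
  have hss' : s.1 ≠ s'.1 := fun h => hss (Subtype.ext h)
  have hgg : ∀ x, g s x = g s' x := fun x =>
    congrArg (fun F : C(N ⧸ Γ, N ⧸ Γ) => F x) (congrArg Subtype.val (congrArg Prod.fst hΦ))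
  have htype : IsLipschitz (Euc n) (h s) ↔ IsLipschitz (Euc n) (h s') := by
    have := congrArg Prod.snd hΦ
    simpa [Φ] using this
  by_cases hcase : IsLipschitz (Euc n) (h s)
  · have hform : ∀ s x, h s x = S.flow (s.1 * ψ (g s x)) • g s x := fun s x => by
      have h1 := S.shearConj_mul_apply hf s.1 (g s x)
      rw [← h1]
      exact ((k s).apply_symm_apply (h s x)).symm
    have hL1 : IsLipschitz (Euc n) fun x => S.flow (s.1 * ψ (g s x)) • g s x := by
      rwa [← funext (hform s)]
    have hL2 : IsLipschitz (Euc n) fun x => S.flow (s'.1 * ψ (g s x)) • g s x := by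
      have h1 := htype.1 hcase
      rw [funext (hform s')] at h1
      simpa only [← hgg] using h1
    obtain ⟨x₀, hx₀⟩ := (g s).surjective p
    have hLp : L.toFun p = p := by rw [hpdef, L.toFun_mk, map_one]
    -- The preimage of the fixed point p under g is fixed by L, so the u-curve through it is
    -- rescaled by the automorphism.
    have hLx : L.toFun x₀ = x₀ := (g s).injective (by rw [hg, hx₀, hLp])
    have hQ : Continuous fun t => g s (d t • x₀) :=
      (g s).continuous.comp ((continuous_smul_quotient n).comp (hdc.prodMk continuous_const))
    obtain ⟨c, ⟨hc, hc0, hcQ⟩, -⟩ := exists_unique_lift n hQ (by rw [hd.1, one_smul, hx₀])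
    -- L∘c and c(μ·) lift the same curve in the quotient and start at 1, so uniqueness of lifts
    -- makes them equal.
    have hcL : ∀ t, L.lift (c t) = c (μ * t) := by
      obtain ⟨c₂, -, huniq⟩ := exists_unique_lift n (Q := fun t => g s (d (μ * t) • x₀))
        (hQ.comp (continuous_const_mul μ)) (by rw [mul_zero, hd.1, one_smul, hx₀])
      have e1 := huniq (fun t => L.lift (c t)) (L.contMDiff_lift.continuous.comp hc)
        (by rw [hc0, map_one]) fun t => by
          rw [← L.toFun_mk, hcQ, ← hg, L.toFun_smul, hLx, hdL]
      have e2 := huniq (fun t => c (μ * t)) (hc.comp (continuous_const_mul μ))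
        (by rw [mul_zero, hc0]) fun t => hcQ _
      exact fun t => congrFun (e1.trans e2.symm) t
    have hcp : ∀ t, g s (d t • x₀) = c t • p := fun t => by rw [hsmulp, hcQ]
    by_cases hcZ : ∀ t, c t ∈ Subgroup.center N
    -- On a central curve through p the potential vanishes, so the conjugacy restricted to the
    -- u-curve is t ↦ c(t) • p.
    · have h1 := smul_eq_of_lipschitz_central S.eigenbasis hu hu0 hne hμ0 hd hc hcZ hcL hL1
        (x₀ := x₀) (p := p) fun t => by
          rw [hcp, hψZ (hcZ t), hp, mul_zero, S.flow_zero, one_smul]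
      obtain ⟨t, ht⟩ := hd.exists_smul_ne hu0 x₀
      refine ht ((g s).injective ?_)
      rw [hcp, h1, hc0, one_smul, hx₀]
    · push Not at hcZ
      obtain ⟨t, a, ha, hta⟩ := hjump c μ hμ1 hc hc0 hcL hcZ
      exact S.not_isLipschitz_of_shears hp hx₀ (b := fun i => d (μ⁻¹ ^ i * t))
        (e := fun i => c (μ⁻¹ ^ i * t)) (hd.hasUnitDeriv.tendsto.comp (hτ t))
        ((hc.tendsto' 0 1 hc0).comp (hτ t)) (fun i => hcp _) (hq0 ha) (hq a)
        (fun i => by rw [hsmulp]; exact hta i)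
        (hd.tendsto_ratio S.rate_ne_zero hlt t ha hμ1) hss' hL1 hL2
  · have hform : ∀ s y, (h s).symm y = (g s).symm (S.flow (-(s.1 * ψ y)) • y) := fun s y => by
      have h1 := S.shearConj_mul_symm_apply hf s.1 y
      rw [← h1]
      change _ = (h s).symm (k s ((k s).symm y))
      rw [Homeomorph.apply_symm_apply]
    have hgg' : ∀ y, (g s').symm y = (g s).symm y := fun y => by
      rw [Homeomorph.symm_apply_eq, ← hgg, Homeomorph.apply_symm_apply]
    have hL1 : IsLipschitz (Euc n) fun y => (g s).symm (S.flow (-(s.1 * ψ y)) • y) := by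
      rw [← funext (hform s)]
      exact (hLip s).resolve_left hcase
    have hL2 : IsLipschitz (Euc n) fun y => (g s).symm (S.flow (-(s'.1 * ψ y)) • y) := by
      have h1 := (hLip s').resolve_left fun h => hcase (htype.2 h)
      rw [funext (hform s')] at h1
      simpa only [hgg'] using h1
    -- For inverses the shear acts before g⁻¹, so the oscillation is needed along the known curve
    -- exp(tu) itself rather than along a g-image.
    obtain ⟨t, a, ha, hta⟩ := hjump d μ hμ1 hdc hd.1 hdL hdZ
    exact S.not_isLipschitz_of_inverse_shears (fun t x => hψZ (S.mem_center t) x) hp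
      (g s).symm.continuous (g s).symm.injective (b := fun i => d (μ⁻¹ ^ i * t))
      (hd.hasUnitDeriv.tendsto.comp (hτ t)) (hq0 ha) (hq a)
      (fun i => by rw [hsmulp]; exact hta i)
      (hd.tendsto_ratio S.rate_ne_zero hlt t ha hμ1) hss' hL1 hL2

end CentralFlow

end NonRigidity

section Construction

variable {n : ℕ} {N : Type*} [TopologicalSpace N] [ChartedSpace (EuclideanSpace ℝ (Fin n)) N]
  [Group N] [LieGroup (𝓡 n) ∞ N] [T2Space N] [PreconnectedSpace N] {Γ : Subgroup N}

/-- Central unstable eigenvectors define central flows. -/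
theorem AnosovAutomorphism.exists_centralFlow (L : AnosovAutomorphism n Γ)
    (hL : L.HasSimpleSpectrum) {w : GroupLieAlgebra (𝓡 n) N} {r : ℝ}
    (hw : L.IsUnstableEigenvector w r)
    (hwz : w ∈ LieAlgebra.center ℝ (GroupLieAlgebra (𝓡 n) N)) :
    ∃ S : CentralFlow L, S.dir = w ∧ S.rate = r := by
  obtain ⟨B⟩ := AnosovAutomorphism.exists_eigenbasis L hL
  obtain ⟨c, hc⟩ := exists_isOneParameterSubgroup (n := n) (N := N) w
  have hd : L.deriv (w : Euc n) = r • (w : Euc n) := hw.1.apply_eq_smul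
  exact ⟨⟨B, c, w, r, hc, hc.mem_center_of_adj ((adj_apply_eq_self_iff (n := n) w).2 hwz),
    hc.map_eigenvector L.lift.toMonoidHom L.hasUnitDeriv hd, hd, hw.1.2, hw.2⟩, rfl, rfl⟩

end Construction


end Nilmanifold

end

theorem proposition8p1 {n : ℕ} {N : Type*} [TopologicalSpace N]
    [ChartedSpace (EuclideanSpace ℝ (Fin n)) N] [Group N] [LieGroup (𝓡 n) ∞ N]
    [T2Space N] [SimplyConnectedSpace N] [Group.IsNilpotent N]
    (Γ : Subgroup N) [DiscreteTopology Γ] [CompactSpace (N ⧸ Γ)]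
    [MeasurableSpace (N ⧸ Γ)] [BorelSpace (N ⧸ Γ)]
    -- the invariant volume of the nilmanifold, normalized
    (vol : Measure (N ⧸ Γ)) [IsProbabilityMeasure vol] [SMulInvariantMeasure N (N ⧸ Γ) vol]
    (L : AnosovAutomorphism n Γ) (hL : L.HasSimpleSpectrum)
    (w u : GroupLieAlgebra (𝓡 n) N) (lw lu : ℝ)
    (hw : L.IsUnstableEigenvector w lw)
    (hwz : w ∈ LieAlgebra.center ℝ (GroupLieAlgebra (𝓡 n) N))
    (hu : L.IsUnstableEigenvector u lu)
    (huz : u ∉ LieAlgebra.center ℝ (GroupLieAlgebra (𝓡 n) N))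
    (hlt : |lw| < |lu|) :
    ¬ LocallyLyapunovSpectrumRigid n Γ vol L.toFun ∧
    ¬ LocallyPeriodicDataRigid (EuclideanSpace ℝ (Fin n)) L.toFun ∧
    ∃ c : ℝ → N, IsOneParameterSubgroup c w ∧
      -- all shears have the same periodic data as `L`
      (∀ φ : N ⧸ Γ → ℝ, IsSmoothBaseFunction n Γ φ →
        IsSmoothDiffeo (EuclideanSpace ℝ (Fin n)) (L.shear c φ) ∧
        (∃ h : (N ⧸ Γ) ≃ₜ (N ⧸ Γ), IsConjugacy h L.toFun (L.shear c φ)) ∧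
        ∀ h : (N ⧸ Γ) ≃ₜ (N ⧸ Γ), IsConjugacy h L.toFun (L.shear c φ) →
          SamePeriodicData (EuclideanSpace ℝ (Fin n)) h L.toFun (L.shear c φ)) ∧
      -- arbitrarily small shears are not Lipschitz conjugate to `L`
      (∀ 𝒱 ∈ @nhds (N ⧸ Γ → ℝ)
          (crTopology (EuclideanSpace ℝ (Fin n)) (N ⧸ Γ) ℝ ℝ (⊤ : ℕ∞)) (fun _ => 0),
        ∀ 𝒲 ∈ @nhds (N ⧸ Γ → N ⧸ Γ) (crTopology (EuclideanSpace ℝ (Fin n)) (N ⧸ Γ)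
          (EuclideanSpace ℝ (Fin n)) (N ⧸ Γ) (⊤ : ℕ∞)) L.toFun,
        ∃ φ : N ⧸ Γ → ℝ, IsSmoothBaseFunction n Γ φ ∧ φ ∈ 𝒱 ∧ L.shear c φ ∈ 𝒲 ∧
          ∀ h : (N ⧸ Γ) ≃ₜ (N ⧸ Γ), IsConjugacy h L.toFun (L.shear c φ) →
            ¬ IsLipschitz (EuclideanSpace ℝ (Fin n)) h ∧
            ¬ IsLipschitz (EuclideanSpace ℝ (Fin n)) h.symm) := by
  obtain ⟨S, rfl, rfl⟩ := L.exists_centralFlow hL hw hwz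
  have hne : ∃ y : N, adj n y u ≠ u := by
    by_contra! h
    exact huz ((adj_apply_eq_self_iff (n := n) u).1 h)
  obtain ⟨f, hf, hf'⟩ :=
    S.exists_base_function_not_isLipschitz hu.1.apply_eq_smul hu.1.2 hne hlt
  -- Bad parameters occur in every interval (0, s₀), so one can be found satisfying any condition
  -- that holds for all s near 0.
  have hsmall : ∀ p : ℝ → Prop, (∀ᶠ s in 𝓝 0, p s) → ∃ s, p s ∧
      ∀ h : (N ⧸ Γ) ≃ₜ (N ⧸ Γ), IsConjugacy h L.toFun (L.shear S.flow fun x => s * f x) →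
        ¬ IsLipschitz (EuclideanSpace ℝ (Fin n)) h ∧
        ¬ IsLipschitz (EuclideanSpace ℝ (Fin n)) h.symm := by
    intro p hp
    obtain ⟨s₀, hs₀, h₀⟩ := Metric.eventually_nhds_iff.1 hp
    obtain ⟨s, hs, hs'⟩ := hf' s₀ hs₀
    refine ⟨s, h₀ ?_, hs'⟩
    rw [dist_zero_right, Real.norm_eq_abs, abs_of_pos hs.1]
    exact hs.2
  have hfs := isSmoothBaseFunction_smul hf
  refine ⟨?_, ?_, S.flow, S.isOneParameterSubgroup, fun φ hφ => ⟨S.isSmoothDiffeo_shear hφ,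
    ⟨S.shearConj hφ, S.isConjugacy_shearConj hφ⟩, fun h hh => S.samePeriodicData_shear hφ hh⟩,
    fun 𝒱 h𝒱 𝒲 h𝒲 => ?_⟩
  · rintro ⟨𝒰, h𝒰, hrigid⟩
    obtain ⟨s, hs, hs'⟩ := hsmall _ ((S.tendsto_shear_crTopology hf 1).eventually h𝒰)
    obtain ⟨h, hh, hreg⟩ := hrigid _ hs (S.isSmoothDiffeo_shear (hfs s)).isC1PlusDiffeo
      (S.measurePreserving_shear vol (hfs s))
      ⟨_, S.hasLyapunovSpectrum_toFun vol, S.hasLyapunovSpectrum_shear vol (hfs s)⟩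
    exact (hs' h hh).1 hreg.isLipschitz
  · rintro ⟨𝒰, h𝒰, hrigid⟩
    obtain ⟨s, hs, hs'⟩ := hsmall _ ((S.tendsto_shear_crTopology hf 1).eventually h𝒰)
    have hh := S.isConjugacy_shearConj (hfs s)
    exact (hs' _ hh).1 (hrigid _ hs (S.isSmoothDiffeo_shear (hfs s)).isC1PlusDiffeo _ hh
      (S.samePeriodicData_shear (hfs s) hh)).isLipschitz
  · obtain ⟨s, ⟨h1, h2⟩, hs'⟩ := hsmall _ (((tendsto_smul_crTopology hf ⊤).eventually h𝒱).and
      ((S.tendsto_shear_crTopology hf ⊤).eventually h𝒲))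
    exact ⟨_, hfs s, h1, h2, hs'⟩
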